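/- Let $A$ be an $n\times n$ Hermitian matrix (real or complex, $n\ge 1$) with eigenvalues $\lambda_1,\dots,\lambda_n$, orthonormal eigenvectors $u_1,\dots,u_n$, smallest eigenvalue $\lambda_{\min}$ and largest eigenvalue $\lambda_{\max}$. Let $\Phi(x)=\frac1n\sum_{i}\mathbb 1(\lambda_i\le x)$ be its cumulative empirical spectral measure (CESM). For a vector $v$ let $\Psi(x)=\sum_i |v^{\mathsf H}u_i|^2\,\mathbb 1(\lambda_i\le x)$ be the weighted CESM. Notation. $d_{\mathrm W}(\Upsilon_1,\Upsilon_2)=\int_{\mathbb R}|\Upsilon_1-\Upsilon_2|\,dx$, and $d_{\mathrm{TV}}(\Upsilon)=\int|d\Upsilon|$ is the total variation. A linear operator $f\mapsto[f]$ from functions to polynomials induces an approximation $[\Psi]$ of $\Psi$ by $\int f\,d[\Psi]:=\int [f]\,d\Psi$. For a probability distribution $\mu$ let $p_0,p_1,\dots$ be its orthonormal polynomials. Consider the following approximations of degree $s$. * Gaussian quadrature $[\Psi]^{\mathrm g}_{2k-1}$ ($k\ge1$, $s=2k-1$): $[f]$ is the interpolant of $f$ at the zeros of the degree-$k$ orthogonal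 polynomial of $\Psi$ itself. If $\Psi$ has only $N<k$ points of increase, $k$ is replaced by $N$ in this rule, so that $[\Psi]^{\mathrm g}_{2k-1}=\Psi$. * Quadrature by interpolation $[\Psi]^{\mathrm i}_s$: $[f]=[f]^{\mathrm i}_s$ is the interpolant of $f$ at the $s+1$ zeros of the degree-$(s+1)$ orthogonal polynomial of $\mu$. * Quadrature by approximation $[\Psi]^{\mathrm a}_s$: $[f]=[f]^{\mathrm a}_s=\sum_{i=0}^s\big(\int f p_i\,d\mu\big)p_i$. * Jackson-damped quadrature $[\Psi]^{\mathrm{d\text{-}a}}_s$, $[\Psi]^{\mathrm{d\text{-}i}}_s$ for the Chebyshev distribution $\mu=\mu^T_{a,b}$ with density $\frac{2}{\pi(b-a)}\big(1-(\tfrac{2x-a-b}{b-a})^2\big)^{-1/2}$ on $(a,b)$: $[f]=\sum_{i=0}^s\rho_i\big(\int f p_i\,d\mu\big)p_i$, respectively the same sum with $\int f p_i\,d\mu$ replaced by its $(s+1)$-point Gaussian quadrature for $\mu$, where $$\rho_i=\frac{(s-i+2)\cos\frac{i\pi}{s+2}+\sin\frac{i\pi}{s+2}\cot\frac{\pi}{s+2}}{s+2}.$$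 Theorem. Let $n_{\mathrm v}\ge1$, let $v_1,\dots,v_{n_{\mathrm v}}$ be independent and uniformly distributed on the real unit sphere $\mathbb S^{n-1}\subset\mathbb R^n$, let $\Psi_\ell$ be the weighted CESM of $v_\ell$, and for $\circ\in\{\mathrm g,\mathrm i,\mathrm a,\mathrm{d\text{-}i},\mathrm{d\text{-}a}\}$ let $\langle[\Psi_\ell]^\circ_s\rangle=\frac1{n_{\mathrm v}}\sum_{\ell}[\Psi_\ell]^\circ_s$ be the output of the prototypical algorithm. Let $\epsilon>0$ and $$\delta=2n\exp\Big(-\frac{n_{\mathrm v}(n+2)\epsilon^2}{4(\lambda_{\max}-\lambda_{\min})^2}\Big),\qquad \delta=0\ \text{ if }\lambda_{\max}=\lambda_{\min}.$$ 1. ($\circ=\mathrm g$.) If $k\ge1$ and $s=2k-1\ge -1+2\pi(\lambda_{\max}-\lambda_{\min})\epsilon^{-1}$, then $\mathbb P\big[d_{\mathrm W}(\Phi,\langle[\Psi_\ell]^{\mathrm g}_s\rangle)>\epsilon\big]\le\delta$. 2. ($\circ\in\{\mathrm i,\mathrm a\}$, $\mu$ arbitrary.) Let $[\lambda_{\min},\lambda_{\max}]\subset[a,b]$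 and let $\mu$ be any probability distribution supported in $[a,b]$. Let the degree $s\ge0$ be fixed or chosen depending on the sample, with $\mu$ having always at least $s+1$ points of support. Then $$\mathbb P\Big[\,s\ge -1+\pi\big(1+d_{\mathrm{TV}}(\langle[\Psi_\ell]^\circ_s\rangle)\big)(b-a)\epsilon^{-1}\ \text{ and }\ d_{\mathrm W}(\Phi,\langle[\Psi_\ell]^\circ_s\rangle)>\epsilon\Big]\le\delta .$$ In particular, if the inequality for $s$ holds almost surely, then $\mathbb P[d_{\mathrm W}(\Phi,\langle[\Psi_\ell]^\circ_s\rangle)>\epsilon]\le\delta$. 3. ($\circ\in\{\mathrm{d\text{-}i},\mathrm{d\text{-}a}\}$, $\mu=\mu^T_{a,b}$, Jackson's coefficients.) Let $a<b$ and $[\lambda_{\min},\lambda_{\max}]\subset[a,b]$. If $s\ge0$ and $s\ge -2+\pi^2(b-a)\epsilon^{-1}$, then $\mathbb P\big[d_{\mathrm W}(\Phi,\langle[\Psi_\ell]^\circ_s\rangle)>\epsilon\big]\le\delta$. -/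

import Mathlib

open MeasureTheory ProbabilityTheory Polynomial
open scoped ENNReal

noncomputable section

namespace RandQuad

/-! ### Distribution functions -/

/-- The Wasserstein (earth mover) distance `∫ |Υ₁ - Υ₂| dx` of two distribution functions, as an
extended nonnegative real. -/
def wassersteinDist (Υ₁ Υ₂ : ℝ → ℝ) : ℝ≥0∞ :=
  ∫⁻ x, ENNReal.ofReal |Υ₁ x - Υ₂ x|

/-- The total variation `∫ |dΥ|` of a distribution function. -/
def totalVar (Υ : ℝ → ℝ) : ℝ≥0∞ :=
  eVariationOn Υ Set.univ

/-- The average `⟨Υ_ℓ⟩ = (1/N) ∑_ℓ Υ_ℓ` of `N` distribution functions. -/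
def average {N : ℕ} (Υ : Fin N → ℝ → ℝ) : ℝ → ℝ :=
  fun x => (N : ℝ)⁻¹ * ∑ l, Υ l x

/-! ### Spectral distributions of a Hermitian matrix -/

section Spectral

variable {𝕜 : Type*} [RCLike 𝕜] {n : ℕ} {A : Matrix (Fin n) (Fin n) 𝕜}

/-- The largest eigenvalue. -/
def lamMax (hA : A.IsHermitian) : ℝ := ⨆ i, hA.eigenvalues i

/-- The smallest eigenvalue. -/
def lamMin (hA : A.IsHermitian) : ℝ := ⨅ i, hA.eigenvalues i

/-- The cumulative empirical spectral measure
`Φ(x) = ∑ i, (1/n) 1(λ_i ≤ x)`. -/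
def cesm (hA : A.IsHermitian) : ℝ → ℝ :=
  fun x => ∑ i, (1 / (n : ℝ)) * (if hA.eigenvalues i ≤ x then 1 else 0)

/-- The real vector `v`, regarded as a vector over `𝕜`. -/
def toField (𝕜 : Type*) [RCLike 𝕜] {n : ℕ} (v : EuclideanSpace ℝ (Fin n)) :
    EuclideanSpace 𝕜 (Fin n) :=
  WithLp.toLp 2 (fun j => ((v j : ℝ) : 𝕜))

/-- The weighted spectral measure `dΨ = ∑ i, |vᴴ u_i|² δ_{λ_i}`, where `u_i` are orthonormal
eigenvectors. Its distribution function `x ↦ ∑ i, |vᴴ u_i|² 1(λ_i ≤ x)` is the weighted CESM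
`Ψ`. -/
def weightedSpectralMeasure (hA : A.IsHermitian) (v : EuclideanSpace ℝ (Fin n)) : Measure ℝ :=
  ∑ i, ENNReal.ofReal (‖inner 𝕜 (toField 𝕜 v) (hA.eigenvectorBasis i)‖ ^ 2) •
    Measure.dirac (hA.eigenvalues i)

end Spectral

/-- The uniform distribution on the real unit sphere of `ℝⁿ`, as a measure on `ℝⁿ`. -/
def unifSphere (n : ℕ) : Measure (EuclideanSpace ℝ (Fin n)) :=
  (ProbabilityTheory.cond
    (volume : Measure (EuclideanSpace ℝ (Fin n))).toSphere Set.univ).map Subtype.val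

/-! ### Orthogonal polynomials -/

/-- The monic orthogonal polynomials of `μ`: Gram–Schmidt applied to the monomials
`1, x, x², …` in the inner product `∫ f g dμ`, without normalization. -/
def monicOrth (μ : Measure ℝ) (i : ℕ) : ℝ[X] :=
  X ^ i - ∑ j : Fin i,
    C ((∫ x, x ^ i * (monicOrth μ j).eval x ∂μ) / (∫ x, ((monicOrth μ j).eval x) ^ 2 ∂μ)) *
      monicOrth μ j
termination_by i
decreasing_by all_goals exact j.2

/-- The orthonormal polynomials `p_i` of `μ` (with positive leading coefficient). -/
def orthPoly (μ : Measure ℝ) (i : ℕ) : ℝ[X] :=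
  C (Real.sqrt (∫ x, ((monicOrth μ i).eval x) ^ 2 ∂μ))⁻¹ * monicOrth μ i

/-- The zeros of the degree `k` orthogonal polynomial of `μ`. -/
def orthNodes (μ : Measure ℝ) (k : ℕ) : Finset ℝ :=
  (monicOrth μ k).roots.toFinset

/-! ### Polynomial approximation operators `f ↦ [f]_s` -/

/-- The polynomial interpolating `f` at the given nodes. -/
def interpAt (nodes : Finset ℝ) (f : ℝ → ℝ) : ℝ[X] :=
  Lagrange.interpolate nodes id f

/-- `[f]_s^i`: the polynomial of degree at most `s` interpolating `f` at the zeros of the degree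
`s + 1` orthogonal polynomial of `μ`. -/
def opInterp (μ : Measure ℝ) (s : ℕ) (f : ℝ → ℝ) : ℝ[X] :=
  interpAt (orthNodes μ (s + 1)) f

/-- `[f]_s^a`: the `μ`-orthogonal projection `∑_{i ≤ s} (∫ f p_i dμ) p_i`. -/
def opApprox (μ : Measure ℝ) (s : ℕ) (f : ℝ → ℝ) : ℝ[X] :=
  ∑ i ∈ Finset.range (s + 1), C (∫ x, f x * (orthPoly μ i).eval x ∂μ) * orthPoly μ i

/-- The number of nodes of the `k`-point Gaussian quadrature rule of `ν`: it is `k` as long as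
`p_0, …, p_{k-1}` exist. If `ν` has only `N < k` points of support, it is `N` (the Lanczos
recurrence terminates after `N` steps). -/
def gaussCount (ν : Measure ℝ) (k : ℕ) : ℕ :=
  open Classical in
  Nat.findGreatest (fun j => ∀ i < j, ∫ x, ((monicOrth ν i).eval x) ^ 2 ∂ν ≠ 0) k

/-- The nodes of the `k`-point Gaussian quadrature rule of `ν`. -/
def gaussNodes (ν : Measure ℝ) (k : ℕ) : Finset ℝ :=
  orthNodes ν (gaussCount ν k)

/-- The integral `∫ f d[ν]^g_{2k-1}` against the `k`-point Gaussian quadrature rule of `ν`. -/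
def gaussIntegral (ν : Measure ℝ) (k : ℕ) (f : ℝ → ℝ) : ℝ :=
  ∫ x, (interpAt (gaussNodes ν k) f).eval x ∂ν

/-- Jackson's damping coefficients `ρ_i^J`, `i = 0, …, s`. -/
def jackson (s i : ℕ) : ℝ :=
  (((s : ℝ) - i + 2) * Real.cos (i * Real.pi / (s + 2)) +
    Real.sin (i * Real.pi / (s + 2)) * Real.cot (Real.pi / (s + 2))) / (s + 2)

/-- `[f]_s^{d-a}` with Jackson's coefficients: `x ↦ ∫ P_x f dμ`, where
`P_x(y) = ∑_{i ≤ s} ρ_i p_i(x) p_i(y)`. -/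
def opDampedApprox (μ : Measure ℝ) (s : ℕ) (f : ℝ → ℝ) : ℝ[X] :=
  ∑ i ∈ Finset.range (s + 1),
    C (jackson s i * ∫ x, f x * (orthPoly μ i).eval x ∂μ) * orthPoly μ i

/-- `[f]_s^{d-i}` with Jackson's coefficients: `x ↦ ∫ P_x f d[μ]^g_{2s+1}`, the integral being
against the `(s+1)`-point Gaussian quadrature rule of `μ`. -/
def opDampedInterp (μ : Measure ℝ) (s : ℕ) (f : ℝ → ℝ) : ℝ[X] :=
  ∑ i ∈ Finset.range (s + 1),
    C (jackson s i * gaussIntegral μ (s + 1) (fun x => f x * (orthPoly μ i).eval x)) *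
      orthPoly μ i

/-- The Chebyshev distribution of the first kind `μ^T_{a,b}`. -/
def chebMeasure (a b : ℝ) : Measure ℝ :=
  (volume.restrict (Set.Ioo a b)).withDensity fun t =>
    ENNReal.ofReal (2 / (Real.pi * (b - a)) *
      (1 / Real.sqrt (1 - (2 / (b - a) * t - (b + a) / (b - a)) ^ 2)))

/-! ### Quadrature approximations `[Ψ]_s` -/

/-- The distribution function of the quadrature approximation of `ν` that is induced by a linear
operator `f ↦ [f]` through `∫ f d[ν] = ∫ [f] dν`; that is, its value at `x` is given by this
relation with `f = 1_{(-∞, x]}`. -/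
def inducedQuad (op : (ℝ → ℝ) → ℝ[X]) (ν : Measure ℝ) : ℝ → ℝ :=
  fun x => ∫ y, (op (Set.indicator (Set.Iic x) fun _ => 1)).eval y ∂ν

/-- `[ν]_{2k-1}^g`: Gaussian quadrature with `k` nodes. -/
def quadGauss (k : ℕ) (ν : Measure ℝ) : ℝ → ℝ := inducedQuad (interpAt (gaussNodes ν k)) ν

/-- `[ν]_s^i`: quadrature by interpolation. -/
def quadInterp (μ : Measure ℝ) (s : ℕ) (ν : Measure ℝ) : ℝ → ℝ := inducedQuad (opInterp μ s) ν

/-- `[ν]_s^a`: quadrature by approximation. -/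
def quadApprox (μ : Measure ℝ) (s : ℕ) (ν : Measure ℝ) : ℝ → ℝ := inducedQuad (opApprox μ s) ν

/-- `[ν]_s^{d-i}`: Jackson-damped quadrature by interpolation for `μ^T_{a,b}`. -/
def quadDampedInterp (a b : ℝ) (s : ℕ) (ν : Measure ℝ) : ℝ → ℝ :=
  inducedQuad (opDampedInterp (chebMeasure a b) s) ν

/-- `[ν]_s^{d-a}`: Jackson-damped quadrature by approximation for `μ^T_{a,b}`. -/
def quadDampedApprox (a b : ℝ) (s : ℕ) (ν : Measure ℝ) : ℝ → ℝ :=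
  inducedQuad (opDampedApprox (chebMeasure a b) s) ν

/-- The output `⟨[Ψ_ℓ]_s⟩` of the prototypical algorithm for the sampled vectors `v_ℓ` and the
quadrature approximation `Q : Ψ ↦ [Ψ]_s`. -/
def protoOutput {𝕜 : Type*} [RCLike 𝕜] {n N : ℕ} {A : Matrix (Fin n) (Fin n) 𝕜}
    (hA : A.IsHermitian) (Q : Measure ℝ → ℝ → ℝ) (v : Fin N → EuclideanSpace ℝ (Fin n)) : ℝ → ℝ :=
  average fun l => Q (weightedSpectralMeasure hA (v l))

/-- The failure probability `2n exp(-N (n+2) ε² / (4 w²))`, where `w` is the width of the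
spectrum, with the convention `exp(-∞) = 0` for `w = 0`. -/
def failureBound (n N : ℕ) (w ε : ℝ) : ℝ :=
  if w = 0 then 0
  else 2 * n * Real.exp (-((N : ℝ) * (n + 2) * ε ^ 2 / (4 * w ^ 2)))

end RandQuad

end

/-! The error splits by the triangle inequality through the averaged weighted CESM `avgCDF`: a
sampling error `Φ` versus `avgCDF`, and a quadrature error `avgCDF` versus the output. The
quadrature error is at most `ε / 2` for every sample of unit vectors that meets the degree
condition, so failure forces a sampling error above `ε / 2`. This event involves no quadrature rule,
hence degrees chosen from the sample cost nothing (`lt_wassersteinDist_avgCDF`,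
`measure_le_failureBound`).

Sampling. For fixed `x`, `Ψ(x)` is a real quadratic form in `v` with eigenvalues in `[0, 1]` and
trace `n Φ(x)` (`exists_diagForm`). If the eigenvalues are 0 or 1, it is the squared norm of a
projection of a uniform unit vector and has Beta moments; Kummer's differential equation for the
moment generating function yields the variance proxy `1 / (2 (n + 2))` (`mgf_le_of_moments`).
Convexity in the eigenvalues extends this to the whole cube, which complex eigenvectors require. A
Chernoff bound for the sum and a union bound over the `n` eigenvalues, where the two step functions
jump, give `2 n exp(...)`; both agree outside `[λ_min, λ_max)`, which turns a pointwise bound into a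
Wasserstein bound.

Quadrature. By Kantorovich–Rubinstein duality (`lintegral_abs_sub_le_of_lipschitz`) it suffices to
integrate 1-Lipschitz `f`. Jackson's theorem (`exists_poly_abs_sub_le`) supplies a polynomial of
degree at most `s` within `M = π (b - a) / (2 (s + 2))` of `f`. A rule exact in degree `s` then has
error at most `M (1 + total variation)`. Gaussian rules have nonnegative weights of sum 1, so their
error is at most `2 M`. The Jackson-damped operators are themselves within `M` of `f`, so no total
variation enters. Jackson's theorem rests on a nonnegative kernel, whose coefficients are
autocorrelations of a sine sequence, with a small second moment. -/

namespace RandQuad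

/-! ### Distribution functions of signed measures with a density -/

section Density

variable {κ : Measure ℝ} {w : ℝ → ℝ}

lemma measurable_setIntegral_Iic [IsFiniteMeasure κ] (hw : Measurable w) :
    Measurable fun x => ∫ y in Set.Iic x, w y ∂κ := by
  have h : (fun x => ∫ y in Set.Iic x, w y ∂κ) =
      fun x => ∫ y, Set.indicator {p : ℝ × ℝ | p.2 ≤ p.1} (fun p => w p.2) (x, y) ∂κ := by
    funext x
    rw [← integral_indicator measurableSet_Iic]
    rfl
  rw [h]
  have hm : StronglyMeasurable (Set.indicator {p : ℝ × ℝ | p.2 ≤ p.1} (fun p => w p.2)) :=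
    ((hw.comp measurable_snd).indicator
      (measurableSet_le measurable_snd measurable_fst)).stronglyMeasurable
  exact (hm.integral_prod_right' (ν := κ)).measurable

/-- Fubini on the region `y ≤ x`, that is, integration by parts. Concentration on `[a, b]` is what
lets the inner integral start at `y` and end at `b`. -/
lemma integral_mul_setIntegral_Iic {a b : ℝ} (hab : a ≤ b) [IsFiniteMeasure κ]
    (hκ : κ (Set.Icc a b)ᶜ = 0) (hw : Integrable w κ) {g : ℝ → ℝ} (hg : Measurable g)
    (hg1 : ∀ x, |g x| ≤ 1) :
    ∫ x in a..b, g x * (∫ y in Set.Iic x, w y ∂κ) = ∫ y, (∫ x in y..b, g x) * w y ∂κ := by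
  rw [intervalIntegral.integral_of_le hab]
  set F : ℝ × ℝ → ℝ := Set.indicator {p : ℝ × ℝ | p.2 ≤ p.1} (fun p => g p.1 * w p.2) with hF
  have hint : Integrable F ((volume.restrict (Set.Ioc a b)).prod κ) := by
    have h0 : Integrable (fun p : ℝ × ℝ => w p.2) ((volume.restrict (Set.Ioc a b)).prod κ) :=
      hw.comp_snd _
    refine (h0.norm.mono' ?_ (Filter.Eventually.of_forall fun p => ?_)).indicator
      (measurableSet_le measurable_snd measurable_fst)
    · exact (hg.comp measurable_fst).aestronglyMeasurable.mul h0.1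
    · simp only [norm_mul, Real.norm_eq_abs]
      exact mul_le_of_le_one_left (abs_nonneg _) (hg1 _)
  have h1 : ∀ x, g x * (∫ y in Set.Iic x, w y ∂κ) = ∫ y, F (x, y) ∂κ := by
    intro x
    rw [← integral_indicator measurableSet_Iic, ← integral_const_mul]
    congr 1
    funext y
    by_cases h : y ≤ x <;> simp [hF, Set.indicator, h]
  simp_rw [h1]
  rw [integral_integral_swap (f := fun x y => F (x, y)) hint]
  refine integral_congr_ae ?_
  have hae : ∀ᵐ y ∂κ, y ∈ Set.Icc a b := hκ
  filter_upwards [hae] with y hy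
  have h2 : ∀ x, F (x, y) = Set.indicator (Set.Ici y) g x * w y := by
    intro x
    by_cases h : y ≤ x <;> simp [hF, Set.indicator, h]
  simp_rw [h2]
  rw [integral_mul_const, intervalIntegral.integral_of_le hy.2,
    integral_indicator measurableSet_Ici,
    Measure.restrict_restrict measurableSet_Ici]
  congr 1
  have hset : Set.Ioi y ∩ Set.Ioc a b = Set.Ioc y b := by
    ext x
    simp only [Set.mem_inter_iff, Set.mem_Ioi, Set.mem_Ioc]
    exact ⟨fun h => ⟨h.1, h.2.2⟩, fun h => ⟨h.1, hy.1.trans_lt h.1, h.2⟩⟩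
  rw [← hset]
  exact setIntegral_congr_set (Ioi_ae_eq_Ici.symm.inter (ae_eq_refl _))

lemma lipschitzWith_integral_of_abs_le_one {g : ℝ → ℝ} (hg : Measurable g) (hg1 : ∀ x, |g x| ≤ 1)
    (b : ℝ) : LipschitzWith 1 fun y => ∫ x in y..b, g x := by
  have hi : ∀ u v : ℝ, IntervalIntegrable g volume u v := fun u v =>
    (intervalIntegrable_const (c := (1 : ℝ))).mono_fun hg.aestronglyMeasurable
      (Filter.Eventually.of_forall fun x => by simpa using hg1 x)
  refine LipschitzWith.of_dist_le_mul fun y z => ?_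
  have h1 : (∫ x in y..b, g x) - ∫ x in z..b, g x = ∫ x in y..z, g x := by
    rw [← intervalIntegral.integral_add_adjacent_intervals (hi y z) (hi z b)]
    ring
  rw [Real.dist_eq, Real.dist_eq, h1, NNReal.coe_one, abs_sub_comm y z]
  exact intervalIntegral.norm_integral_le_of_norm_le_const (f := g) (C := 1) fun x _ => by
    simpa using hg1 x

/-- Kantorovich–Rubinstein duality, in the direction that bounds the Wasserstein distance. -/
lemma lintegral_abs_sub_le_of_lipschitz {a b : ℝ} (hab : a ≤ b) {ν : Measure ℝ}
    [IsFiniteMeasure ν] [IsFiniteMeasure κ]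
    (hν : ν (Set.Icc a b)ᶜ = 0) (hκ : κ (Set.Icc a b)ᶜ = 0)
    {u : ℝ → ℝ} (hum : Measurable u) (hu : Integrable u ν)
    (hwm : Measurable w) (hw : Integrable w κ) (hmass : ∫ y, u y ∂ν = ∫ y, w y ∂κ) {M : ℝ}
    (h : ∀ f : ℝ → ℝ, LipschitzWith 1 f → ∫ y, f y * u y ∂ν - ∫ y, f y * w y ∂κ ≤ M) :
    ∫⁻ x, ENNReal.ofReal |(∫ y in Set.Iic x, u y ∂ν) - ∫ y in Set.Iic x, w y ∂κ| ≤
      ENNReal.ofReal M := by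
  set D : ℝ → ℝ := fun x => (∫ y in Set.Iic x, u y ∂ν) - ∫ y in Set.Iic x, w y ∂κ with hD
  have hDm : Measurable D := (measurable_setIntegral_Iic hum).sub (measurable_setIntegral_Iic hwm)
  have hbd : ∀ x, |D x| ≤ (∫ y, |u y| ∂ν) + ∫ y, |w y| ∂κ := by
    intro x
    refine (abs_sub _ _).trans (add_le_add ?_ ?_)
    · exact (abs_integral_le_integral_abs).trans
        (setIntegral_le_integral hu.abs (Filter.Eventually.of_forall fun _ => abs_nonneg _))
    · exact (abs_integral_le_integral_abs).trans
        (setIntegral_le_integral hw.abs (Filter.Eventually.of_forall fun _ => abs_nonneg _))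
  have hlow : ∀ {θ : Measure ℝ} {r : ℝ → ℝ}, θ (Set.Icc a b)ᶜ = 0 → ∀ x < a,
      ∫ y in Set.Iic x, r y ∂θ = 0 := by
    intro θ r hθ x hx
    refine setIntegral_measure_zero _ (measure_mono_null ?_ hθ)
    intro y hy hy'
    exact absurd (hy'.1.trans hy) (not_le.2 hx)
  have hhigh : ∀ {θ : Measure ℝ} {r : ℝ → ℝ}, θ (Set.Icc a b)ᶜ = 0 → ∀ x ≥ b,
      ∫ y in Set.Iic x, r y ∂θ = ∫ y, r y ∂θ := by
    intro θ r hθ x hx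
    have : ∀ᵐ y ∂θ, y ∈ Set.Iic x := by
      have h' : ∀ᵐ y ∂θ, y ∈ Set.Icc a b := hθ
      filter_upwards [h'] with y hy using hy.2.trans hx
    rw [Measure.restrict_eq_self_of_ae_mem this]
  -- To the right of `b` this is the equality of total masses.
  have hD0 : ∀ x ∉ Set.Icc a b, D x = 0 := by
    intro x hx
    by_cases hxa : x < a
    · simp only [hD]; rw [hlow hν x hxa, hlow hκ x hxa, sub_zero]
    · have : b ≤ x := by
        by_contra hb
        exact hx ⟨not_lt.1 hxa, (not_le.1 hb).le⟩
      simp only [hD]; rw [hhigh hν x this, hhigh hκ x this, hmass, sub_self]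
  have hset : ∫⁻ x, ENNReal.ofReal |D x| = ∫⁻ x in Set.Ioc a b, ENNReal.ofReal |D x| := by
    rw [restrict_Ioc_eq_restrict_Icc]
    rw [← lintegral_indicator measurableSet_Icc]
    congr 1
    funext x
    by_cases hx : x ∈ Set.Icc a b
    · simp [hx]
    · simp [hx, hD0 x hx]
  have hDi : ∀ g : ℝ → ℝ, Measurable g → (∀ x, |g x| ≤ 1) → ∀ {θ : Measure ℝ} {r : ℝ → ℝ},
      IsFiniteMeasure θ → Measurable r → Integrable r θ →
      IntervalIntegrable (fun x => g x * ∫ y in Set.Iic x, r y ∂θ) volume a b := by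
    intro g hg hg1 θ r _ hrm hr
    refine (intervalIntegrable_const (c := ∫ y, |r y| ∂θ)).mono_fun
      (hg.mul (measurable_setIntegral_Iic hrm)).aestronglyMeasurable
      (Filter.Eventually.of_forall fun x => ?_)
    simp only [norm_mul, Real.norm_eq_abs]
    rw [abs_of_nonneg (integral_nonneg fun _ => abs_nonneg _)]
    refine (mul_le_of_le_one_left (abs_nonneg _) (hg1 x)).trans ?_
    exact (abs_integral_le_integral_abs).trans
        (setIntegral_le_integral hr.abs (Filter.Eventually.of_forall fun _ => abs_nonneg _))
  -- With `g` the sign of `D`, the integral of `|D| = g D` becomes a difference of integrals of the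
  -- 1-Lipschitz test function `y ↦ ∫ x in y..b, g x`.
  set g : ℝ → ℝ := fun x => if 0 ≤ D x then 1 else -1 with hg
  have hgm : Measurable g :=
    Measurable.ite (measurableSet_le measurable_const hDm) measurable_const measurable_const
  have hg1 : ∀ x, |g x| ≤ 1 := by intro x; simp only [hg]; split_ifs <;> simp
  have hgD : ∀ x, |D x| = g x * (∫ y in Set.Iic x, u y ∂ν) - g x * ∫ y in Set.Iic x, w y ∂κ := by
    intro x
    rw [← mul_sub]
    change |D x| = g x * D x
    simp only [hg]
    split_ifs with h0
    · rw [abs_of_nonneg h0, one_mul]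
    · rw [abs_of_neg (not_le.1 h0)]; ring
  have hDint : Integrable (fun x => |D x|) (volume.restrict (Set.Ioc a b)) := by
    refine Integrable.mono' (integrable_const ((∫ y, |u y| ∂ν) + ∫ y, |w y| ∂κ))
      hDm.abs.aestronglyMeasurable (Filter.Eventually.of_forall fun x => ?_)
    simpa using hbd x
  rw [hset, ← ofReal_integral_eq_lintegral_ofReal hDint
    (Filter.Eventually.of_forall fun _ => abs_nonneg _)]
  refine ENNReal.ofReal_le_ofReal ?_
  rw [← intervalIntegral.integral_of_le hab]
  simp_rw [hgD]
  rw [intervalIntegral.integral_sub (hDi g hgm hg1 ‹_› hum hu) (hDi g hgm hg1 ‹_› hwm hw),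
    integral_mul_setIntegral_Iic hab hν hu hgm hg1, integral_mul_setIntegral_Iic hab hκ hw hgm hg1]
  exact h _ (lipschitzWith_integral_of_abs_le_one hgm hg1 b)

/-- A Riemann–Stieltjes sum: on each cell `H` is frozen at the left endpoint. The frozen part sees
only increments of the distribution function, the rest costs the oscillation `η` times the mass of
`|w|`. -/
lemma abs_setIntegral_Ioc_le_sum [IsFiniteMeasure κ] (hw : Integrable w κ) {H : ℝ → ℝ}
    (hH : Measurable H) {M η : ℝ} (hHM : ∀ x, |H x| ≤ M) {t : ℕ → ℝ} (ht : Monotone t)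
    (hη : ∀ i, ∀ x ∈ Set.Ioc (t i) (t (i + 1)), |H x - H (t i)| ≤ η) (n : ℕ) :
    |∫ y in Set.Ioc (t 0) (t n), H y * w y ∂κ| ≤
      M * (∑ i ∈ Finset.range n,
        |(∫ y in Set.Iic (t (i + 1)), w y ∂κ) - ∫ y in Set.Iic (t i), w y ∂κ|) +
      η * ∫ y in Set.Ioc (t 0) (t n), |w y| ∂κ := by
  have hHw : Integrable (fun y => H y * w y) κ :=
    hw.bdd_mul hH.aestronglyMeasurable (Filter.Eventually.of_forall hHM)
  induction n with
  | zero => simp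
  | succ n ih =>
    have hun : Set.Ioc (t 0) (t (n + 1)) = Set.Ioc (t 0) (t n) ∪ Set.Ioc (t n) (t (n + 1)) :=
      (Set.Ioc_union_Ioc_eq_Ioc (ht (Nat.zero_le _)) (ht (Nat.le_succ _))).symm
    have hdisj : Disjoint (Set.Ioc (t 0) (t n)) (Set.Ioc (t n) (t (n + 1))) := by
      rw [Set.disjoint_left]
      rintro x ⟨_, hx⟩ ⟨hx', _⟩
      exact absurd hx (not_le.2 hx')
    rw [hun, setIntegral_union hdisj measurableSet_Ioc hHw.integrableOn hHw.integrableOn,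
      setIntegral_union hdisj measurableSet_Ioc hw.abs.integrableOn hw.abs.integrableOn,
      Finset.sum_range_succ]
    have hinc : (∫ y in Set.Iic (t (n + 1)), w y ∂κ) - ∫ y in Set.Iic (t n), w y ∂κ =
        ∫ y in Set.Ioc (t n) (t (n + 1)), w y ∂κ := by
      rw [← Set.Iic_union_Ioc_eq_Iic (ht (Nat.le_succ n)), setIntegral_union _ measurableSet_Ioc
        hw.integrableOn hw.integrableOn]
      · ring
      · rw [Set.disjoint_left]
        rintro x hx ⟨hx', _⟩
        exact absurd hx (not_le.2 hx')
    have hstep : |∫ y in Set.Ioc (t n) (t (n + 1)), H y * w y ∂κ| ≤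
        M * |(∫ y in Set.Iic (t (n + 1)), w y ∂κ) - ∫ y in Set.Iic (t n), w y ∂κ| +
        η * ∫ y in Set.Ioc (t n) (t (n + 1)), |w y| ∂κ := by
      have hsplit : ∫ y in Set.Ioc (t n) (t (n + 1)), H y * w y ∂κ =
          H (t n) * (∫ y in Set.Ioc (t n) (t (n + 1)), w y ∂κ) +
          ∫ y in Set.Ioc (t n) (t (n + 1)), (H y - H (t n)) * w y ∂κ := by
        rw [← integral_const_mul, ← integral_add]
        · congr 1; funext y; ring
        · exact (hw.const_mul _).integrableOn
        · refine Integrable.integrableOn ?_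
          have := hHw.sub (hw.const_mul (H (t n)))
          refine this.congr (Filter.Eventually.of_forall fun y => ?_)
          simp only [Pi.sub_apply]; ring
      rw [hsplit, hinc]
      refine (abs_add_le _ _).trans (add_le_add ?_ ?_)
      · rw [abs_mul]
        exact mul_le_mul_of_nonneg_right (hHM _) (abs_nonneg _)
      · refine (abs_integral_le_integral_abs).trans ?_
        rw [← integral_const_mul]
        refine setIntegral_mono_on ?_ (hw.abs.const_mul _).integrableOn measurableSet_Ioc ?_
        · refine Integrable.integrableOn (Integrable.abs ?_)
          have := hHw.sub (hw.const_mul (H (t n)))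
          refine this.congr (Filter.Eventually.of_forall fun y => ?_)
          simp only [Pi.sub_apply]; ring
        · intro y hy
          rw [abs_mul]
          exact mul_le_mul_of_nonneg_right (hη n y hy) (abs_nonneg _)
    refine (abs_add_le _ _).trans ?_
    linarith

/-- The integral of a continuous function against a signed measure is bounded by the total
variation of its distribution function. -/
lemma abs_integral_mul_le_totalVar {a b : ℝ} (hab : a ≤ b) [IsFiniteMeasure κ]
    (hκ : κ (Set.Icc a b)ᶜ = 0) (hw : Integrable w κ) {h : ℝ → ℝ} (hh : Continuous h) {M : ℝ}
    (hM : ∀ x ∈ Set.Icc a b, |h x| ≤ M) :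
    ENNReal.ofReal |∫ y, h y * w y ∂κ| ≤
      ENNReal.ofReal M * totalVar fun x => ∫ y in Set.Iic x, w y ∂κ := by
  -- Extending `h` by constants outside `[a, b]` makes it bounded by `M` and uniformly continuous on
  -- the line, without changing the integral.
  set H : ℝ → ℝ := Set.IccExtend hab (fun x : Set.Icc a b => h x) with hHdef
  have hHc : Continuous H := (hh.comp continuous_subtype_val).Icc_extend'
  have hHM : ∀ x, |H x| ≤ M := fun x => hM _ (Set.projIcc a b hab x).2
  have hM0 : 0 ≤ M := (abs_nonneg _).trans (hHM a)
  have hHu : UniformContinuous H := by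
    have h1 : UniformContinuous (fun x : Set.Icc a b => h x) :=
      CompactSpace.uniformContinuous_of_continuous (hh.comp continuous_subtype_val)
    exact h1.comp (LipschitzWith.projIcc hab).uniformContinuous
  have hae : ∀ᵐ y ∂κ, y ∈ Set.Icc a b := hκ
  have hHh : ∫ y, h y * w y ∂κ = ∫ y, H y * w y ∂κ := by
    refine integral_congr_ae ?_
    filter_upwards [hae] with y hy
    simp only [hHdef]
    rw [Set.IccExtend_of_mem hab _ hy]
  set T := totalVar fun x => ∫ y in Set.Iic x, w y ∂κ with hT
  by_cases hTtop : T = ⊤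
  · rcases hM0.eq_or_lt with h0 | h0
    · have : ∫ y, h y * w y ∂κ = 0 := by
        rw [hHh]
        refine integral_eq_zero_of_ae (Filter.Eventually.of_forall fun y => ?_)
        have := hHM y
        rw [← h0] at this
        simp [abs_nonpos_iff.1 this]
      simp [this]
    · rw [hTtop, ENNReal.mul_top (by simpa using h0)]
      exact le_top
  · have key : |∫ y, h y * w y ∂κ| ≤ M * T.toReal := by
      set W := ∫ y, |w y| ∂κ with hW
      have hW0 : 0 ≤ W := integral_nonneg fun _ => abs_nonneg _
      refine le_of_forall_pos_le_add fun η' hη' => ?_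
      -- Chosen so that `η * W ≤ η'`, also when `W = 0`.
      set η := η' / (W + 1) with hηd
      have hη : 0 < η := by positivity
      obtain ⟨δ, hδ, hδH⟩ := Metric.uniformContinuous_iff.1 hHu η hη
      set d := δ / 2 with hdd
      have hd : 0 < d := by positivity
      -- The grid starts strictly left of `a`, since the half-open cells would otherwise lose an
      -- atom at `a`.
      set t : ℕ → ℝ := fun i => a - d + i * d with htd
      have ht : Monotone t := by
        intro i j hij
        have : (i : ℝ) ≤ j := by exact_mod_cast hij
        simp only [htd]
        nlinarith
      obtain ⟨n, hn⟩ := exists_nat_gt ((b - a + d) / d)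
      have htn : b ≤ t n := by
        rw [div_lt_iff₀ hd] at hn
        simp only [htd]; linarith
      have ht0 : t 0 < a := by simp [htd, hd]
      have hb := abs_setIntegral_Ioc_le_sum hw hHc.measurable hHM ht (η := η) (by
        intro i x hx
        refine (hδH ?_).le
        have h1 : t (i + 1) = t i + d := by simp only [htd]; push_cast; ring
        rw [Real.dist_eq, abs_lt]
        constructor
        · linarith [hx.1]
        · have := hx.2
          rw [h1] at this
          linarith) n
      have hmem : ∀ᵐ y ∂κ, y ∈ Set.Ioc (t 0) (t n) := by
        filter_upwards [hae] with y hy using ⟨ht0.trans_le hy.1, hy.2.trans htn⟩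
      rw [Measure.restrict_eq_self_of_ae_mem hmem] at hb
      rw [hHh]
      refine hb.trans (add_le_add ?_ ?_)
      · refine mul_le_mul_of_nonneg_left ?_ hM0
        have hv : ∑ i ∈ Finset.range n, edist (∫ y in Set.Iic (t (i + 1)), w y ∂κ)
            (∫ y in Set.Iic (t i), w y ∂κ) ≤ T :=
          eVariationOn.sum_le (f := fun x => ∫ y in Set.Iic x, w y ∂κ) (n := n) ht
            (fun _ => Set.mem_univ _)
        have := ENNReal.toReal_mono hTtop hv
        rw [ENNReal.toReal_sum (fun i _ => edist_ne_top _ _)] at this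
        refine le_trans (le_of_eq (Finset.sum_congr rfl fun i _ => ?_)) this
        rw [edist_dist, ENNReal.toReal_ofReal dist_nonneg, Real.dist_eq]
      · rw [hηd, div_mul_eq_mul_div, div_le_iff₀ (by positivity)]
        nlinarith
    calc ENNReal.ofReal |∫ y, h y * w y ∂κ| ≤ ENNReal.ofReal (M * T.toReal) :=
          ENNReal.ofReal_le_ofReal key
      _ = ENNReal.ofReal M * T := by
          rw [ENNReal.ofReal_mul hM0, ENNReal.ofReal_toReal hTtop]

end Density

end RandQuad

namespace RandQuad

/-! ### Orthogonal polynomials -/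

/-- All polynomials are integrable. -/
def PolyIntegrable (μ : Measure ℝ) : Prop := ∀ p : ℝ[X], Integrable (fun x => p.eval x) μ

lemma integrable_of_continuous_of_compl_Icc {μ : Measure ℝ} [IsFiniteMeasure μ] {a b : ℝ}
    (hμ : μ (Set.Icc a b)ᶜ = 0) {f : ℝ → ℝ} (hf : Continuous f) : Integrable f μ := by
  obtain ⟨C, hC⟩ := isCompact_Icc.exists_bound_of_continuousOn (s := Set.Icc a b) hf.continuousOn
  refine Integrable.mono' (integrable_const C) hf.aestronglyMeasurable ?_
  have h : ∀ᵐ y ∂μ, y ∈ Set.Icc a b := hμ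
  filter_upwards [h] with y hy using hC y hy

lemma polyIntegrable_of_compl_Icc {μ : Measure ℝ} [IsFiniteMeasure μ] {a b : ℝ}
    (hμ : μ (Set.Icc a b)ᶜ = 0) : PolyIntegrable μ :=
  fun p => integrable_of_continuous_of_compl_Icc hμ p.continuous

/-- Integration of polynomials as a linear functional. -/
noncomputable def polyInt {μ : Measure ℝ} (h : PolyIntegrable μ) : ℝ[X] →ₗ[ℝ] ℝ where
  toFun p := ∫ x, p.eval x ∂μ
  map_add' p q := by simp only [eval_add]; exact integral_add (h p) (h q)
  map_smul' c p := by simp [integral_const_mul]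

section Orth

variable {μ : Measure ℝ}

lemma polyInt_apply (h : PolyIntegrable μ) (p : ℝ[X]) : polyInt h p = ∫ x, p.eval x ∂μ := rfl

lemma polyInt_C_mul (h : PolyIntegrable μ) (c : ℝ) (p : ℝ[X]) :
    polyInt h (C c * p) = c * polyInt h p := by
  rw [← smul_eq_C_mul, map_smul, smul_eq_mul]

lemma ae_eval_eq_zero_of_polyInt_sq (h : PolyIntegrable μ) {p : ℝ[X]}
    (hp : polyInt h (p * p) = 0) : ∀ᵐ x ∂μ, p.eval x = 0 := by
  rw [polyInt_apply, integral_eq_zero_iff_of_nonneg (fun x => by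
    simp only [eval_mul, Pi.zero_apply]; exact mul_self_nonneg _) (h _)] at hp
  filter_upwards [hp] with x hx
  simpa using hx

lemma polyInt_mul_eq_zero_of_ae (h : PolyIntegrable μ) {p : ℝ[X]}
    (hp : ∀ᵐ x ∂μ, p.eval x = 0) (q : ℝ[X]) : polyInt h (p * q) = 0 := by
  rw [polyInt_apply]
  refine integral_eq_zero_of_ae ?_
  filter_upwards [hp] with x hx
  simp [hx]

lemma monicOrth_eq (μ : Measure ℝ) (i : ℕ) : monicOrth μ i =
    X ^ i - ∑ j : Fin i,
      C ((∫ x, x ^ i * (monicOrth μ j).eval x ∂μ) / (∫ x, ((monicOrth μ j).eval x) ^ 2 ∂μ)) *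
        monicOrth μ j := by
  rw [monicOrth]

lemma degree_C_mul_le_degree (c : ℝ) (p : ℝ[X]) : (C c * p).degree ≤ p.degree := by
  rw [← smul_eq_C_mul]
  exact degree_smul_le c p

lemma degree_sum_lt_of_forall {ι : Type*} {s : Finset ι} {p : ι → ℝ[X]} {m : ℕ}
    (hp : ∀ i ∈ s, (p i).degree < m) : (∑ i ∈ s, p i).degree < m :=
  mem_degreeLT.1 (Submodule.sum_mem _ fun i hi => mem_degreeLT.2 (hp i hi))

lemma monicOrth_monic_and_natDegree (μ : Measure ℝ) (i : ℕ) :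
    (monicOrth μ i).Monic ∧ (monicOrth μ i).natDegree = i := by
  induction i using Nat.strong_induction_on with
  | _ i ih =>
    rw [monicOrth_eq]
    set r := ∑ j : Fin i,
      C ((∫ x, x ^ i * (monicOrth μ j).eval x ∂μ) / (∫ x, ((monicOrth μ j).eval x) ^ 2 ∂μ)) *
        monicOrth μ j with hr
    have hdeg : r.degree < (i : WithBot ℕ) := by
      refine degree_sum_lt_of_forall fun j _ => (degree_C_mul_le_degree _ _).trans_lt ?_
      refine degree_le_natDegree.trans_lt ?_
      rw [(ih j j.2).2]
      exact_mod_cast j.2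
    have hX : (X ^ i : ℝ[X]).degree = i := degree_X_pow i
    constructor
    · exact (monic_X_pow i).sub_of_left (by rwa [hX])
    · have : (X ^ i - r).degree = (i : WithBot ℕ) := by
        rw [degree_sub_eq_left_of_degree_lt (by rwa [hX]), hX]
      exact natDegree_eq_of_degree_eq_some this

lemma monicOrth_monic (μ : Measure ℝ) (i : ℕ) : (monicOrth μ i).Monic :=
  (monicOrth_monic_and_natDegree μ i).1

lemma natDegree_monicOrth (μ : Measure ℝ) (i : ℕ) : (monicOrth μ i).natDegree = i :=
  (monicOrth_monic_and_natDegree μ i).2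

lemma degree_monicOrth (μ : Measure ℝ) (i : ℕ) : (monicOrth μ i).degree = i := by
  rw [degree_eq_natDegree (monicOrth_monic μ i).ne_zero, natDegree_monicOrth]

/-- A linear functional that vanishes on monic polynomials of degrees `0, …, m - 1` vanishes on all
polynomials of degree less than `m`. -/
lemma eq_zero_of_forall_monic {π : ℕ → ℝ[X]} (hmon : ∀ i, (π i).Monic)
    (hdeg : ∀ i, (π i).degree = i) (L : ℝ[X] →ₗ[ℝ] ℝ) {m : ℕ} (hL : ∀ i < m, L (π i) = 0)
    {q : ℝ[X]} (hq : q.degree < m) : L q = 0 := by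
  induction m generalizing q with
  | zero =>
    have : q = 0 := by
      rw [← degree_eq_bot]
      exact Nat.WithBot.lt_zero_iff.1 (by simpa using hq)
    simp [this]
  | succ m ih =>
    by_cases hlt : q.degree < m
    · exact ih (fun i hi => hL i (hi.trans (Nat.lt_succ_self m))) hlt
    · have hqm : q.degree = m := by
        refine le_antisymm ?_ (not_lt.1 hlt)
        by_cases hq0 : q = 0
        · simp [hq0]
        · exact degree_le_of_natDegree_le
            (Nat.lt_succ_iff.1 ((natDegree_lt_iff_degree_lt hq0).2 hq))
      have hq0 : q ≠ 0 := by rintro rfl; simp at hqm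
      have hr : (q - C q.leadingCoeff * π m).degree < m := by
        rw [← hqm]
        refine degree_sub_lt_left ?_ hq0 ?_
        · rw [degree_C_mul (leadingCoeff_ne_zero.2 hq0), hdeg, hqm]
        · rw [leadingCoeff_mul, leadingCoeff_C, (hmon m).leadingCoeff, mul_one]
      have h1 := ih (fun i hi => hL i (hi.trans (Nat.lt_succ_self m))) hr
      rw [← smul_eq_C_mul, map_sub, map_smul, hL m (Nat.lt_succ_self m)] at h1
      simpa using h1

/-- Orthogonality survives degenerate measures: if an earlier polynomial has norm zero, it vanishes
almost everywhere, so its inner products are zero and the Gram–Schmidt coefficient `0 / 0 = 0` is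
harmless. -/
lemma polyInt_monicOrth_mul_of_lt (h : PolyIntegrable μ) (i : ℕ) :
    ∀ j < i, polyInt h (monicOrth μ i * monicOrth μ j) = 0 := by
  induction i using Nat.strong_induction_on with
  | _ i ih =>
    intro j hj
    have hoff : ∀ k : Fin i, (k : ℕ) ≠ j →
        polyInt h (monicOrth μ k * monicOrth μ j) = 0 := by
      intro k hk
      rcases lt_or_gt_of_ne hk with hk | hk
      · rw [mul_comm]; exact ih j hj k hk
      · exact ih k k.2 j hk
    rw [monicOrth_eq μ i, sub_mul, map_sub, Finset.sum_mul, map_sum, Finset.sum_eq_single ⟨j, hj⟩]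
    · rw [mul_assoc, polyInt_C_mul]
      have h1 : polyInt h (X ^ i * monicOrth μ j) = ∫ x, x ^ i * (monicOrth μ j).eval x ∂μ := by
        simp [polyInt_apply]
      have h2 : polyInt h (monicOrth μ j * monicOrth μ j) =
          ∫ x, ((monicOrth μ j).eval x) ^ 2 ∂μ := by
        simp [polyInt_apply, sq]
      rw [← h1, ← h2]
      by_cases h0 : polyInt h (monicOrth μ j * monicOrth μ j) = 0
      · rw [h0, mul_comm (X ^ i), polyInt_mul_eq_zero_of_ae h (ae_eval_eq_zero_of_polyInt_sq h h0)]
        simp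
      · rw [div_mul_cancel₀ _ h0, sub_self]
    · intro k _ hk
      rw [mul_assoc, polyInt_C_mul, hoff k (fun h => hk (Fin.ext h)), mul_zero]
    · simp

lemma polyInt_monicOrth_mul (h : PolyIntegrable μ) {i : ℕ} {q : ℝ[X]} (hq : q.degree < i) :
    polyInt h (monicOrth μ i * q) = 0 :=
  eq_zero_of_forall_monic (monicOrth_monic μ) (degree_monicOrth μ)
    ((polyInt h).comp (LinearMap.mulLeft ℝ (monicOrth μ i))) (m := i)
    (fun j hj => polyInt_monicOrth_mul_of_lt h i j hj) hq

/-- The orthogonal polynomials of degree less than `m` have nonzero norm. -/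
def OrthNondeg (μ : Measure ℝ) (m : ℕ) : Prop :=
  ∀ i < m, ∫ x, ((monicOrth μ i).eval x) ^ 2 ∂μ ≠ 0

lemma OrthNondeg.polyInt_ne_zero (h : PolyIntegrable μ) {m i : ℕ} (hm : OrthNondeg μ m)
    (hi : i < m) : polyInt h (monicOrth μ i * monicOrth μ i) ≠ 0 := by
  have := hm i hi
  simpa [polyInt_apply, sq] using this

/-- Pairing `q` with the orthogonal polynomial of its own degree leaves the leading coefficient of
`q` times a nonzero squared norm. -/
lemma OrthNondeg.eq_zero_of_ae (h : PolyIntegrable μ) {m : ℕ} (hm : OrthNondeg μ m) {q : ℝ[X]}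
    (hq : q.degree < m) (h0 : ∀ᵐ x ∂μ, q.eval x = 0) : q = 0 := by
  by_contra hne
  set d := q.natDegree with hd
  have hdm : d < m := (natDegree_lt_iff_degree_lt hne).2 hq
  have hqd : q.degree = d := degree_eq_natDegree hne
  have hr : (q - C q.leadingCoeff * monicOrth μ d).degree < d := by
    rw [← hqd]
    refine degree_sub_lt_left ?_ hne ?_
    · rw [degree_C_mul (leadingCoeff_ne_zero.2 hne), degree_monicOrth, hqd]
    · rw [leadingCoeff_mul, leadingCoeff_C, (monicOrth_monic μ d).leadingCoeff, mul_one]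
  have h1 := polyInt_monicOrth_mul h hr
  have h2 := polyInt_mul_eq_zero_of_ae h h0 (monicOrth μ d)
  rw [mul_sub, map_sub, mul_comm, h2, mul_left_comm, polyInt_C_mul, zero_sub, neg_eq_zero] at h1
  exact (mul_ne_zero (leadingCoeff_ne_zero.2 hne) (hm.polyInt_ne_zero h hdm)) h1

lemma OrthNondeg.eq_zero_of_polyInt_sq (h : PolyIntegrable μ) {m : ℕ} (hm : OrthNondeg μ m)
    {q : ℝ[X]} (hq : q.degree < m) (h0 : polyInt h (q * q) = 0) : q = 0 :=
  hm.eq_zero_of_ae h hq (ae_eval_eq_zero_of_polyInt_sq h h0)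

lemma ae_eval_eq_zero_of_polyInt_eq_zero (h : PolyIntegrable μ) {p : ℝ[X]}
    (hp0 : ∀ᵐ x ∂μ, 0 ≤ p.eval x) (hp : polyInt h p = 0) : ∀ᵐ x ∂μ, p.eval x = 0 := by
  rw [polyInt_apply, integral_eq_zero_iff_of_nonneg_ae hp0 (h _)] at hp
  exact hp

/-- The orthogonal polynomial of degree `m` has `m` real roots. -/
lemma OrthNondeg.card_roots (h : PolyIntegrable μ) {m : ℕ} (hm : OrthNondeg μ m) :
    Multiset.card (monicOrth μ m).roots = m := by
  -- Split off all real roots: the cofactor `q` has none, hence constant sign. If `g` had degree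
  -- below `m`, orthogonality to `g` would make `∫ g² q` vanish, forcing `g = 0` almost everywhere.
  obtain ⟨q, hq, hcard, hroots⟩ := exists_prod_multiset_X_sub_C_mul (monicOrth μ m)
  rw [natDegree_monicOrth] at hcard
  set g := ((monicOrth μ m).roots.map fun a => X - C a).prod with hg
  have hgm : g.Monic := monic_multiset_prod_of_monic _ _ fun a _ => monic_X_sub_C a
  have hgd : g.natDegree = Multiset.card (monicOrth μ m).roots := by
    rw [hg, natDegree_multiset_prod_X_sub_C_eq_card]
  by_contra hne
  have hlt : g.degree < m := by
    rw [degree_eq_natDegree hgm.ne_zero, hgd]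
    exact_mod_cast lt_of_le_of_ne (by omega) hne
  have hq0 : q ≠ 0 := by
    rintro rfl
    rw [mul_zero] at hq
    exact (monicOrth_monic μ m).ne_zero hq.symm
  have hqne : ∀ x, q.eval x ≠ 0 := by
    intro x hx
    have : x ∈ q.roots := (mem_roots hq0).2 hx
    simp [hroots] at this
  have hint := polyInt_monicOrth_mul h hlt
  rw [← hq] at hint
  have hgae : ∀ᵐ x ∂μ, (g * q * g).eval x = 0 := by
    by_cases hpos : ∀ x, 0 < q.eval x
    · refine ae_eval_eq_zero_of_polyInt_eq_zero h (Filter.Eventually.of_forall fun x => ?_) hint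
      have := hpos x
      simp only [eval_mul]
      nlinarith [mul_nonneg (mul_self_nonneg (g.eval x)) this.le]
    · push Not at hpos
      obtain ⟨x₀, hx₀⟩ := hpos
      have hneg : ∀ x, q.eval x < 0 := by
        intro x
        by_contra hx
        obtain ⟨y, hy⟩ := mem_range_of_exists_le_of_exists_ge q.continuous ⟨x₀, hx₀⟩
          ⟨x, not_lt.1 hx⟩
        exact hqne y hy
      have h' : polyInt h (-(g * q * g)) = 0 := by rw [map_neg, hint, neg_zero]
      have := ae_eval_eq_zero_of_polyInt_eq_zero h (Filter.Eventually.of_forall fun x => ?_) h'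
      · filter_upwards [this] with x hx
        rw [eval_neg] at hx
        linarith
      · have := hneg x
        simp only [eval_mul, eval_neg]
        nlinarith [mul_nonneg (mul_self_nonneg (g.eval x)) (neg_nonneg.2 this.le)]
  refine hgm.ne_zero (hm.eq_zero_of_ae h hlt ?_)
  filter_upwards [hgae] with x hx
  simpa [hqne x] using hx

/-- A double root `r` gives a factorization `(X - r)² q`, and orthogonality to `q` says that `(X -
r) q`, of degree `m - 1`, has norm zero. -/
lemma OrthNondeg.nodup_roots (h : PolyIntegrable μ) {m : ℕ} (hm : OrthNondeg μ m) :
    (monicOrth μ m).roots.Nodup := by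
  rw [Multiset.nodup_iff_count_le_one]
  intro r
  by_contra hr
  rw [count_roots] at hr
  have hdvd : (X - C r) ^ 2 ∣ monicOrth μ m :=
    (le_rootMultiplicity_iff (monicOrth_monic μ m).ne_zero).1 (by omega)
  obtain ⟨q, hq⟩ := hdvd
  have hq0 : q ≠ 0 := by
    rintro rfl
    rw [mul_zero] at hq
    exact (monicOrth_monic μ m).ne_zero hq
  have hdeg : m = 2 + q.natDegree := by
    have := congrArg natDegree hq
    rwa [natDegree_monicOrth, natDegree_mul (pow_ne_zero _ (X_sub_C_ne_zero r)) hq0,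
      natDegree_pow, natDegree_X_sub_C, mul_one] at this
  have hqd : q.degree < m := by
    rw [degree_eq_natDegree hq0]; exact_mod_cast by omega
  have h1 := polyInt_monicOrth_mul h hqd
  rw [hq, show (X - C r) ^ 2 * q * q = ((X - C r) * q) * ((X - C r) * q) by ring] at h1
  have h2 := hm.eq_zero_of_polyInt_sq h (q := (X - C r) * q) ?_ h1
  · exact (mul_ne_zero (X_sub_C_ne_zero r) hq0) h2
  · rw [degree_mul, degree_X_sub_C, degree_eq_natDegree hq0]
    exact_mod_cast by omega

lemma OrthNondeg.card_orthNodes (h : PolyIntegrable μ) {m : ℕ} (hm : OrthNondeg μ m) :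
    (orthNodes μ m).card = m := by
  rw [orthNodes, Multiset.toFinset_card_of_nodup (hm.nodup_roots h), hm.card_roots h]

lemma eval_monicOrth_of_mem_orthNodes {m : ℕ} {r : ℝ} (hr : r ∈ orthNodes μ m) :
    (monicOrth μ m).eval r = 0 := by
  rw [orthNodes, Multiset.mem_toFinset] at hr
  exact (mem_roots'.1 hr).2

/-- For a root `r` outside the interval, write the polynomial as `(X - r) q`. Orthogonality to `q`
gives `∫ (x - r) q² = 0`, although `x - r` has constant nonzero sign on `[a, b]`. -/
lemma OrthNondeg.orthNodes_subset (h : PolyIntegrable μ) {a b : ℝ} (hμ : μ (Set.Icc a b)ᶜ = 0)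
    {m : ℕ} (hm : OrthNondeg μ m) {r : ℝ} (hr : r ∈ orthNodes μ m) : r ∈ Set.Icc a b := by
  by_contra hab
  have hae : ∀ᵐ y ∂μ, y ∈ Set.Icc a b := hμ
  obtain ⟨q, hq⟩ := dvd_iff_isRoot.2 (eval_monicOrth_of_mem_orthNodes hr)
  have hq0 : q ≠ 0 := by
    rintro rfl
    rw [mul_zero] at hq
    exact (monicOrth_monic μ m).ne_zero hq
  have hdeg : m = 1 + q.natDegree := by
    have := congrArg natDegree hq
    rwa [natDegree_monicOrth, natDegree_mul (X_sub_C_ne_zero r) hq0, natDegree_X_sub_C] at this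
  have hqd : q.degree < m := by
    rw [degree_eq_natDegree hq0]; exact_mod_cast by omega
  have h1 := polyInt_monicOrth_mul h hqd
  rw [hq] at h1
  refine hq0 (hm.eq_zero_of_ae h hqd ?_)
  by_cases hra : r < a
  · have := ae_eval_eq_zero_of_polyInt_eq_zero h ?_ h1
    · filter_upwards [this, hae] with x hx hxab
      have : x - r ≠ 0 := by have := hxab.1; linarith
      simpa [this] using hx
    · filter_upwards [hae] with x hxab
      have : 0 ≤ x - r := by have := hxab.1; linarith
      simp only [eval_mul, eval_sub, eval_X, eval_C]
      nlinarith [mul_nonneg this (mul_self_nonneg (q.eval x))]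
  · have hrb : b < r := by
      by_contra hb
      exact hab ⟨not_lt.1 hra, not_lt.1 hb⟩
    have h1' : polyInt h (-((X - C r) * q * q)) = 0 := by rw [map_neg, h1, neg_zero]
    have := ae_eval_eq_zero_of_polyInt_eq_zero h ?_ h1'
    · filter_upwards [this, hae] with x hx hxab
      have : x - r ≠ 0 := by have := hxab.2; intro h; linarith
      simpa [this] using hx
    · filter_upwards [hae] with x hxab
      have : 0 ≤ r - x := by have := hxab.2; linarith
      simp only [eval_mul, eval_sub, eval_X, eval_C, eval_neg]
      nlinarith [mul_nonneg this (mul_self_nonneg (q.eval x))]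

/-- An orthogonal polynomial of degree `i ≤ s` and norm zero would confine the support to its at
most `i` roots. -/
lemma orthNondeg_of_support {s : ℕ} (h : PolyIntegrable μ)
    (hs : (s : ℕ∞) + 1 ≤ μ.support.encard) : OrthNondeg μ (s + 1) := by
  intro i hi h0
  have h0' : polyInt h (monicOrth μ i * monicOrth μ i) = 0 := by
    simpa [polyInt_apply, sq] using h0
  have hsub : μ.support ⊆ ((monicOrth μ i).roots.toFinset : Set ℝ) := by
    refine Measure.support_subset_of_isClosed (Finset.finite_toSet _).isClosed ?_
    filter_upwards [ae_eval_eq_zero_of_polyInt_sq h h0'] with x hx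
    simpa [(monicOrth_monic μ i).ne_zero] using hx
  have h1 := Set.encard_le_encard hsub
  rw [Set.encard_coe_eq_coe_finsetCard] at h1
  have h2 : (monicOrth μ i).roots.toFinset.card ≤ i :=
    (Multiset.toFinset_card_le _).trans ((card_roots' _).trans (natDegree_monicOrth μ i).le)
  have h3 : ((s + 1 : ℕ) : ℕ∞) ≤ (i : ℕ∞) := by
    push_cast
    exact hs.trans (h1.trans (by exact_mod_cast h2))
  have : s + 1 ≤ i := by exact_mod_cast h3
  omega

/-! ### Orthonormal polynomials -/

lemma degree_orthPoly_le (μ : Measure ℝ) (i : ℕ) : (orthPoly μ i).degree ≤ i := by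
  rw [orthPoly]
  exact (degree_C_mul_le_degree _ _).trans (degree_monicOrth μ i).le

lemma polyInt_orthPoly_mul_of_ne (h : PolyIntegrable μ) {i j : ℕ} (hij : i ≠ j) :
    polyInt h (orthPoly μ i * orthPoly μ j) = 0 := by
  rw [orthPoly, orthPoly, mul_mul_mul_comm, ← C_mul, polyInt_C_mul]
  rcases lt_or_gt_of_ne hij with hij | hij
  · rw [mul_comm (monicOrth μ i), polyInt_monicOrth_mul_of_lt h j i hij, mul_zero]
  · rw [polyInt_monicOrth_mul_of_lt h i j hij, mul_zero]

lemma polyInt_sq_nonneg (h : PolyIntegrable μ) (p : ℝ[X]) : 0 ≤ polyInt h (p * p) := by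
  rw [polyInt_apply]
  exact integral_nonneg fun x => by simp only [eval_mul, Pi.zero_apply]; exact mul_self_nonneg _

lemma OrthNondeg.polyInt_orthPoly_sq (h : PolyIntegrable μ) {m i : ℕ} (hm : OrthNondeg μ m)
    (hi : i < m) : polyInt h (orthPoly μ i * orthPoly μ i) = 1 := by
  rw [orthPoly, mul_mul_mul_comm, ← C_mul, polyInt_C_mul]
  have h1 : ∫ x, ((monicOrth μ i).eval x) ^ 2 ∂μ = polyInt h (monicOrth μ i * monicOrth μ i) := by
    simp [polyInt_apply, sq]
  have h2 := hm.polyInt_ne_zero h hi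
  rw [h1, ← mul_inv, Real.mul_self_sqrt (polyInt_sq_nonneg h _), inv_mul_cancel₀ h2]

/-- The orthogonal projection onto polynomials of degree less than `m` reproduces them. -/
lemma OrthNondeg.sum_orthPoly_eq (h : PolyIntegrable μ) {m : ℕ} (hm : OrthNondeg μ m) {q : ℝ[X]}
    (hq : q.degree < m) :
    ∑ i ∈ Finset.range m, C (polyInt h (q * orthPoly μ i)) * orthPoly μ i = q := by
  set r := q - ∑ i ∈ Finset.range m, C (polyInt h (q * orthPoly μ i)) * orthPoly μ i with hr
  have hrd : r.degree < m := by
    refine (degree_sub_le _ _).trans_lt (max_lt hq ?_)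
    refine degree_sum_lt_of_forall fun i hi => ?_
    refine ((degree_C_mul_le_degree _ _).trans (degree_orthPoly_le μ i)).trans_lt ?_
    exact_mod_cast Finset.mem_range.1 hi
  have hro : ∀ i < m, polyInt h (r * orthPoly μ i) = 0 := by
    intro i hi
    rw [hr, sub_mul, map_sub, Finset.sum_mul, map_sum, Finset.sum_eq_single i]
    · rw [mul_assoc, polyInt_C_mul, hm.polyInt_orthPoly_sq h hi, mul_one, sub_self]
    · intro j _ hj
      rw [mul_assoc, polyInt_C_mul, polyInt_orthPoly_mul_of_ne h hj, mul_zero]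
    · intro hi'
      exact absurd (Finset.mem_range.2 hi) hi'
  have hrm : ∀ i < m, polyInt h (r * monicOrth μ i) = 0 := by
    intro i hi
    have := hro i hi
    rw [orthPoly, mul_left_comm, polyInt_C_mul] at this
    refine (mul_eq_zero.1 this).resolve_left (inv_ne_zero ?_)
    intro h0
    have h1 := hm.polyInt_orthPoly_sq h hi
    rw [orthPoly, h0] at h1
    simp at h1
  have h0 : polyInt h (r * r) = 0 :=
    eq_zero_of_forall_monic (monicOrth_monic μ) (degree_monicOrth μ)
      ((polyInt h).comp (LinearMap.mulLeft ℝ r)) (m := m) hrm hrd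
  exact (sub_eq_zero.1 (hm.eq_zero_of_polyInt_sq h hrd h0)).symm

/-- Orthonormal polynomials with positive leading coefficients are unique. -/
lemma monicOrth_eq_of_orthonormal (h : PolyIntegrable μ) {q : ℕ → ℝ[X]}
    (hdeg : ∀ i, (q i).natDegree = i) (hlead : ∀ i, 0 < (q i).leadingCoeff)
    (horth : ∀ i j, polyInt h (q i * q j) = if i = j then 1 else 0) (i : ℕ) :
    monicOrth μ i = C (q i).leadingCoeff⁻¹ * q i := by
  have hcoef : ∀ j, ∀ c, polyInt h (q j * (C c * q j)) = c := by
    intro j c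
    rw [mul_left_comm, polyInt_C_mul, horth, if_pos rfl, mul_one]
  have hq0 : ∀ i, q i ≠ 0 := fun i => leadingCoeff_ne_zero.1 (hlead i).ne'
  have hd : ∀ i, (q i).degree = i := fun i => by rw [degree_eq_natDegree (hq0 i), hdeg]
  set π : ℕ → ℝ[X] := fun i => C (q i).leadingCoeff⁻¹ * q i with hπ
  have hπm : ∀ i, (π i).Monic := fun i => by
    rw [Monic, hπ]
    simp only [leadingCoeff_mul, leadingCoeff_C]
    exact inv_mul_cancel₀ (hlead i).ne'
  have hπd : ∀ i, (π i).degree = i := fun i => by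
    simp only [hπ]
    rw [degree_C_mul (inv_ne_zero (hlead i).ne'), hd]
  have hπo : ∀ {i : ℕ} {r : ℝ[X]}, r.degree < i → polyInt h (π i * r) = 0 := by
    intro i r hr
    refine eq_zero_of_forall_monic hπm hπd
      ((polyInt h).comp (LinearMap.mulLeft ℝ (π i))) (m := i) (fun j hj => ?_) hr
    simp only [LinearMap.comp_apply, LinearMap.mulLeft_apply, hπ]
    rw [mul_mul_mul_comm, ← C_mul, polyInt_C_mul, horth, if_neg hj.ne', mul_zero]
  have hnon : ∀ m, OrthNondeg μ m → monicOrth μ m = π m := by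
    intro m hm
    have hlt : (monicOrth μ m - π m).degree < m := by
      rw [← degree_monicOrth μ m]
      refine degree_sub_lt_left ?_ (monicOrth_monic μ m).ne_zero ?_
      · rw [degree_monicOrth, hπd]
      · rw [(monicOrth_monic μ m).leadingCoeff, (hπm m).leadingCoeff]
    refine sub_eq_zero.1 (hm.eq_zero_of_polyInt_sq h hlt ?_)
    rw [sub_mul, map_sub, polyInt_monicOrth_mul h hlt, hπo hlt, sub_zero]
  -- Nondegeneracy and identification advance together: nondegeneracy below `m` identifies the
  -- polynomial of degree `m`, whose norm is then visibly nonzero.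
  have hall : ∀ m, OrthNondeg μ m := by
    intro m
    induction m with
    | zero => intro i hi; omega
    | succ m ih =>
      intro i hi
      rcases Nat.lt_succ_iff_lt_or_eq.1 hi with hi | rfl
      · exact ih i hi
      · have h1 : polyInt h (monicOrth μ i * monicOrth μ i) ≠ 0 := by
          rw [hnon i ih]
          simp only [hπ]
          rw [mul_mul_mul_comm, ← C_mul, polyInt_C_mul, horth, if_pos rfl, mul_one]
          exact mul_ne_zero (inv_ne_zero (hlead i).ne') (inv_ne_zero (hlead i).ne')
        simpa [polyInt_apply, sq] using h1
  exact hnon i (hall i)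

lemma orthPoly_eq_of_orthonormal (h : PolyIntegrable μ) {q : ℕ → ℝ[X]}
    (hdeg : ∀ i, (q i).natDegree = i) (hlead : ∀ i, 0 < (q i).leadingCoeff)
    (horth : ∀ i j, polyInt h (q i * q j) = if i = j then 1 else 0) (i : ℕ) :
    orthPoly μ i = q i := by
  have h1 : ∫ x, ((monicOrth μ i).eval x) ^ 2 ∂μ = (q i).leadingCoeff⁻¹ ^ 2 := by
    have : ∫ x, ((monicOrth μ i).eval x) ^ 2 ∂μ = polyInt h (monicOrth μ i * monicOrth μ i) := by
      simp [polyInt_apply, sq]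
    rw [this, monicOrth_eq_of_orthonormal h hdeg hlead horth, mul_mul_mul_comm, ← C_mul,
      polyInt_C_mul, horth, if_pos rfl, mul_one, sq]
  rw [orthPoly, h1, Real.sqrt_sq (inv_nonneg.2 (hlead i).le), inv_inv,
    monicOrth_eq_of_orthonormal h hdeg hlead horth, ← mul_assoc, ← C_mul,
    mul_inv_cancel₀ (hlead i).ne', C_1, one_mul]

lemma orthNondeg_of_orthonormal (h : PolyIntegrable μ) {q : ℕ → ℝ[X]}
    (hdeg : ∀ i, (q i).natDegree = i) (hlead : ∀ i, 0 < (q i).leadingCoeff)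
    (horth : ∀ i j, polyInt h (q i * q j) = if i = j then 1 else 0) (m : ℕ) :
    OrthNondeg μ m := by
  intro i _
  have : ∫ x, ((monicOrth μ i).eval x) ^ 2 ∂μ = polyInt h (monicOrth μ i * monicOrth μ i) := by
    simp [polyInt_apply, sq]
  rw [this, monicOrth_eq_of_orthonormal h hdeg hlead horth, mul_mul_mul_comm, ← C_mul,
      polyInt_C_mul, horth, if_pos rfl, mul_one]
  exact mul_ne_zero (inv_ne_zero (hlead i).ne') (inv_ne_zero (hlead i).ne')

/-! ### Gaussian quadrature -/

/-- The weight of the node `x` in the interpolatory quadrature rule with the given nodes. -/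
noncomputable def quadWeight (μ : Measure ℝ) (nodes : Finset ℝ) (x : ℝ) : ℝ :=
  ∫ y, (Lagrange.basis nodes id x).eval y ∂μ

lemma integral_interpAt (h : PolyIntegrable μ) (nodes : Finset ℝ) (f : ℝ → ℝ) :
    ∫ y, (interpAt nodes f).eval y ∂μ = ∑ x ∈ nodes, f x * quadWeight μ nodes x := by
  rw [← polyInt_apply h, interpAt, Lagrange.interpolate_apply, map_sum]
  refine Finset.sum_congr rfl fun x _ => ?_
  rw [polyInt_C_mul]
  rfl

lemma interpAt_eval_eq_self {nodes : Finset ℝ} {p : ℝ[X]} (hp : p.degree < nodes.card) :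
    interpAt nodes (fun x => p.eval x) = p :=
  (Lagrange.eq_interpolate (v := id) Function.injective_id.injOn hp).symm

/-- Divide `p` by the nodal polynomial. The interpolant is the remainder, and the quotient has
degree below `m`, so its product with the nodal polynomial integrates to zero. -/
lemma OrthNondeg.integral_interpAt_eval (h : PolyIntegrable μ) {m : ℕ} (hm : OrthNondeg μ m)
    {p : ℝ[X]} (hp : p.degree < (2 * m : ℕ)) :
    ∫ y, (interpAt (orthNodes μ m) (fun x => p.eval x)).eval y ∂μ = ∫ y, p.eval y ∂μ := by
  set π := monicOrth μ m with hπ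
  have hπm : π.Monic := monicOrth_monic μ m
  have hr : (p %ₘ π).degree < m := by
    rw [← degree_monicOrth μ m]; exact degree_modByMonic_lt _ hπm
  have hq : (p /ₘ π).degree < m := by
    by_cases h0 : p /ₘ π = 0
    · rw [h0, degree_zero]; exact WithBot.bot_lt_coe m
    · rw [degree_eq_natDegree h0, natDegree_divByMonic _ hπm, natDegree_monicOrth]
      by_cases hp0 : p = 0
      · simp [hp0] at h0
      · have := (natDegree_lt_iff_degree_lt hp0).2 hp
        have h2 : 0 < m := by
          by_contra hm0
          have : m = 0 := by omega
          subst this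
          omega
        exact_mod_cast by omega
  have hdecomp : p %ₘ π + π * (p /ₘ π) = p := modByMonic_add_div p π
  have hinterp : interpAt (orthNodes μ m) (fun x => p.eval x) = p %ₘ π := by
    have h1 : interpAt (orthNodes μ m) (fun x => p.eval x) =
        interpAt (orthNodes μ m) (fun x => (p %ₘ π).eval x) := by
      refine Lagrange.interpolate_eq_of_values_eq_on _ _ fun x hx => ?_
      conv_lhs => rw [← hdecomp]
      rw [eval_add, eval_mul, hπ, eval_monicOrth_of_mem_orthNodes hx, zero_mul, add_zero]
    rw [h1, interpAt_eval_eq_self]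
    rwa [hm.card_orthNodes h]
  rw [hinterp, ← polyInt_apply h, ← polyInt_apply h]
  conv_rhs => rw [← hdecomp]
  rw [map_add, polyInt_monicOrth_mul h hq, add_zero]

/-- The square of the Lagrange basis polynomial has degree `2m - 2`, so the rule is exact for it:
the weight equals the integral of that square. -/
lemma OrthNondeg.quadWeight_nonneg (h : PolyIntegrable μ) {m : ℕ} (hm : OrthNondeg μ m) {x : ℝ}
    (hx : x ∈ orthNodes μ m) : 0 ≤ quadWeight μ (orthNodes μ m) x := by
  set ℓ := Lagrange.basis (orthNodes μ m) id x with hℓ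
  have hd : ℓ.degree = ((m - 1 : ℕ) : WithBot ℕ) := by
    rw [hℓ, Lagrange.degree_basis Function.injective_id.injOn hx, hm.card_orthNodes h]
  have hm0 : 0 < m := by
    have := Finset.card_pos.2 ⟨x, hx⟩
    rwa [hm.card_orthNodes h] at this
  have h1 := hm.integral_interpAt_eval h (p := ℓ * ℓ) (by
    rw [degree_mul, hd]
    exact_mod_cast by omega)
  rw [integral_interpAt h, Finset.sum_eq_single x] at h1
  · have h2 : ℓ.eval x = 1 := Lagrange.eval_basis_self (v := id) Function.injective_id.injOn hx
    simp only [eval_mul, h2, one_mul] at h1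
    rw [h1]
    exact integral_nonneg fun y => mul_self_nonneg _
  · intro y hy hyx
    have h2 : ℓ.eval y = 0 := Lagrange.eval_basis_of_ne (v := id) hyx.symm hy
    simp [h2]
  · exact fun h' => absurd hx h'

end Orth

end RandQuad

namespace RandQuad

/-! ### The Chebyshev distribution -/

section ChebMeasure

variable {a b : ℝ}

lemma integral_chebMeasure (hab : a < b) (f : ℝ → ℝ) :
    ∫ x, f x ∂chebMeasure a b =
      Real.pi⁻¹ * ∫ θ in (0 : ℝ)..Real.pi, f ((b - a) / 2 * Real.cos θ + (a + b) / 2) := by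
  have hba : 0 < b - a := sub_pos.2 hab
  have hpi := Real.pi_pos
  rw [chebMeasure, integral_withDensity_eq_integral_toReal_smul (by fun_prop)
    (Filter.Eventually.of_forall fun x => ENNReal.ofReal_lt_top)]
  have hnn : ∀ t, 0 ≤ 2 / (Real.pi * (b - a)) *
      (1 / Real.sqrt (1 - (2 / (b - a) * t - (b + a) / (b - a)) ^ 2)) := fun t => by positivity
  simp_rw [ENNReal.toReal_ofReal (hnn _), smul_eq_mul]
  rw [← integral_Ioc_eq_integral_Ioo, ← intervalIntegral.integral_of_le hab.le]
  set G : ℝ → ℝ := fun x => 2 / (Real.pi * (b - a)) * (1 / Real.sqrt (1 - x ^ 2)) *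
    f ((b - a) / 2 * x + (a + b) / 2) with hG
  have h1 : ∀ t, 2 / (Real.pi * (b - a)) *
      (1 / Real.sqrt (1 - (2 / (b - a) * t - (b + a) / (b - a)) ^ 2)) * f t =
      G (2 / (b - a) * t - (b + a) / (b - a)) := by
    intro t
    have : (b - a) / 2 * (2 / (b - a) * t - (b + a) / (b - a)) + (a + b) / 2 = t := by
      field_simp; ring
    simp only [hG, this]
  simp_rw [h1]
  rw [intervalIntegral.integral_comp_mul_sub G (by positivity)]
  have e1 : 2 / (b - a) * a - (b + a) / (b - a) = -1 := by field_simp; ring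
  have e2 : 2 / (b - a) * b - (b + a) / (b - a) = 1 := by field_simp; ring
  rw [e1, e2, ← Chebyshev.integral_measureT_eq_integral_cos
    (f := fun x => f ((b - a) / 2 * x + (a + b) / 2)), Chebyshev.integral_measureT, smul_eq_mul,
    ← intervalIntegral.integral_const_mul, ← intervalIntegral.integral_const_mul]
  refine intervalIntegral.integral_congr fun x _ => ?_
  simp only [hG, Real.sqrt_inv]
  field_simp

lemma chebMeasure_compl_Icc (a b : ℝ) : chebMeasure a b (Set.Icc a b)ᶜ = 0 := by
  refine withDensity_absolutelyContinuous _ _ ?_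
  rw [Measure.restrict_apply measurableSet_Icc.compl]
  convert measure_empty (μ := (volume : Measure ℝ))
  ext x
  simp only [Set.mem_inter_iff, Set.mem_compl_iff, Set.mem_Icc, Set.mem_Ioo,
    Set.mem_empty_iff_false,
    iff_false]
  rintro ⟨h1, h2⟩
  exact h1 ⟨h2.1.le, h2.2.le⟩

lemma isProbabilityMeasure_chebMeasure (hab : a < b) : IsProbabilityMeasure (chebMeasure a b) := by
  have h := integral_chebMeasure hab fun _ => 1
  rw [integral_const, intervalIntegral.integral_const, smul_eq_mul, smul_eq_mul, mul_one, mul_one,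
    sub_zero, inv_mul_cancel₀ Real.pi_ne_zero] at h
  refine ⟨?_⟩
  rw [Measure.real, ENNReal.toReal_eq_one_iff] at h
  exact h

/-- The Chebyshev polynomials of the first kind, transplanted to `[a, b]`. -/
noncomputable def chebPoly (a b : ℝ) (i : ℕ) : ℝ[X] :=
  (Chebyshev.T ℝ i).comp (C (2 / (b - a)) * X + C (-((b + a) / (b - a))))

/-- The orthonormal polynomials of the Chebyshev distribution. -/
noncomputable def chebOrth (a b : ℝ) (i : ℕ) : ℝ[X] :=
  C (if i = 0 then 1 else Real.sqrt 2) * chebPoly a b i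

lemma eval_chebPoly (hab : a < b) (i : ℕ) (θ : ℝ) :
    (chebPoly a b i).eval ((b - a) / 2 * Real.cos θ + (a + b) / 2) = Real.cos (i * θ) := by
  have hba : b - a ≠ 0 := (sub_pos.2 hab).ne'
  have : 2 / (b - a) * ((b - a) / 2 * Real.cos θ + (a + b) / 2) + -((b + a) / (b - a)) =
      Real.cos θ := by field_simp; ring
  rw [chebPoly, eval_comp, eval_add, eval_mul, eval_C, eval_C, eval_X, this,
    Chebyshev.T_real_cos]
  simp

lemma natDegree_chebPoly (hab : a < b) (i : ℕ) : (chebPoly a b i).natDegree = i := by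
  have hba : 0 < 2 / (b - a) := div_pos two_pos (sub_pos.2 hab)
  rw [chebPoly, natDegree_comp, natDegree_linear hba.ne', Chebyshev.natDegree_T]
  simp

lemma leadingCoeff_chebPoly_pos (hab : a < b) (i : ℕ) : 0 < (chebPoly a b i).leadingCoeff := by
  have hba : 0 < 2 / (b - a) := div_pos two_pos (sub_pos.2 hab)
  rw [chebPoly, leadingCoeff_comp (by rw [natDegree_linear hba.ne']; exact one_ne_zero),
    leadingCoeff_linear hba.ne', Chebyshev.leadingCoeff_T]
  positivity

lemma integral_chebPoly_mul (hab : a < b) (i j : ℕ) :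
    ∫ x, (chebPoly a b i * chebPoly a b j).eval x ∂chebMeasure a b =
      if i = j then (if i = 0 then 1 else 1 / 2) else 0 := by
  have hpi := Real.pi_pos
  rw [integral_chebMeasure hab]
  simp_rw [eval_mul, eval_chebPoly hab]
  have h : ∀ θ : ℝ, Real.cos (i * θ) * Real.cos (j * θ) =
      (fun x => (Chebyshev.T ℝ i).eval x * (Chebyshev.T ℝ j).eval x) (Real.cos θ) := by
    intro θ
    simp [Chebyshev.T_real_cos]
  simp_rw [h]
  rw [← Chebyshev.integral_measureT_eq_integral_cos
    (f := fun x => (Chebyshev.T ℝ i).eval x * (Chebyshev.T ℝ j).eval x)]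
  split_ifs with hij h0
  · subst hij; subst h0
    have := Chebyshev.integral_eval_T_real_mul_self_measureT_zero
    simp only [Nat.cast_zero]
    rw [this]; field_simp
  · subst hij
    rw [Chebyshev.integral_T_real_mul_self_measureT_of_ne_zero h0]; field_simp
  · rw [Chebyshev.integral_eval_T_real_mul_eval_T_real_measureT_of_ne hij, mul_zero]

lemma polyIntegrable_chebMeasure (hab : a < b) : PolyIntegrable (chebMeasure a b) :=
  have := isProbabilityMeasure_chebMeasure hab
  polyIntegrable_of_compl_Icc (chebMeasure_compl_Icc a b)

lemma natDegree_chebOrth (hab : a < b) (i : ℕ) : (chebOrth a b i).natDegree = i := by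
  rw [chebOrth, natDegree_C_mul (by split_ifs <;> simp), natDegree_chebPoly hab]

lemma leadingCoeff_chebOrth_pos (hab : a < b) (i : ℕ) : 0 < (chebOrth a b i).leadingCoeff := by
  rw [chebOrth, leadingCoeff_mul, leadingCoeff_C]
  refine mul_pos ?_ (leadingCoeff_chebPoly_pos hab i)
  split_ifs <;> simp

lemma polyInt_chebOrth_mul (hab : a < b) (i j : ℕ) :
    polyInt (polyIntegrable_chebMeasure hab) (chebOrth a b i * chebOrth a b j) =
      if i = j then 1 else 0 := by
  rw [chebOrth, chebOrth, mul_mul_mul_comm, ← C_mul, polyInt_C_mul, polyInt_apply,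
    integral_chebPoly_mul hab]
  by_cases hij : i = j
  · subst hij
    by_cases h0 : i = 0
    · simp [h0]
    · simp [h0]
  · simp [hij]

lemma orthPoly_chebMeasure (hab : a < b) (i : ℕ) :
    orthPoly (chebMeasure a b) i = chebOrth a b i :=
  orthPoly_eq_of_orthonormal (polyIntegrable_chebMeasure hab) (natDegree_chebOrth hab)
    (leadingCoeff_chebOrth_pos hab) (polyInt_chebOrth_mul hab) i

lemma orthNondeg_chebMeasure (hab : a < b) (m : ℕ) : OrthNondeg (chebMeasure a b) m :=
  orthNondeg_of_orthonormal (polyIntegrable_chebMeasure hab) (natDegree_chebOrth hab)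
    (leadingCoeff_chebOrth_pos hab) (polyInt_chebOrth_mul hab) m

end ChebMeasure

/-! ### Jackson's kernel -/

/-- The squared modulus of `∑ c_j e^{ijθ}` as a cosine polynomial. A kernel whose coefficients are
autocorrelations is therefore nonnegative. -/
lemma sq_add_sq_eq_autocorrelation (c : ℕ → ℝ) (θ : ℝ) (m : ℕ) :
    (∑ j ∈ Finset.range m, c j * Real.cos (j * θ)) ^ 2 +
      (∑ j ∈ Finset.range m, c j * Real.sin (j * θ)) ^ 2 =
    (∑ j ∈ Finset.range m, c j * c j) +
      2 * ∑ i ∈ Finset.range m, Real.cos ((i + 1 : ℕ) * θ) *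
        ∑ j ∈ Finset.range (m - (i + 1)), c j * c (j + (i + 1)) := by
  induction m with
  | zero => simp
  | succ m ih =>
    have h1 : ∑ i ∈ Finset.range (m + 1), Real.cos ((i + 1 : ℕ) * θ) *
        ∑ j ∈ Finset.range (m + 1 - (i + 1)), c j * c (j + (i + 1)) =
        (∑ i ∈ Finset.range m, Real.cos ((i + 1 : ℕ) * θ) *
          ∑ j ∈ Finset.range (m - (i + 1)), c j * c (j + (i + 1))) +
        ∑ i ∈ Finset.range m, Real.cos ((m - i : ℝ) * θ) * (c i * c m) := by
      rw [Finset.sum_range_succ, Nat.sub_self, Finset.range_zero, Finset.sum_empty, mul_zero,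
        add_zero]
      rw [← Finset.sum_range_reflect (fun i => Real.cos ((m - i : ℝ) * θ) * (c i * c m)),
        ← Finset.sum_add_distrib]
      refine Finset.sum_congr rfl fun i hi => ?_
      have hi := Finset.mem_range.1 hi
      have h2 : m + 1 - (i + 1) = (m - (i + 1)) + 1 := by omega
      have h3 : m - 1 - i = m - (i + 1) := by omega
      have h4 : m - (i + 1) + (i + 1) = m := by omega
      have h5 : ((m : ℝ) - ((m - (i + 1) : ℕ) : ℝ)) = ((i + 1 : ℕ) : ℝ) := by
        rw [Nat.cast_sub (by omega)]; ring
      rw [h2, Finset.sum_range_succ, h3, h4, h5]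
      ring
    rw [h1, Finset.sum_range_succ, Finset.sum_range_succ, Finset.sum_range_succ]
    have h6 : ∑ i ∈ Finset.range m, Real.cos ((m - i : ℝ) * θ) * (c i * c m) =
        c m * Real.cos (m * θ) * (∑ j ∈ Finset.range m, c j * Real.cos (j * θ)) +
        c m * Real.sin (m * θ) * (∑ j ∈ Finset.range m, c j * Real.sin (j * θ)) := by
      rw [Finset.mul_sum, Finset.mul_sum, ← Finset.sum_add_distrib]
      refine Finset.sum_congr rfl fun i _ => ?_
      rw [sub_mul, Real.cos_sub]
      ring
    rw [h6]
    have h7 := Real.sin_sq_add_cos_sq (m * θ)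
    linear_combination ih + (c m) ^ 2 * h7

lemma sum_sin_mul_sin (α : ℝ) (i n : ℕ) :
    2 * Real.sin α * ∑ j ∈ Finset.range n,
      Real.sin ((j + 1 : ℕ) * α) * Real.sin ((j + i + 1 : ℕ) * α) =
    n * Real.cos (i * α) * Real.sin α - Real.sin (n * α) * Real.cos ((n + 1 + i) * α) := by
  induction n with
  | zero => simp
  | succ n ih =>
    rw [Finset.sum_range_succ, mul_add, ih]
    push_cast
    set x := (n : ℝ) * α with hx
    set y := (i : ℝ) * α with hy
    have e1 : ((n : ℝ) + 1) * α = x + α := by rw [hx]; ring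
    have e2 : ((n : ℝ) + i + 1) * α = x + y + α := by rw [hx, hy]; ring
    have e3 : ((n : ℝ) + 1 + i) * α = x + y + α := by rw [hx, hy]; ring
    have e4 : ((n : ℝ) + 1 + 1 + i) * α = x + y + α + α := by rw [hx, hy]; ring
    rw [e1, e2, e3, e4]
    have e5 : y = (x + y + α) - (x + α) := by ring
    conv_rhs => rw [add_mul, add_mul, one_mul]
    have e6 : Real.cos y = Real.cos (x + y + α) * Real.cos (x + α) +
        Real.sin (x + y + α) * Real.sin (x + α) := by
      conv_lhs => rw [e5, Real.cos_sub]
    rw [e6]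
    generalize x + y + α = z
    rw [Real.cos_add z α, Real.sin_add x α, Real.cos_add x α]
    have h7 := Real.sin_sq_add_cos_sq α
    linear_combination (Real.sin x * Real.cos z) * h7

section Jackson

variable (s : ℕ)

lemma jackson_angle_mem : Real.pi / (s + 2) ∈ Set.Ioc 0 (Real.pi / 2) := by
  have hs : (0 : ℝ) ≤ s := Nat.cast_nonneg s
  have hpi := Real.pi_pos
  refine ⟨by positivity, ?_⟩
  exact div_le_div_of_nonneg_left hpi.le two_pos (by linarith)

lemma sin_jackson_angle_pos : 0 < Real.sin (Real.pi / (s + 2)) := by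
  have h := jackson_angle_mem s
  exact Real.sin_pos_of_pos_of_lt_pi h.1 (by linarith [h.2, Real.pi_pos])

/-- Jackson's coefficients come from the sequence `sin ((j + 1) π / (s + 2))`. At this angle the
boundary term of `sum_sin_mul_sin` simplifies, because its cosine is evaluated at `π`. -/
lemma jackson_eq_autocorrelation {i : ℕ} (hi : i ≤ s) :
    ∑ j ∈ Finset.range (s + 1 - i), Real.sin ((j + 1 : ℕ) * (Real.pi / (s + 2))) *
      Real.sin ((j + i + 1 : ℕ) * (Real.pi / (s + 2))) = (s + 2) / 2 * jackson s i := by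
  set α := Real.pi / ((s : ℝ) + 2) with hα
  have hsin := sin_jackson_angle_pos s
  have hs : (0 : ℝ) < s + 2 := by positivity
  have h := sum_sin_mul_sin α i (s + 1 - i)
  have hc : ((s + 1 - i : ℕ) : ℝ) = (s : ℝ) + 1 - i := by
    rw [Nat.cast_sub (by omega)]; push_cast; ring
  have e1 : ((s : ℝ) + 1 - i + 1 + i) * α = Real.pi := by rw [hα]; field_simp; ring
  have e2 : ((s : ℝ) + 1 - i) * α = Real.pi - (i * α + α) := by rw [← e1]; ring
  rw [hc, e1, e2, Real.cos_pi, Real.sin_pi_sub, Real.sin_add] at h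
  have e3 : (i : ℝ) * Real.pi / (s + 2) = i * α := by rw [hα]; ring
  rw [← hα] at hsin
  rw [jackson, e3, ← hα, Real.cot_eq_cos_div_sin]
  refine mul_left_cancel₀ (mul_ne_zero two_ne_zero hsin.ne') ?_
  rw [h]
  generalize Real.sin (i * α) = x
  generalize Real.cos (i * α) = y
  generalize Real.sin α = z at *
  field_simp
  ring

/-- The trigonometric kernel with Jackson's coefficients. -/
noncomputable def jacksonKernel (θ : ℝ) : ℝ :=
  jackson s 0 + 2 * ∑ i ∈ Finset.range s, jackson s (i + 1) * Real.cos ((i + 1 : ℕ) * θ)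

lemma jacksonKernel_nonneg (θ : ℝ) : 0 ≤ jacksonKernel s θ := by
  set c : ℕ → ℝ := fun j => Real.sin ((j + 1 : ℕ) * (Real.pi / (s + 2))) with hc
  have h := sq_add_sq_eq_autocorrelation c θ (s + 1)
  have hs : (0 : ℝ) < s + 2 := by positivity
  have h0 : ∑ j ∈ Finset.range (s + 1), c j * c j = (s + 2) / 2 * jackson s 0 := by
    rw [← jackson_eq_autocorrelation s (Nat.zero_le s)]
    rfl
  have h1 : ∑ i ∈ Finset.range (s + 1), Real.cos ((i + 1 : ℕ) * θ) *
      ∑ j ∈ Finset.range (s + 1 - (i + 1)), c j * c (j + (i + 1)) =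
      (s + 2) / 2 * ∑ i ∈ Finset.range s, jackson s (i + 1) * Real.cos ((i + 1 : ℕ) * θ) := by
    rw [Finset.sum_range_succ, Nat.sub_self, Finset.range_zero, Finset.sum_empty, mul_zero,
      add_zero, Finset.mul_sum]
    refine Finset.sum_congr rfl fun i hi => ?_
    have hi : i + 1 ≤ s := Finset.mem_range.1 hi
    rw [← mul_assoc, ← jackson_eq_autocorrelation s hi, mul_comm]
  rw [h0, h1] at h
  have : jacksonKernel s θ = 2 / (s + 2) *
      ((∑ j ∈ Finset.range (s + 1), c j * Real.cos (j * θ)) ^ 2 +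
        (∑ j ∈ Finset.range (s + 1), c j * Real.sin (j * θ)) ^ 2) := by
    rw [h, jacksonKernel]
    generalize ∑ i ∈ Finset.range s, jackson s (i + 1) * Real.cos ((i + 1 : ℕ) * θ) = S
    field_simp
  rw [this]
  positivity

lemma jackson_zero : jackson s 0 = 1 := by
  have hs : (0 : ℝ) < s + 2 := by positivity
  rw [jackson]
  simp only [Nat.cast_zero, zero_mul, zero_div, Real.cos_zero, Real.sin_zero]
  field_simp
  ring

lemma jackson_one : jackson s 1 = Real.cos (Real.pi / (s + 2)) := by
  have hs : (0 : ℝ) < s + 2 := by positivity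
  have hsin := sin_jackson_angle_pos s
  rw [jackson, Nat.cast_one, one_mul, Real.cot_eq_cos_div_sin, mul_div_cancel₀ _ hsin.ne']
  field_simp
  ring

lemma jackson_two : jackson s 2 =
    2 * Real.cos (Real.pi / (s + 2)) ^ 2 - 1 +
      2 * (1 - Real.cos (Real.pi / (s + 2)) ^ 2) / (s + 2) := by
  have hs : (0 : ℝ) < s + 2 := by positivity
  have hsin := sin_jackson_angle_pos s
  rw [jackson, Nat.cast_ofNat, mul_div_assoc, Real.cot_eq_cos_div_sin, Real.cos_two_mul,
    Real.sin_two_mul]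
  field_simp
  ring

/-- The closed formula vanishes one index beyond the range, so moment identities of degree `s + 1`
need no separate form. This covers the first moment for `s = 0` and the second for `s = 1`. -/
lemma jackson_succ_self : jackson s (s + 1) = 0 := by
  have hs : (0 : ℝ) < s + 2 := by positivity
  have hsin := sin_jackson_angle_pos s
  have e : ((s + 1 : ℕ) : ℝ) * Real.pi / (s + 2) = Real.pi - Real.pi / (s + 2) := by
    push_cast; field_simp; ring
  rw [jackson, e, Real.cos_pi_sub, Real.sin_pi_sub, Real.cot_eq_cos_div_sin,
    mul_div_cancel₀ _ hsin.ne']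
  push_cast
  field_simp
  ring

lemma jackson_zero_two : jackson 0 2 = 0 := by
  rw [jackson_two]; simp

/-- The second moment bound behind Jackson's theorem. -/
lemma jackson_moment_le {u : ℝ} (hu : u ^ 2 ≤ 1) :
    u ^ 2 - 2 * u * (jackson s 1 * u) + (1 + jackson s 2 * (2 * u ^ 2 - 1)) / 2 ≤
      (Real.pi / (s + 2)) ^ 2 := by
  set α := Real.pi / ((s : ℝ) + 2) with hα
  have hs : (0 : ℝ) < s + 2 := by positivity
  have h1 : jackson s 1 = Real.cos α := jackson_one s
  have h2 := jackson_two s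
  rw [← hα] at h2
  set c := Real.cos α with hc
  have hc1 : c ≤ 1 := Real.cos_le_one α
  have hc2 : c ^ 2 ≤ 1 := by
    have := Real.neg_one_le_cos α
    nlinarith
  have h3 : 2 * c ^ 2 - 1 ≤ jackson s 2 := by
    rw [h2]
    have : 0 ≤ 2 * (1 - c ^ 2) / (s + 2) := div_nonneg (by linarith) hs.le
    linarith
  have h4 : jackson s 2 ≤ 1 := by
    rw [h2]
    have : 2 * (1 - c ^ 2) / (s + 2) ≤ 1 - c ^ 2 := by
      rw [div_le_iff₀ hs]
      have : (0 : ℝ) ≤ s := Nat.cast_nonneg s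
      nlinarith
    linarith
  have h5 : 2 * (1 - c) ≤ α ^ 2 := by
    have := Real.one_sub_sq_div_two_le_cos (x := α)
    linarith
  refine le_trans ?_ h5
  rw [h1]
  -- The left side is affine in `u²`. At `u² = 1` it is at most `2 (1 - c)` because `ρ_2 ≤ 1`; at
  -- `u² = 0` it is at most `1 - c² ≤ 2 (1 - c)` because `ρ_2 ≥ 2c² - 1`.
  nlinarith [mul_nonneg (sub_nonneg.2 hu) (sq_nonneg (1 - c)), sq_nonneg u,
    mul_nonneg (sub_nonneg.2 hu) (sub_nonneg.2 h3), mul_nonneg (sq_nonneg u) (sub_nonneg.2 h4)]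

end Jackson

end RandQuad

namespace RandQuad

/-! ### Jackson's theorem -/

section JacksonTheorem

variable {a b : ℝ}

lemma exists_eq_cos_of_mem_Icc (hab : a < b) {x : ℝ} (hx : x ∈ Set.Icc a b) :
    ∃ θ : ℝ, x = (b - a) / 2 * Real.cos θ + (a + b) / 2 := by
  have hba : 0 < b - a := sub_pos.2 hab
  refine ⟨Real.arccos ((2 * x - a - b) / (b - a)), ?_⟩
  rw [Real.cos_arccos]
  · field_simp; ring
  · rw [le_div_iff₀ hba]; linarith [hx.1]
  · rw [div_le_iff₀ hba]; linarith [hx.2]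

/-- The positive kernel `P_x` of Jackson-damped Chebyshev expansions. -/
noncomputable def jacksonPoly (a b : ℝ) (s : ℕ) (x : ℝ) : ℝ[X] :=
  ∑ i ∈ Finset.range (s + 1), C (jackson s i * (chebOrth a b i).eval x) * chebOrth a b i

/-- Product-to-sum formulas; the factor `√2 · √2` of the orthonormal polynomials supplies the 2 in
the trigonometric kernel. Positivity of `P_x` on the square follows. -/
lemma eval_jacksonPoly (hab : a < b) (s : ℕ) (θ φ : ℝ) :
    (jacksonPoly a b s ((b - a) / 2 * Real.cos θ + (a + b) / 2)).eval
      ((b - a) / 2 * Real.cos φ + (a + b) / 2) =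
    (jacksonKernel s (θ - φ) + jacksonKernel s (θ + φ)) / 2 := by
  rw [jacksonPoly, eval_finsetSum, Finset.sum_range_succ', jacksonKernel, jacksonKernel]
  have h : ∀ i ∈ Finset.range s, (C (jackson s (i + 1) * (chebOrth a b (i + 1)).eval
      ((b - a) / 2 * Real.cos θ + (a + b) / 2)) * chebOrth a b (i + 1)).eval
      ((b - a) / 2 * Real.cos φ + (a + b) / 2) =
      jackson s (i + 1) * Real.cos ((i + 1 : ℕ) * (θ - φ)) +
        jackson s (i + 1) * Real.cos ((i + 1 : ℕ) * (θ + φ)) := by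
    intro i _
    rw [chebOrth, if_neg (Nat.succ_ne_zero i)]
    simp only [eval_mul, eval_C, eval_chebPoly hab]
    rw [mul_sub, mul_add, Real.cos_sub, Real.cos_add]
    have := Real.mul_self_sqrt (zero_le_two (α := ℝ))
    linear_combination jackson s (i + 1) * Real.cos ((i + 1 : ℕ) * θ) *
      Real.cos ((i + 1 : ℕ) * φ) * this
  rw [Finset.sum_congr rfl h, Finset.sum_add_distrib, chebOrth, if_pos rfl]
  simp only [eval_mul, eval_C, eval_chebPoly hab, Nat.cast_zero, zero_mul, Real.cos_zero]
  ring

lemma eval_jacksonPoly_nonneg (hab : a < b) (s : ℕ) {x y : ℝ} (hx : x ∈ Set.Icc a b)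
    (hy : y ∈ Set.Icc a b) : 0 ≤ (jacksonPoly a b s x).eval y := by
  obtain ⟨θ, rfl⟩ := exists_eq_cos_of_mem_Icc hab hx
  obtain ⟨φ, rfl⟩ := exists_eq_cos_of_mem_Icc hab hy
  rw [eval_jacksonPoly hab]
  have := jacksonKernel_nonneg s (θ - φ)
  have := jacksonKernel_nonneg s (θ + φ)
  positivity

/-- A Lipschitz function is close to its average against a positive kernel with a small second
moment. -/
lemma abs_sub_integral_le_of_moment {κ : Measure ℝ} [IsFiniteMeasure κ]
    (hκ : κ (Set.Icc a b)ᶜ = 0) {p : ℝ[X]} (hp : ∀ y ∈ Set.Icc a b, 0 ≤ p.eval y)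
    (hp1 : ∫ y, p.eval y ∂κ = 1) {x t : ℝ} (ht : 0 < t)
    (hm : ∫ y, (x - y) ^ 2 * p.eval y ∂κ ≤ t ^ 2) {f : ℝ → ℝ} (hf : LipschitzWith 1 f) :
    |f x - ∫ y, f y * p.eval y ∂κ| ≤ t := by
  have hae : ∀ᵐ y ∂κ, y ∈ Set.Icc a b := hκ
  have hint : ∀ {g : ℝ → ℝ}, Continuous g → Integrable g κ :=
    fun hg => integrable_of_continuous_of_compl_Icc hκ hg
  have hfc := hf.continuous
  have hpc := p.continuous
  have h1 : f x - ∫ y, f y * p.eval y ∂κ = ∫ y, (f x - f y) * p.eval y ∂κ := by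
    simp_rw [sub_mul]
    rw [integral_sub (hint (by fun_prop)) (hint (by fun_prop)), integral_const_mul, hp1, mul_one]
  rw [h1]
  refine (abs_integral_le_integral_abs).trans ?_
  calc ∫ y, |(f x - f y) * p.eval y| ∂κ
      ≤ ∫ y, (t / 2) * p.eval y + (1 / (2 * t)) * ((x - y) ^ 2 * p.eval y) ∂κ := by
        refine integral_mono_ae (hint (by fun_prop)) (hint (by fun_prop)) ?_
        filter_upwards [hae] with y hy
        rw [abs_mul, abs_of_nonneg (hp y hy)]
        have h2 : |f x - f y| ≤ |x - y| := by
          have := hf.dist_le_mul x y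
          rwa [Real.dist_eq, Real.dist_eq, NNReal.coe_one, one_mul] at this
        -- The arithmetic–geometric mean inequality replaces Cauchy–Schwarz: only the mass and the
        -- second moment of the kernel are needed.
        have h3 : |x - y| ≤ t / 2 + 1 / (2 * t) * (x - y) ^ 2 := by
          rw [← sq_abs (x - y)]
          have : t / 2 + 1 / (2 * t) * |x - y| ^ 2 - |x - y| = (|x - y| - t) ^ 2 / (2 * t) := by
            field_simp; ring
          have h4 : 0 ≤ (|x - y| - t) ^ 2 / (2 * t) := by positivity
          linarith
        calc |f x - f y| * p.eval y ≤ (t / 2 + 1 / (2 * t) * (x - y) ^ 2) * p.eval y :=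
              mul_le_mul_of_nonneg_right (h2.trans h3) (hp y hy)
          _ = _ := by ring
    _ = t / 2 + 1 / (2 * t) * ∫ y, (x - y) ^ 2 * p.eval y ∂κ := by
        rw [integral_add (hint (by fun_prop)) (hint (by fun_prop)), integral_const_mul,
          integral_const_mul, hp1, mul_one]
    _ ≤ t / 2 + 1 / (2 * t) * t ^ 2 := by gcongr
    _ = t := by field_simp; ring

/-- Orthonormality picks out the `j`-th term of the kernel. For `j = s + 1` there is no such term,
in agreement with `jackson_succ_self`. -/
lemma polyInt_chebOrth_mul_jacksonPoly {κ : Measure ℝ} (h : PolyIntegrable κ) (s j : ℕ) (x : ℝ)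
    (hj : j ≤ s + 1)
    (horth : ∀ i ≤ s, polyInt h (chebOrth a b j * chebOrth a b i) = if j = i then 1 else 0) :
    polyInt h (chebOrth a b j * jacksonPoly a b s x) =
      jackson s j * (chebOrth a b j).eval x := by
  rw [jacksonPoly, Finset.mul_sum, map_sum]
  have h1 : ∀ i ∈ Finset.range (s + 1), polyInt h (chebOrth a b j *
      (C (jackson s i * (chebOrth a b i).eval x) * chebOrth a b i)) =
      if j = i then jackson s i * (chebOrth a b i).eval x else 0 := by
    intro i hi
    rw [mul_left_comm, polyInt_C_mul, horth i (Nat.lt_succ_iff.1 (Finset.mem_range.1 hi))]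
    split_ifs <;> simp
  rw [Finset.sum_congr rfl h1, Finset.sum_ite_eq]
  split_ifs with hjs
  · rfl
  · have : j = s + 1 := by
      rw [Finset.mem_range] at hjs; omega
    rw [this, jackson_succ_self, zero_mul]

/-- `κ` integrates the products of low-degree Chebyshev polynomials like the Chebyshev
distribution; in degree two a bound on Jackson's kernel is enough. -/
structure ChebExact (a b : ℝ) (s : ℕ) {κ : Measure ℝ} (h : PolyIntegrable κ) : Prop where
  low : ∀ j ≤ 1, ∀ i ≤ s,
    polyInt h (chebOrth a b j * chebOrth a b i) = if j = i then 1 else 0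
  two : ∀ x, polyInt h (chebOrth a b 2 * jacksonPoly a b s x) ≤
    jackson s 2 * (chebOrth a b 2).eval x

lemma chebPoly_two (a b : ℝ) :
    chebPoly a b 2 = C 2 * (chebPoly a b 1 * chebPoly a b 1) - 1 := by
  have : Chebyshev.T ℝ ((2 : ℕ) : ℤ) = C 2 * (X * X) - 1 := by
    rw [Nat.cast_ofNat, Chebyshev.T_two, sq, map_ofNat]
  rw [chebPoly, this, chebPoly]
  simp

lemma chebOrth_zero (a b : ℝ) : chebOrth a b 0 = 1 := by simp [chebOrth, chebPoly]

/-- Jackson's bound for a measure that integrates the products of low-degree Chebyshev polynomials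
like the Chebyshev distribution. -/
lemma ChebExact.abs_sub_integral_jacksonPoly_le (hab : a < b) {κ : Measure ℝ} [IsFiniteMeasure κ]
    (hκ : κ (Set.Icc a b)ᶜ = 0) {h : PolyIntegrable κ} {s : ℕ} (hex : ChebExact a b s h)
    {f : ℝ → ℝ} (hf : LipschitzWith 1 f) {x : ℝ} (hx : x ∈ Set.Icc a b) :
    |f x - ∫ y, f y * (jacksonPoly a b s x).eval y ∂κ| ≤ Real.pi * (b - a) / (2 * (s + 2)) := by
  have hba : 0 < b - a := sub_pos.2 hab
  have hs : (0 : ℝ) < s + 2 := by positivity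
  have hpi := Real.pi_pos
  have hsqrt := Real.mul_self_sqrt (zero_le_two (α := ℝ))
  have hsq0 : 0 < Real.sqrt 2 := by positivity
  have L0 := polyInt_chebOrth_mul_jacksonPoly h s 0 x (by omega) (hex.low 0 (by omega))
  have L1 := polyInt_chebOrth_mul_jacksonPoly h s 1 x (by omega) (hex.low 1 (by omega))
  have L2 := hex.two x
  rw [chebOrth_zero, one_mul, jackson_zero, eval_one, mul_one] at L0
  rw [chebOrth, if_neg one_ne_zero, mul_assoc, polyInt_C_mul, eval_mul, eval_C,
    mul_left_comm, mul_right_inj' hsq0.ne'] at L1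
  rw [chebOrth, if_neg two_ne_zero, mul_assoc, polyInt_C_mul, eval_mul, eval_C,
    mul_left_comm, mul_le_mul_iff_right₀ hsq0] at L2
  set P := jacksonPoly a b s x with hP
  set τ := chebPoly a b 1 with hτ
  have hτ2 : chebPoly a b 2 = C 2 * (τ * τ) - 1 := chebPoly_two a b
  have hττ : polyInt h (τ * τ * P) ≤ (1 + jackson s 2 * (2 * (τ.eval x) ^ 2 - 1)) / 2 := by
    rw [hτ2, sub_mul, map_sub, mul_assoc (C 2), polyInt_C_mul, one_mul, L0] at L2
    simp only [eval_sub, eval_mul, eval_C, eval_one] at L2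
    rw [sq]
    linarith
  have hτx : ∀ y, τ.eval y = (2 * y - a - b) / (b - a) := by
    intro y
    rw [hτ, chebPoly]
    simp
    field_simp
    ring
  have hu : (τ.eval x) ^ 2 ≤ 1 := by
    rw [hτx, div_pow, div_le_one (by positivity)]
    exact sq_le_sq' (by linarith [hx.1]) (by linarith [hx.2])
  -- In the variable `τ`, which maps `[a, b]` to `[-1, 1]`, the square expands into moments of
  -- degrees 0, 1 and 2 of the kernel, supplied by `L0`, `L1` and `hττ`. The scale `(b - a) / 2`
  -- produces the constant.
  have hmom : ∫ y, (x - y) ^ 2 * P.eval y ∂κ ≤ (Real.pi * (b - a) / (2 * (s + 2))) ^ 2 := by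
    have e1 : ∫ y, (x - y) ^ 2 * P.eval y ∂κ = polyInt h (C (((b - a) / 2) ^ 2) *
        (C ((τ.eval x) ^ 2) * P - C (2 * τ.eval x) * (τ * P) + τ * τ * P)) := by
      rw [polyInt_apply]
      congr 1
      funext y
      have : x - y = (b - a) / 2 * (τ.eval x - τ.eval y) := by
        rw [hτx, hτx]; field_simp; ring
      simp only [eval_mul, eval_add, eval_sub, eval_C]
      rw [this]
      ring
    rw [e1, polyInt_C_mul, map_add, map_sub, polyInt_C_mul, polyInt_C_mul, L0, L1]
    have hj := jackson_moment_le s hu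
    calc ((b - a) / 2) ^ 2 * (τ.eval x ^ 2 * 1 - 2 * τ.eval x * (jackson s 1 * τ.eval x) +
          polyInt h (τ * τ * P))
        ≤ ((b - a) / 2) ^ 2 * (Real.pi / (s + 2)) ^ 2 := by
          refine mul_le_mul_of_nonneg_left ?_ (sq_nonneg _)
          linarith
      _ = _ := by field_simp
  exact abs_sub_integral_le_of_moment hκ (fun y hy => eval_jacksonPoly_nonneg hab s hx hy)
    (by rw [← polyInt_apply h, L0]) (by positivity) hmom hf

/-- The operator `f ↦ ∑ i ∈ I, (∫ f e_i dκ) q_i`. -/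
noncomputable def kernelOp {ι : Type*} (κ : Measure ℝ) (I : Finset ι) (e : ι → ℝ → ℝ)
    (q : ι → ℝ[X]) (f : ℝ → ℝ) : ℝ[X] :=
  ∑ i ∈ I, C (∫ y, f y * e i y ∂κ) * q i

/-- The Jackson-damped Chebyshev expansion whose coefficients are integrals against `κ`. -/
noncomputable def jacksonOp (a b : ℝ) (s : ℕ) (κ : Measure ℝ) : (ℝ → ℝ) → ℝ[X] :=
  kernelOp κ (Finset.range (s + 1)) (fun i y => jackson s i * (chebOrth a b i).eval y)
    (chebOrth a b)

lemma eval_jacksonOp {κ : Measure ℝ} [IsFiniteMeasure κ] (hκ : κ (Set.Icc a b)ᶜ = 0) (s : ℕ)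
    {f : ℝ → ℝ} (hf : Continuous f) (x : ℝ) :
    (jacksonOp a b s κ f).eval x = ∫ y, f y * (jacksonPoly a b s x).eval y ∂κ := by
  simp only [jacksonOp, kernelOp, jacksonPoly, eval_finsetSum, eval_mul, eval_C, Finset.mul_sum]
  rw [integral_finsetSum]
  · refine Finset.sum_congr rfl fun i _ => ?_
    rw [← integral_mul_const]
    congr 1
    funext y
    ring
  · intro i _
    refine integrable_of_continuous_of_compl_Icc hκ ?_
    have := (chebOrth a b i).continuous
    fun_prop

lemma opDampedApprox_eq_jacksonOp (hab : a < b) (s : ℕ) :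
    opDampedApprox (chebMeasure a b) s = jacksonOp a b s (chebMeasure a b) := by
  funext f
  rw [opDampedApprox, jacksonOp, kernelOp]
  refine Finset.sum_congr rfl fun i _ => ?_
  rw [← integral_const_mul]
  simp_rw [mul_left_comm, orthPoly_chebMeasure hab]

lemma chebExact_chebMeasure (hab : a < b) (s : ℕ) :
    ChebExact a b s (polyIntegrable_chebMeasure hab) := by
  refine ⟨fun j _ i _ => polyInt_chebOrth_mul hab j i, fun x => ?_⟩
  have h := polyIntegrable_chebMeasure hab
  by_cases hs : 2 ≤ s + 1
  · rw [polyInt_chebOrth_mul_jacksonPoly h s 2 x hs (fun i _ => polyInt_chebOrth_mul hab 2 i)]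
  · have : s = 0 := by omega
    subst this
    rw [jackson_zero_two, zero_mul, jacksonPoly]
    simp only [zero_add, Finset.range_one, Finset.sum_singleton]
    rw [mul_left_comm, polyInt_C_mul, polyInt_chebOrth_mul hab]
    simp

/-- Jackson-damped Chebyshev expansions converge at the rate of Jackson's theorem. -/
lemma ChebExact.abs_sub_jacksonOp_le (hab : a < b) {κ : Measure ℝ} [IsFiniteMeasure κ]
    (hκ : κ (Set.Icc a b)ᶜ = 0) {h : PolyIntegrable κ} {s : ℕ} (hex : ChebExact a b s h)
    {f : ℝ → ℝ} (hf : LipschitzWith 1 f) {x : ℝ} (hx : x ∈ Set.Icc a b) :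
    |f x - (jacksonOp a b s κ f).eval x| ≤ Real.pi * (b - a) / (2 * (s + 2)) := by
  rw [eval_jacksonOp hκ s hf.continuous]
  exact hex.abs_sub_integral_jacksonPoly_le hab hκ hf hx

lemma ChebExact.jacksonOp_one {κ : Measure ℝ} [IsFiniteMeasure κ]
    (hκ : κ (Set.Icc a b)ᶜ = 0) {h : PolyIntegrable κ} {s : ℕ} (hex : ChebExact a b s h) :
    jacksonOp a b s κ (fun _ => 1) = 1 := by
  refine Polynomial.funext fun x => ?_
  rw [eval_jacksonOp hκ s continuous_const, eval_one]
  have L0 := polyInt_chebOrth_mul_jacksonPoly h s 0 x (by omega) (hex.low 0 (by omega))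
  rw [chebOrth_zero, one_mul, jackson_zero, eval_one, mul_one] at L0
  simpa [polyInt_apply] using L0

lemma degree_opDampedApprox_lt (s : ℕ) (f : ℝ → ℝ) :
    (opDampedApprox (chebMeasure a b) s f).degree < (s + 1 : ℕ) := by
  refine degree_sum_lt_of_forall fun i hi => ?_
  refine ((degree_C_mul_le_degree _ _).trans (degree_orthPoly_le _ i)).trans_lt ?_
  exact_mod_cast Finset.mem_range.1 hi

/-- **Jackson's theorem** for Lipschitz functions. -/
lemma exists_poly_abs_sub_le (hab : a ≤ b) (s : ℕ) {f : ℝ → ℝ} (hf : LipschitzWith 1 f) :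
    ∃ p : ℝ[X], p.degree < (s + 1 : ℕ) ∧
      ∀ x ∈ Set.Icc a b, |f x - p.eval x| ≤ Real.pi * (b - a) / (2 * (s + 2)) := by
  rcases hab.lt_or_eq with hab | rfl
  · have := isProbabilityMeasure_chebMeasure hab
    refine ⟨opDampedApprox (chebMeasure a b) s f, degree_opDampedApprox_lt s f, fun x hx => ?_⟩
    rw [opDampedApprox_eq_jacksonOp hab]
    exact (chebExact_chebMeasure hab s).abs_sub_jacksonOp_le hab (chebMeasure_compl_Icc a b) hf hx
  · refine ⟨C (f a), degree_C_le.trans_lt (by exact_mod_cast Nat.succ_pos s), fun x hx => ?_⟩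
    rw [Set.Icc_self, Set.mem_singleton_iff] at hx
    simp [hx]

end JacksonTheorem

end RandQuad

namespace RandQuad

/-! ### Atomic measures -/

section Atomic

variable {ι : Type*} {I : Finset ι} {c x : ι → ℝ}

/-- The measure `∑ i ∈ I, c_i δ_{x_i}`. -/
noncomputable def atomicMeasure (I : Finset ι) (c x : ι → ℝ) : Measure ℝ :=
  ∑ i ∈ I, ENNReal.ofReal (c i) • Measure.dirac (x i)

instance : IsFiniteMeasure (atomicMeasure I c x) := by
  refine ⟨?_⟩
  rw [atomicMeasure, Measure.finsetSum_apply]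
  refine ENNReal.sum_lt_top.2 fun i _ => ?_
  simp

lemma integral_atomicMeasure (hc : ∀ i ∈ I, 0 ≤ c i) (f : ℝ → ℝ) :
    ∫ y, f y ∂atomicMeasure I c x = ∑ i ∈ I, f (x i) * c i := by
  rw [atomicMeasure, integral_finsetSum_measure]
  · refine Finset.sum_congr rfl fun i hi => ?_
    rw [integral_smul_measure, integral_dirac, ENNReal.toReal_ofReal (hc i hi), smul_eq_mul,
      mul_comm]
  · intro i _
    exact (integrable_dirac (by simp)).smul_measure ENNReal.ofReal_ne_top

lemma integrable_atomicMeasure (f : ℝ → ℝ) : Integrable f (atomicMeasure I c x) := by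
  rw [atomicMeasure, integrable_finsetSum_measure]
  intro i _
  exact (integrable_dirac (by simp)).smul_measure ENNReal.ofReal_ne_top

lemma atomicMeasure_compl_Icc {a b : ℝ} (hx : ∀ i ∈ I, x i ∈ Set.Icc a b) :
    atomicMeasure I c x (Set.Icc a b)ᶜ = 0 := by
  rw [atomicMeasure, Measure.finsetSum_apply]
  refine Finset.sum_eq_zero fun i hi => ?_
  rw [Measure.smul_apply, Measure.dirac_apply' _ measurableSet_Icc.compl, Set.indicator_of_notMem]
  · simp
  · exact fun h => h (hx i hi)

end Atomic

/-! ### Approximation operators given by a finite-rank kernel -/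

section Kernel

variable {ι : Type*} {I : Finset ι} {e : ι → ℝ → ℝ} {q : ι → ℝ[X]} {κ ν : Measure ℝ}

/-- The density with respect to `κ` of the quadrature approximation of `ν`. -/
noncomputable def kernelDensity (I : Finset ι) (e : ι → ℝ → ℝ) (q : ι → ℝ[X]) (ν : Measure ℝ)
    (y : ℝ) : ℝ :=
  ∑ i ∈ I, (∫ z, (q i).eval z ∂ν) * e i y

/-- Duality: the approximation of `ν` is the signed measure with density `kernelDensity` against
`κ`. This one form covers discrete and continuous rules. -/
lemma integral_kernelOp (hν : PolyIntegrable ν) {f : ℝ → ℝ}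
    (hf : ∀ i ∈ I, Integrable (fun y => f y * e i y) κ) :
    ∫ y, (kernelOp κ I e q f).eval y ∂ν = ∫ y, f y * kernelDensity I e q ν y ∂κ := by
  rw [← polyInt_apply hν, kernelOp, map_sum]
  simp only [kernelDensity, Finset.mul_sum]
  rw [integral_finsetSum]
  · refine Finset.sum_congr rfl fun i _ => ?_
    rw [polyInt_C_mul, polyInt_apply, mul_comm, ← integral_const_mul]
    congr 1
    funext y
    ring
  · intro i hi
    refine ((hf i hi).const_mul (∫ z, (q i).eval z ∂ν)).congr
      (Filter.Eventually.of_forall fun y => ?_)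
    simp only
    ring

lemma measurable_kernelDensity (he : ∀ i ∈ I, Measurable (e i)) :
    Measurable (kernelDensity I e q ν) :=
  Finset.measurable_fun_sum _ fun i hi => (he i hi).const_mul _

lemma integrable_kernelDensity (he : ∀ i ∈ I, Integrable (e i) κ) :
    Integrable (kernelDensity I e q ν) κ :=
  integrable_finsetSum _ fun i hi => (he i hi).const_mul _

lemma inducedQuad_kernelOp (hν : PolyIntegrable ν) (he : ∀ i ∈ I, Integrable (e i) κ) (x : ℝ) :
    inducedQuad (kernelOp κ I e q) ν x = ∫ y in Set.Iic x, kernelDensity I e q ν y ∂κ := by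
  have hind : ∀ (g : ℝ → ℝ) y, Set.indicator (Set.Iic x) (fun _ => (1 : ℝ)) y * g y =
      Set.indicator (Set.Iic x) g y := by
    intro g y
    by_cases h : y ∈ Set.Iic x <;> simp [h]
  rw [inducedQuad, integral_kernelOp hν, ← integral_indicator measurableSet_Iic]
  · simp_rw [hind]
  · intro i hi
    simp_rw [hind]
    exact (he i hi).indicator measurableSet_Iic

lemma integrable_continuous_mul {a b : ℝ} (hκ : κ (Set.Icc a b)ᶜ = 0) {f g : ℝ → ℝ}
    (hf : Continuous f) (hg : Integrable g κ) : Integrable (fun y => f y * g y) κ := by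
  obtain ⟨C, hC⟩ := isCompact_Icc.exists_bound_of_continuousOn (s := Set.Icc a b) hf.continuousOn
  refine hg.bdd_mul (c := C) hf.aestronglyMeasurable ?_
  have h : ∀ᵐ y ∂κ, y ∈ Set.Icc a b := hκ
  filter_upwards [h] with y hy using hC y hy

variable {a b : ℝ} [IsFiniteMeasure κ] [IsProbabilityMeasure ν]

/-- Kantorovich–Rubinstein duality between `ν` with density 1 and `κ` with density `kernelDensity`;
`hone` says that the masses agree. -/
lemma wassersteinDist_kernelOp_le (hab : a ≤ b) (hκ : κ (Set.Icc a b)ᶜ = 0)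
    (hν : ν (Set.Icc a b)ᶜ = 0) (hem : ∀ i ∈ I, Measurable (e i))
    (hei : ∀ i ∈ I, Integrable (e i) κ) (hone : ∫ y, (kernelOp κ I e q fun _ => 1).eval y ∂ν = 1)
    {M : ℝ} (h : ∀ f : ℝ → ℝ, LipschitzWith 1 f →
      ∫ y, f y ∂ν - ∫ y, (kernelOp κ I e q f).eval y ∂ν ≤ M) :
    wassersteinDist (fun x => ν.real (Set.Iic x)) (inducedQuad (kernelOp κ I e q) ν) ≤
      ENNReal.ofReal M := by
  have hνp := polyIntegrable_of_compl_Icc hν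
  have hd := lintegral_abs_sub_le_of_lipschitz hab hν hκ (u := fun _ => 1) measurable_const
    (integrable_const 1) (measurable_kernelDensity (q := q) (ν := ν) hem)
    (integrable_kernelDensity hei) ?_ (M := M) ?_
  · refine le_trans (le_of_eq ?_) hd
    rw [wassersteinDist]
    congr 1
    funext x
    rw [inducedQuad_kernelOp hνp hei, setIntegral_const, smul_eq_mul, mul_one]
  · rw [integral_kernelOp hνp (by simpa using hei)] at hone
    simpa using hone.symm
  · intro f hf
    have := h f hf
    rw [integral_kernelOp hνp fun i hi => integrable_continuous_mul hκ hf.continuous (hei i hi)]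
      at this
    simpa using this

/-- The error of a quadrature approximation that is exact for polynomials of degree at most `s`, in
terms of its total variation. -/
lemma wassersteinDist_kernelOp_le_totalVar (hab : a ≤ b) (hκ : κ (Set.Icc a b)ᶜ = 0)
    (hν : ν (Set.Icc a b)ᶜ = 0) (hem : ∀ i ∈ I, Measurable (e i))
    (hei : ∀ i ∈ I, Integrable (e i) κ) {s : ℕ}
    (hrep : ∀ p : ℝ[X], p.degree < (s + 1 : ℕ) → kernelOp κ I e q (fun y => p.eval y) = p) :
    wassersteinDist (fun x => ν.real (Set.Iic x)) (inducedQuad (kernelOp κ I e q) ν) ≤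
      ENNReal.ofReal (Real.pi * (b - a) / (2 * (s + 2))) *
        (1 + totalVar (inducedQuad (kernelOp κ I e q) ν)) := by
  have hνp := polyIntegrable_of_compl_Icc hν
  set M := Real.pi * (b - a) / (2 * (s + 2)) with hM
  have hba : 0 ≤ b - a := sub_nonneg.2 hab
  have hM0 : 0 ≤ M := by have := Real.pi_pos; positivity
  set V := totalVar (inducedQuad (kernelOp κ I e q) ν) with hV
  by_cases htop : ENNReal.ofReal M * (1 + V) = ⊤
  · rw [htop]; exact le_top
  rw [← ENNReal.ofReal_toReal htop]
  have hw := integrable_kernelDensity (q := q) (ν := ν) hei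
  refine wassersteinDist_kernelOp_le hab hκ hν hem hei ?_ fun f hf => ?_
  · have := hrep 1 (degree_one_le.trans_lt (by exact_mod_cast Nat.succ_pos s))
    simp only [eval_one] at this
    rw [this]
    simp
  · obtain ⟨p, hp, hpf⟩ := exists_poly_abs_sub_le hab s hf
    have hfc := hf.continuous
    have hpc := p.continuous
    have h1 : ∫ y, p.eval y ∂ν = ∫ y, p.eval y * kernelDensity I e q ν y ∂κ := by
      rw [← integral_kernelOp hνp fun i hi => integrable_continuous_mul hκ hpc (hei i hi),
        hrep p hp]
    rw [integral_kernelOp hνp fun i hi => integrable_continuous_mul hκ hfc (hei i hi)]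
    -- The Jackson approximant `p` is integrated exactly, so `f` may be replaced by `f - p` on both
    -- sides. The first integral costs `M`, the second `M` times the total variation.
    have h2 : ∫ y, f y ∂ν - ∫ y, f y * kernelDensity I e q ν y ∂κ =
        ∫ y, f y - p.eval y ∂ν - ∫ y, (f y - p.eval y) * kernelDensity I e q ν y ∂κ := by
      simp_rw [sub_mul]
      rw [integral_sub (integrable_of_continuous_of_compl_Icc hν hfc) (hνp p),
        integral_sub (integrable_continuous_mul hκ hfc hw) (integrable_continuous_mul hκ hpc hw),
        h1]
      ring
    have h3 : ∫ y, f y - p.eval y ∂ν ≤ M := by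
      have hae : ∀ᵐ y ∂ν, y ∈ Set.Icc a b := hν
      calc ∫ y, f y - p.eval y ∂ν ≤ ∫ _, M ∂ν := by
            refine integral_mono_ae (integrable_of_continuous_of_compl_Icc hν (by fun_prop))
              (integrable_const _) ?_
            filter_upwards [hae] with y hy using (le_abs_self _).trans (hpf y hy)
        _ = M := by simp
    have h4 := abs_integral_mul_le_totalVar hab hκ hw (h := fun y => f y - p.eval y)
      (by fun_prop) hpf
    have h5 : (fun x => ∫ y in Set.Iic x, kernelDensity I e q ν y ∂κ) =
        inducedQuad (kernelOp κ I e q) ν := by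
      funext x; rw [inducedQuad_kernelOp hνp hei]
    rw [h5, ← hV] at h4
    rw [h2]
    have h6 : ENNReal.ofReal (∫ y, f y - p.eval y ∂ν -
        ∫ y, (f y - p.eval y) * kernelDensity I e q ν y ∂κ) ≤ ENNReal.ofReal M * (1 + V) := by
      rw [mul_add, mul_one]
      refine le_trans (ENNReal.ofReal_le_ofReal ?_) (ENNReal.ofReal_add_le.trans (add_le_add
        (ENNReal.ofReal_le_ofReal h3) h4))
      have := neg_abs_le (∫ y, (f y - p.eval y) * kernelDensity I e q ν y ∂κ)
      linarith
    exact (ENNReal.ofReal_le_iff_le_toReal htop).1 h6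

end Kernel

/-! ### The quadrature approximations as kernel operators -/

section Operators

variable {a b : ℝ} {μ ν : Measure ℝ}

/-- The base measure is the counting measure on the nodes, so integrating against the indicator of a
node evaluates `f` there. -/
lemma interpAt_eq_kernelOp (nodes : Finset ℝ) :
    interpAt nodes = kernelOp (atomicMeasure nodes (fun _ => 1) id) nodes
      (fun x => Set.indicator {x} fun _ => 1) (Lagrange.basis nodes id) := by
  funext f
  rw [interpAt, Lagrange.interpolate_apply, kernelOp]
  refine Finset.sum_congr rfl fun x hx => ?_
  rw [integral_atomicMeasure fun _ _ => zero_le_one, Finset.sum_eq_single x]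
  · simp
  · intro y _ hyx
    simp [hyx]
  · exact fun h => absurd hx h

lemma opApprox_eq_kernelOp (μ : Measure ℝ) (s : ℕ) :
    opApprox μ s = kernelOp μ (Finset.range (s + 1)) (fun i y => (orthPoly μ i).eval y)
      (orthPoly μ) := rfl

lemma gaussCount_orthNondeg (ν : Measure ℝ) (k : ℕ) : OrthNondeg ν (gaussCount ν k) := by
  classical
  have := Nat.findGreatest_spec (P := fun j => ∀ i < j, ∫ x, ((monicOrth ν i).eval x) ^ 2 ∂ν ≠ 0)
    (Nat.zero_le k) (fun i hi => absurd hi (Nat.not_lt_zero i))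
  unfold gaussCount OrthNondeg
  convert this

lemma gaussCount_le (ν : Measure ℝ) (k : ℕ) : gaussCount ν k ≤ k := by
  unfold gaussCount
  exact Nat.findGreatest_le k

lemma le_gaussCount {k j : ℕ} (hj : OrthNondeg ν j) (hjk : j ≤ k) : j ≤ gaussCount ν k := by
  unfold gaussCount
  exact Nat.le_findGreatest hjk hj

lemma gaussCount_eq {k : ℕ} (hk : OrthNondeg ν k) : gaussCount ν k = k :=
  le_antisymm (gaussCount_le ν k) (le_gaussCount hk le_rfl)

/-- A Gaussian quadrature rule with `k` nodes is exact in degree less than `2k`. -/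
lemma integral_interpAt_gaussNodes (h : PolyIntegrable ν) {k : ℕ} {p : ℝ[X]}
    (hp : p.degree < (2 * k : ℕ)) :
    ∫ y, (interpAt (gaussNodes ν k) (fun x => p.eval x)).eval y ∂ν = ∫ y, p.eval y ∂ν := by
  rcases (gaussCount_le ν k).lt_or_eq with hlt | heq
  -- If the rule stops early, maximality of the node count gives the nodal polynomial norm zero.
  -- Then `ν` lives on the nodes, where the interpolant equals `p`.
  · have hnot : ¬ OrthNondeg ν (gaussCount ν k + 1) := by
      intro h'
      have := le_gaussCount h' hlt
      omega
    have hzero : polyInt h (monicOrth ν (gaussCount ν k) * monicOrth ν (gaussCount ν k)) = 0 := by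
      by_contra hne
      refine hnot fun i hi => ?_
      rcases Nat.lt_succ_iff_lt_or_eq.1 hi with hi | rfl
      · exact gaussCount_orthNondeg ν k i hi
      · simpa [polyInt_apply, sq] using hne
    refine integral_congr_ae ?_
    filter_upwards [ae_eval_eq_zero_of_polyInt_sq h hzero] with y hy
    have hmem : y ∈ gaussNodes ν k := by
      rw [gaussNodes, orthNodes, Multiset.mem_toFinset, mem_roots (monicOrth_monic _ _).ne_zero]
      exact hy
    exact Lagrange.eval_interpolate_at_node (v := id) _ Function.injective_id.injOn hmem
  · have hk := gaussCount_orthNondeg ν k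
    rw [heq] at hk
    rw [gaussNodes, heq]
    exact hk.integral_interpAt_eval h hp

/-- Gaussian quadrature as integration against an atomic measure. -/
noncomputable def gaussMeasure (ν : Measure ℝ) (k : ℕ) : Measure ℝ :=
  atomicMeasure (gaussNodes ν k) (quadWeight ν (gaussNodes ν k)) id

lemma integral_gaussMeasure (h : PolyIntegrable ν) (k : ℕ) (f : ℝ → ℝ) :
    ∫ y, f y ∂gaussMeasure ν k = gaussIntegral ν k f := by
  have hw : ∀ x ∈ gaussNodes ν k, 0 ≤ quadWeight ν (gaussNodes ν k) x := fun x hx =>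
    (gaussCount_orthNondeg ν k).quadWeight_nonneg h hx
  rw [gaussMeasure, integral_atomicMeasure hw, gaussIntegral, integral_interpAt h]
  rfl

instance (k : ℕ) : IsFiniteMeasure (gaussMeasure ν k) := by
  unfold gaussMeasure; infer_instance

lemma gaussMeasure_compl_Icc [IsFiniteMeasure ν] (hν : ν (Set.Icc a b)ᶜ = 0) (k : ℕ) :
    gaussMeasure ν k (Set.Icc a b)ᶜ = 0 :=
  atomicMeasure_compl_Icc fun _ hx =>
    (gaussCount_orthNondeg ν k).orthNodes_subset (polyIntegrable_of_compl_Icc hν) hν hx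

lemma opDampedInterp_eq_jacksonOp (hab : a < b) (s : ℕ) :
    opDampedInterp (chebMeasure a b) s =
      jacksonOp a b s (gaussMeasure (chebMeasure a b) (s + 1)) := by
  funext f
  rw [opDampedInterp, jacksonOp, kernelOp]
  refine Finset.sum_congr rfl fun i _ => ?_
  rw [← integral_gaussMeasure (polyIntegrable_chebMeasure hab), ← integral_const_mul]
  simp_rw [mul_left_comm, orthPoly_chebMeasure hab]

/-- The `(s + 1)`-point rule is exact up to degree `2s + 1`, which covers all required products if
`s ≥ 1`. For `s = 0` its only node is the zero of `T_1`, where `T_2 = -1`: the integral of `p_2` is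
negative instead of zero, which is why only an inequality is asked in degree two. -/
lemma chebExact_gaussMeasure (hab : a < b) (s : ℕ)
    (h : PolyIntegrable (gaussMeasure (chebMeasure a b) (s + 1))) : ChebExact a b s h := by
  have hT := polyIntegrable_chebMeasure hab
  have hdeg : ∀ i, (chebOrth a b i).degree ≤ i := fun i =>
    degree_le_of_natDegree_le (natDegree_chebOrth hab i).le
  have hexact : ∀ i j, i + j < 2 * (s + 1) →
      polyInt h (chebOrth a b i * chebOrth a b j) = if i = j then 1 else 0 := by
    intro i j hij
    rw [← polyInt_chebOrth_mul hab i j, polyInt_apply, polyInt_apply, integral_gaussMeasure hT]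
    refine integral_interpAt_gaussNodes hT ?_
    refine (degree_mul_le _ _).trans_lt ((add_le_add (hdeg i) (hdeg j)).trans_lt ?_)
    exact_mod_cast hij
  refine ⟨fun j hj i hi => hexact j i (by omega), fun x => ?_⟩
  by_cases hs : 2 ≤ s + 1
  · rw [polyInt_chebOrth_mul_jacksonPoly h s 2 x hs (fun i hi => hexact 2 i (by omega))]
  · have : s = 0 := by omega
    subst this
    rw [jackson_zero_two, zero_mul, jacksonPoly]
    simp only [zero_add, Finset.range_one, Finset.sum_singleton]
    rw [chebOrth_zero, eval_one, jackson_zero]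
    have hnodes : gaussNodes (chebMeasure a b) (0 + 1) = orthNodes (chebMeasure a b) 1 := by
      rw [gaussNodes, gaussCount_eq (orthNondeg_chebMeasure hab _)]
    have hsq : polyInt h (chebPoly a b 1 * chebPoly a b 1) = 0 := by
      rw [polyInt_apply, integral_gaussMeasure hT, gaussIntegral, integral_interpAt hT]
      refine Finset.sum_eq_zero fun y hy => ?_
      rw [hnodes] at hy
      have h0 := eval_monicOrth_of_mem_orthNodes hy
      rw [monicOrth_eq_of_orthonormal hT (natDegree_chebOrth hab) (leadingCoeff_chebOrth_pos hab)
        (polyInt_chebOrth_mul hab), chebOrth, if_neg one_ne_zero, eval_mul, eval_mul, eval_C,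
        eval_C, ← mul_assoc] at h0
      have h1 : (chebPoly a b 1).eval y = 0 := by
        refine (mul_eq_zero.1 h0).resolve_left (mul_ne_zero (inv_ne_zero ?_) (by positivity))
        have := leadingCoeff_chebOrth_pos hab 1
        rw [chebOrth, if_neg one_ne_zero] at this
        exact this.ne'
      rw [eval_mul, h1, zero_mul, zero_mul]
    have hone := hexact 0 0 (by omega)
    rw [chebOrth_zero, if_pos rfl, mul_one] at hone
    rw [mul_one, mul_one, C_1, mul_one, chebOrth, if_neg two_ne_zero, polyInt_C_mul, chebPoly_two,
      map_sub, polyInt_C_mul, hsq, hone]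
    have := Real.sqrt_nonneg 2
    linarith

lemma degree_lt_card_of_orthNondeg (h : PolyIntegrable μ) {s : ℕ} (hs : OrthNondeg μ (s + 1))
    {p : ℝ[X]} (hp : p.degree < (s + 1 : ℕ)) : opInterp μ s (fun y => p.eval y) = p :=
  interpAt_eval_eq_self (by rwa [hs.card_orthNodes h])

/-! ### Error bounds for quadrature approximations of a probability distribution -/

variable [IsProbabilityMeasure ν]

lemma wassersteinDist_quadInterp_le [IsFiniteMeasure μ] (hab : a ≤ b) (hμ : μ (Set.Icc a b)ᶜ = 0)
    (hν : ν (Set.Icc a b)ᶜ = 0) {s : ℕ} (hs : OrthNondeg μ (s + 1)) :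
    wassersteinDist (fun x => ν.real (Set.Iic x)) (quadInterp μ s ν) ≤
      ENNReal.ofReal (Real.pi * (b - a) / (2 * (s + 2))) * (1 + totalVar (quadInterp μ s ν)) := by
  have h := polyIntegrable_of_compl_Icc hμ
  have hop : opInterp μ s = interpAt (orthNodes μ (s + 1)) := rfl
  have hrep : ∀ p : ℝ[X], p.degree < (s + 1 : ℕ) → opInterp μ s (fun y => p.eval y) = p :=
    fun p hp => degree_lt_card_of_orthNondeg h hs hp
  rw [quadInterp]
  rw [hop, interpAt_eq_kernelOp] at hrep ⊢
  exact wassersteinDist_kernelOp_le_totalVar hab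
    (atomicMeasure_compl_Icc fun x hx => hs.orthNodes_subset h hμ hx) hν
    (fun x _ => measurable_const.indicator (measurableSet_singleton x))
    (fun x _ => integrable_atomicMeasure _) hrep

lemma wassersteinDist_quadApprox_le [IsFiniteMeasure μ] (hab : a ≤ b) (hμ : μ (Set.Icc a b)ᶜ = 0)
    (hν : ν (Set.Icc a b)ᶜ = 0) {s : ℕ} (hs : OrthNondeg μ (s + 1)) :
    wassersteinDist (fun x => ν.real (Set.Iic x)) (quadApprox μ s ν) ≤
      ENNReal.ofReal (Real.pi * (b - a) / (2 * (s + 2))) * (1 + totalVar (quadApprox μ s ν)) := by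
  have h := polyIntegrable_of_compl_Icc hμ
  have hrep : ∀ p : ℝ[X], p.degree < (s + 1 : ℕ) → opApprox μ s (fun y => p.eval y) = p := by
    intro p hp
    conv_rhs => rw [← hs.sum_orthPoly_eq h hp]
    simp only [opApprox, polyInt_apply, eval_mul]
  rw [quadApprox]
  rw [opApprox_eq_kernelOp] at hrep ⊢
  exact wassersteinDist_kernelOp_le_totalVar hab hμ hν
    (fun i _ => (orthPoly μ i).continuous.measurable)
    (fun i _ => h _) hrep

/-- Jackson's theorem in degree `2k - 1`. Both `ν` and the rule are probability measures on `[a,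
b]`, so each integral of the approximation error is at most `M`; here `2 M = π (b - a) / (2k + 1)`.
-/
lemma wassersteinDist_quadGauss_le (hab : a ≤ b) (hν : ν (Set.Icc a b)ᶜ = 0) {k : ℕ} (hk : 1 ≤ k) :
    wassersteinDist (fun x => ν.real (Set.Iic x)) (quadGauss k ν) ≤
      ENNReal.ofReal (Real.pi * (b - a) / (2 * k)) := by
  have h := polyIntegrable_of_compl_Icc hν
  have hG := gaussCount_orthNondeg ν k
  have hexact : ∀ p : ℝ[X], p.degree < (2 * k : ℕ) →
      ∫ y, (interpAt (gaussNodes ν k) (fun x => p.eval x)).eval y ∂ν = ∫ y, p.eval y ∂ν :=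
    fun p hp => integral_interpAt_gaussNodes h hp
  have hw : ∀ x ∈ gaussNodes ν k, 0 ≤ quadWeight ν (gaussNodes ν k) x :=
    fun x hx => hG.quadWeight_nonneg h hx
  have hone : ∫ y, (interpAt (gaussNodes ν k) fun _ => 1).eval y ∂ν = 1 := by
    have := hexact 1 (degree_one_le.trans_lt (by exact_mod_cast (by omega : 0 < 2 * k)))
    simpa using this
  have herr : ∀ f : ℝ → ℝ, LipschitzWith 1 f →
      ∫ y, f y ∂ν - ∫ y, (interpAt (gaussNodes ν k) f).eval y ∂ν ≤
        Real.pi * (b - a) / (2 * k) := by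
    intro f hf
    obtain ⟨p, hp, hpf⟩ := exists_poly_abs_sub_le hab (2 * k - 1) hf
    have hp' : p.degree < (2 * k : ℕ) := by
      rwa [show 2 * k - 1 + 1 = 2 * k by omega] at hp
    set M := Real.pi * (b - a) / (2 * (((2 * k - 1 : ℕ) : ℝ) + 2)) with hM
    have hfc := hf.continuous
    have hpc := p.continuous
    have hsum1 : ∑ x ∈ gaussNodes ν k, quadWeight ν (gaussNodes ν k) x = 1 := by
      rw [integral_interpAt h] at hone
      simpa using hone
    have h1 := hexact p hp'
    rw [integral_interpAt h] at h1
    have h2 : ∫ y, f y - p.eval y ∂ν ≤ M := by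
      have hae : ∀ᵐ y ∂ν, y ∈ Set.Icc a b := hν
      calc ∫ y, f y - p.eval y ∂ν ≤ ∫ _, M ∂ν := by
            refine integral_mono_ae (integrable_of_continuous_of_compl_Icc hν (by fun_prop))
              (integrable_const _) ?_
            filter_upwards [hae] with y hy using (le_abs_self _).trans (hpf y hy)
        _ = M := by simp
    rw [integral_sub (integrable_of_continuous_of_compl_Icc hν hfc) (h p), ← h1] at h2
    have h3 : ∑ x ∈ gaussNodes ν k, (p.eval x - f x) * quadWeight ν (gaussNodes ν k) x ≤ M := by
      calc _ ≤ ∑ x ∈ gaussNodes ν k, M * quadWeight ν (gaussNodes ν k) x := by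
            refine Finset.sum_le_sum fun x hx => mul_le_mul_of_nonneg_right ?_ (hw x hx)
            rw [← neg_sub]
            exact (neg_le_abs _).trans (hpf x (hG.orthNodes_subset h hν hx))
        _ = M := by rw [← Finset.mul_sum, hsum1, mul_one]
    simp_rw [sub_mul] at h3
    rw [Finset.sum_sub_distrib] at h3
    rw [integral_interpAt h]
    have hk' : (1 : ℝ) ≤ k := by exact_mod_cast hk
    have h4 : 2 * M ≤ Real.pi * (b - a) / (2 * k) := by
      have hc : ((2 * k - 1 : ℕ) : ℝ) = 2 * k - 1 := by
        rw [Nat.cast_sub (by omega)]; push_cast; ring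
      have hnum : 0 ≤ Real.pi * (b - a) := mul_nonneg Real.pi_pos.le (sub_nonneg.2 hab)
      rw [hM, hc]
      have : 2 * (Real.pi * (b - a) / (2 * (2 * (k : ℝ) - 1 + 2))) =
          Real.pi * (b - a) / (2 * k + 1) := by
        have : (2 : ℝ) * k - 1 + 2 = 2 * k + 1 := by ring
        rw [this]; field_simp
      rw [this]
      exact div_le_div_of_nonneg_left hnum (by positivity) (by linarith)
    linarith
  rw [quadGauss]
  rw [interpAt_eq_kernelOp] at hone herr ⊢
  exact wassersteinDist_kernelOp_le hab
    (atomicMeasure_compl_Icc fun x hx => hG.orthNodes_subset h hν hx) hν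
    (fun x _ => measurable_const.indicator (measurableSet_singleton x))
    (fun x _ => integrable_atomicMeasure _) hone herr

lemma integral_sub_le_of_abs_sub_le (hν : ν (Set.Icc a b)ᶜ = 0) {f : ℝ → ℝ} (hf : Continuous f)
    {p : ℝ[X]} {M : ℝ} (h : ∀ x ∈ Set.Icc a b, |f x - p.eval x| ≤ M) :
    ∫ y, f y ∂ν - ∫ y, p.eval y ∂ν ≤ M := by
  have hae : ∀ᵐ y ∂ν, y ∈ Set.Icc a b := hν
  have hpc := p.continuous
  rw [← integral_sub (integrable_of_continuous_of_compl_Icc hν hf)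
    (polyIntegrable_of_compl_Icc hν p)]
  calc ∫ y, f y - p.eval y ∂ν ≤ ∫ _, M ∂ν := by
        refine integral_mono_ae (integrable_of_continuous_of_compl_Icc hν (by fun_prop))
          (integrable_const _) ?_
        filter_upwards [hae] with y hy using (le_abs_self _).trans (h y hy)
    _ = M := by simp

/-- Damped operators do not reproduce polynomials, but they approximate every 1-Lipschitz function
uniformly, so the duality applies directly. Mass is preserved because `ρ_0 = 1`. -/
lemma ChebExact.wassersteinDist_jacksonOp_le (hab : a < b) {κ : Measure ℝ} [IsFiniteMeasure κ]
    (hκ : κ (Set.Icc a b)ᶜ = 0) {h : PolyIntegrable κ} {s : ℕ} (hex : ChebExact a b s h)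
    (hν : ν (Set.Icc a b)ᶜ = 0) :
    wassersteinDist (fun x => ν.real (Set.Iic x)) (inducedQuad (jacksonOp a b s κ) ν) ≤
      ENNReal.ofReal (Real.pi * (b - a) / (2 * (s + 2))) := by
  refine wassersteinDist_kernelOp_le hab.le hκ hν
    (fun i _ => ((chebOrth a b i).continuous.measurable).const_mul _)
    (fun i _ => (h _).const_mul _) ?_ fun f hf =>
    integral_sub_le_of_abs_sub_le hν hf.continuous fun x hx => hex.abs_sub_jacksonOp_le hab hκ hf hx
  have := hex.jacksonOp_one hκ
  rw [jacksonOp] at this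
  rw [this]
  simp

lemma wassersteinDist_quadDampedApprox_le (hab : a < b) (hν : ν (Set.Icc a b)ᶜ = 0) (s : ℕ) :
    wassersteinDist (fun x => ν.real (Set.Iic x)) (quadDampedApprox a b s ν) ≤
      ENNReal.ofReal (Real.pi * (b - a) / (2 * (s + 2))) := by
  have := isProbabilityMeasure_chebMeasure hab
  rw [quadDampedApprox, opDampedApprox_eq_jacksonOp hab]
  exact (chebExact_chebMeasure hab s).wassersteinDist_jacksonOp_le hab
    (chebMeasure_compl_Icc a b) hν

lemma wassersteinDist_quadDampedInterp_le (hab : a < b) (hν : ν (Set.Icc a b)ᶜ = 0) (s : ℕ) :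
    wassersteinDist (fun x => ν.real (Set.Iic x)) (quadDampedInterp a b s ν) ≤
      ENNReal.ofReal (Real.pi * (b - a) / (2 * (s + 2))) := by
  have := isProbabilityMeasure_chebMeasure hab
  have hκ := gaussMeasure_compl_Icc (chebMeasure_compl_Icc a b) (s + 1)
  rw [quadDampedInterp, opDampedInterp_eq_jacksonOp hab]
  exact (chebExact_gaussMeasure hab s (polyIntegrable_of_compl_Icc hκ)).wassersteinDist_jacksonOp_le
    hab hκ hν

end Operators

end RandQuad

namespace RandQuad

/-! ### Moments of quadratic forms on the sphere -/

section Sphere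

variable {n : ℕ}

/-- The squared norm of the projection to the span of some vectors of an orthonormal basis. -/
noncomputable def projSq (w : OrthonormalBasis (Fin n) ℝ (EuclideanSpace ℝ (Fin n)))
    (S : Finset (Fin n)) (v : EuclideanSpace ℝ (Fin n)) : ℝ :=
  ∑ j ∈ S, (inner ℝ (w j) v) ^ 2

variable (w : OrthonormalBasis (Fin n) ℝ (EuclideanSpace ℝ (Fin n))) (S : Finset (Fin n))

lemma continuous_projSq : Continuous (projSq w S) := by
  unfold projSq
  fun_prop

lemma projSq_univ (v : EuclideanSpace ℝ (Fin n)) : projSq w Finset.univ v = ‖v‖ ^ 2 := by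
  rw [projSq, ← w.sum_sq_norm_inner_right v]
  simp

lemma projSq_nonneg (v : EuclideanSpace ℝ (Fin n)) : 0 ≤ projSq w S v :=
  Finset.sum_nonneg fun _ _ => sq_nonneg _

lemma projSq_add_compl (v : EuclideanSpace ℝ (Fin n)) :
    projSq w S v + projSq w Sᶜ v = ‖v‖ ^ 2 := by
  rw [← projSq_univ w, projSq, projSq, projSq, Finset.sum_add_sum_compl]

lemma integrable_prod_inner {g : Fin n → ℝ → ℝ} (hg : ∀ j, Integrable (g j)) :
    Integrable fun x : EuclideanSpace ℝ (Fin n) => ∏ j, g j (inner ℝ (w j) x) := by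
  have h1 : Integrable fun y : Fin n → ℝ => ∏ j, g j (y j) := Integrable.fintype_prod hg
  have h2 := (PiLp.volume_preserving_ofLp (Fin n)).integrable_comp_of_integrable h1
  have h3 := w.measurePreserving_repr.integrable_comp_of_integrable h2
  refine h3.congr (Filter.Eventually.of_forall fun x => ?_)
  simp [w.repr_apply_apply]

lemma integral_prod_inner (g : Fin n → ℝ → ℝ) :
    ∫ x : EuclideanSpace ℝ (Fin n), ∏ j, g j (inner ℝ (w j) x) = ∏ j, ∫ y, g j y := by
  have h : ∀ x : EuclideanSpace ℝ (Fin n), ∏ j, g j (inner ℝ (w j) x) =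
      (fun y : EuclideanSpace ℝ (Fin n) => (fun z : Fin n → ℝ => ∏ j, g j (z j)) y.ofLp)
        (w.repr x) := by
    intro x
    simp [w.repr_apply_apply]
  rw [integral_congr_ae (Filter.Eventually.of_forall h),
    w.measurePreserving_repr.integral_comp w.repr.toHomeomorph.measurableEmbedding
      (fun y : EuclideanSpace ℝ (Fin n) => (fun z : Fin n → ℝ => ∏ j, g j (z j)) y.ofLp),
    (PiLp.volume_preserving_ofLp (Fin n)).integral_comp
      (MeasurableEquiv.toLp 2 (Fin n → ℝ)).symm.measurableEmbedding
      (fun z : Fin n → ℝ => ∏ j, g j (z j)), integral_fintype_prod_volume_eq_prod]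

/-- The Gaussian measure with density `exp (-‖x‖²)`. -/
noncomputable def expNormSq (n : ℕ) : Measure (EuclideanSpace ℝ (Fin n)) :=
  volume.withDensity fun x => ENNReal.ofReal (Real.exp (-‖x‖ ^ 2))

lemma integral_expNormSq (f : EuclideanSpace ℝ (Fin n) → ℝ) :
    ∫ x, f x ∂expNormSq n = ∫ x, Real.exp (-‖x‖ ^ 2) * f x := by
  rw [expNormSq, integral_withDensity_eq_integral_toReal_smul (by fun_prop)
    (Filter.Eventually.of_forall fun x => ENNReal.ofReal_lt_top)]
  simp_rw [ENNReal.toReal_ofReal (Real.exp_pos _).le, smul_eq_mul]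

lemma exp_projSq_eq_prod (t : ℝ) (x : EuclideanSpace ℝ (Fin n)) :
    Real.exp (-‖x‖ ^ 2) * Real.exp (t * projSq w S x) =
      ∏ j, (fun y => Real.exp (-(if j ∈ S then 1 - t else 1) * y ^ 2)) (inner ℝ (w j) x) := by
  rw [← Real.exp_add, ← Real.exp_sum, ← projSq_univ w, projSq, projSq]
  congr 1
  rw [Finset.mul_sum, ← Finset.sum_neg_distrib,
    ← Finset.sum_filter_add_sum_filter_not Finset.univ (· ∈ S) (fun j =>
      -(if j ∈ S then 1 - t else 1) * (inner ℝ (w j) x) ^ 2),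
    ← Finset.sum_filter_add_sum_filter_not Finset.univ (· ∈ S) (fun j =>
      -(inner ℝ (w j) x) ^ 2), Finset.filter_univ_mem,
    Finset.sum_congr rfl (g := fun j => -(inner ℝ (w j) x) ^ 2 + t * (inner ℝ (w j) x) ^ 2)
      (s₁ := S) (f := fun j => -(if j ∈ S then 1 - t else 1) * (inner ℝ (w j) x) ^ 2),
    Finset.sum_add_distrib,
    Finset.sum_congr rfl (g := fun j => -(inner ℝ (w j) x) ^ 2)
      (s₁ := Finset.univ.filter (· ∉ S))
      (f := fun j => -(if j ∈ S then 1 - t else 1) * (inner ℝ (w j) x) ^ 2)]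
  · ring
  · intro j hj
    rw [if_neg (Finset.mem_filter.1 hj).2]; ring
  · intro j hj
    rw [if_pos hj]; ring

lemma integrable_exp_projSq {t : ℝ} (ht : t < 1) :
    Integrable (fun x => Real.exp (t * projSq w S x)) (expNormSq n) := by
  rw [expNormSq, integrable_withDensity_iff_integrable_smul' (by fun_prop)
    (Filter.Eventually.of_forall fun x => ENNReal.ofReal_lt_top)]
  simp_rw [ENNReal.toReal_ofReal (Real.exp_pos _).le, smul_eq_mul, exp_projSq_eq_prod]
  refine integrable_prod_inner w fun j => integrable_exp_neg_mul_sq ?_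
  split_ifs <;> linarith

/-- In the coordinates of `w` the weight factors into one-dimensional Gaussians, those in `S` with
exponent rescaled by `1 - t`. Derivatives at 0 give the moments. -/
lemma mgf_projSq {t : ℝ} (ht : t < 1) :
    mgf (projSq w S) (expNormSq n) t = Real.sqrt Real.pi ^ n * (1 - t) ^ (-(S.card / 2 : ℝ)) := by
  have h1 : (0 : ℝ) ≤ 1 - t := by linarith
  rw [mgf, integral_expNormSq]
  simp_rw [exp_projSq_eq_prod]
  rw [integral_prod_inner w
    fun (j : Fin n) (y : ℝ) => Real.exp (-(if j ∈ S then 1 - t else 1) * y ^ 2)]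
  simp_rw [integral_gaussian]
  have h2 : ∀ j : Fin n, Real.sqrt (Real.pi / if j ∈ S then 1 - t else 1) =
      Real.sqrt Real.pi * if j ∈ S then (1 - t) ^ (-(1 / 2 : ℝ)) else 1 := by
    intro j
    split_ifs
    · rw [Real.sqrt_div Real.pi_pos.le, Real.rpow_neg h1, Real.sqrt_eq_rpow (1 - t), div_eq_mul_inv]
    · simp
  simp_rw [h2]
  rw [Finset.prod_mul_distrib, Finset.prod_const, Finset.card_univ, Fintype.card_fin,
    Finset.prod_ite_mem, Finset.univ_inter, Finset.prod_const, ← Real.rpow_mul_natCast h1]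
  congr 2
  ring

lemma zero_mem_interior_integrableExpSet (X : EuclideanSpace ℝ (Fin n) → ℝ)
    {μ : Measure (EuclideanSpace ℝ (Fin n))}
    (h : ∀ t < 1, Integrable (fun x => Real.exp (t * X x)) μ) {t : ℝ} (ht : t < 1) :
    t ∈ interior (integrableExpSet X μ) :=
  mem_interior.2 ⟨Set.Iio 1, fun t ht => h t ht, isOpen_Iio, ht⟩

lemma iteratedDeriv_mgf_projSq (k : ℕ) {t : ℝ} (ht : t < 1) :
    iteratedDeriv k (mgf (projSq w S) (expNormSq n)) t =
      Real.sqrt Real.pi ^ n * (∏ i ∈ Finset.range k, (S.card / 2 + i : ℝ)) *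
        (1 - t) ^ (-(S.card / 2 + k : ℝ)) := by
  induction k generalizing t with
  | zero => simp [mgf_projSq w S ht]
  | succ k ih =>
    rw [iteratedDeriv_succ]
    have hev : iteratedDeriv k (mgf (projSq w S) (expNormSq n)) =ᶠ[nhds t] fun t =>
        Real.sqrt Real.pi ^ n * (∏ i ∈ Finset.range k, (S.card / 2 + i : ℝ)) *
          (1 - t) ^ (-(S.card / 2 + k : ℝ)) := by
      filter_upwards [isOpen_Iio.mem_nhds ht] with u hu using ih hu
    rw [hev.deriv_eq]
    have h1 : HasDerivAt (fun t : ℝ => 1 - t) (-1) t := by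
      simpa using (hasDerivAt_id t).const_sub 1
    have h2 := (h1.rpow_const (p := -(S.card / 2 + k : ℝ)) (Or.inl (by linarith))).const_mul
      (Real.sqrt Real.pi ^ n * (∏ i ∈ Finset.range k, (S.card / 2 + i : ℝ)))
    rw [h2.deriv, Finset.prod_range_succ]
    have h3 : -((S.card : ℝ) / 2 + k) - 1 = -((S.card : ℝ) / 2 + (k + 1 : ℕ)) := by
      push_cast; ring
    rw [h3]
    ring

lemma integral_projSq_pow_expNormSq (k : ℕ) :
    ∫ x, projSq w S x ^ k ∂expNormSq n =
      Real.sqrt Real.pi ^ n * ∏ i ∈ Finset.range k, (S.card / 2 + i : ℝ) := by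
  have h := iteratedDeriv_mgf_zero (X := projSq w S) (μ := expNormSq n)
    (zero_mem_interior_integrableExpSet _ (fun t ht => integrable_exp_projSq w S ht) one_pos) k
  rw [iteratedDeriv_mgf_projSq w S k one_pos] at h
  simpa using h.symm

/-- Polar coordinates. -/
lemma integral_projSq_pow_expNormSq_eq_mul [Nontrivial (EuclideanSpace ℝ (Fin n))] (k : ℕ) :
    ∫ x, projSq w S x ^ k ∂expNormSq n =
      (∫ u : Metric.sphere (0 : EuclideanSpace ℝ (Fin n)) 1, projSq w S u ^ k ∂volume.toSphere) *
      ∫ r : Set.Ioi (0 : ℝ), (r : ℝ) ^ (2 * k) * Real.exp (-(r : ℝ) ^ 2)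
        ∂Measure.volumeIoiPow (Module.finrank ℝ (EuclideanSpace ℝ (Fin n)) - 1) := by
  rw [integral_expNormSq, ← integral_prod_mul (f := fun u : Metric.sphere
    (0 : EuclideanSpace ℝ (Fin n)) 1 => projSq w S u ^ k) (g := fun r : Set.Ioi (0 : ℝ) =>
    (r : ℝ) ^ (2 * k) * Real.exp (-(r : ℝ) ^ 2)),
    ← (volume : Measure (EuclideanSpace ℝ (Fin n))).measurePreserving_homeomorphUnitSphereProd
      |>.integral_comp (Homeomorph.measurableEmbedding _)]
  have h : ∫ x, Real.exp (-‖x‖ ^ 2) * projSq w S x ^ k =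
      ∫ x : ({(0 : EuclideanSpace ℝ (Fin n))}ᶜ : Set (EuclideanSpace ℝ (Fin n))),
        Real.exp (-‖x.1‖ ^ 2) * projSq w S x.1 ^ k ∂((volume : Measure
          (EuclideanSpace ℝ (Fin n))).comap (↑)) := by
    rw [integral_subtype_comap (measurableSet_singleton _).compl
      fun x : EuclideanSpace ℝ (Fin n) => Real.exp (-‖x‖ ^ 2) * projSq w S x ^ k,
      restrict_compl_singleton]
  rw [h]
  congr 1
  funext x
  have hx : ‖(x : EuclideanSpace ℝ (Fin n))‖ ≠ 0 := norm_ne_zero_iff.2 x.2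
  -- Homogeneity of degree two separates direction from radius.
  have hproj : projSq w S (‖(x : EuclideanSpace ℝ (Fin n))‖⁻¹ • (x : EuclideanSpace ℝ (Fin n))) =
      (‖(x : EuclideanSpace ℝ (Fin n))‖⁻¹) ^ 2 * projSq w S x := by
    simp_rw [projSq, inner_smul_right, mul_pow, Finset.mul_sum]
  simp only [homeomorphUnitSphereProd_apply_fst_coe, homeomorphUnitSphereProd_apply_snd_coe]
  rw [hproj, mul_pow, ← pow_mul, inv_pow]
  field_simp

lemma integral_unifSphere (f : EuclideanSpace ℝ (Fin n) → ℝ) (hf : Continuous f) :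
    ∫ v, f v ∂unifSphere n =
      ((volume : Measure (EuclideanSpace ℝ (Fin n))).toSphere.real Set.univ)⁻¹ *
      ∫ u : Metric.sphere (0 : EuclideanSpace ℝ (Fin n)) 1, f u ∂volume.toSphere := by
  rw [unifSphere, integral_map measurable_subtype_coe.aemeasurable hf.aestronglyMeasurable,
    ProbabilityTheory.cond, Measure.restrict_univ, integral_smul_measure, smul_eq_mul,
    ENNReal.toReal_inv]
  rfl

lemma toSphere_univ_ne_zero [Nontrivial (EuclideanSpace ℝ (Fin n))] :
    (volume : Measure (EuclideanSpace ℝ (Fin n))).toSphere Set.univ ≠ 0 := by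
  rw [Measure.measure_univ_ne_zero]
  exact Measure.toSphere_ne_zero _

lemma isProbabilityMeasure_unifSphere [Nontrivial (EuclideanSpace ℝ (Fin n))] :
    IsProbabilityMeasure (unifSphere n) := by
  rw [unifSphere]
  have : IsProbabilityMeasure (ProbabilityTheory.cond
      (volume : Measure (EuclideanSpace ℝ (Fin n))).toSphere Set.univ) :=
    cond_isProbabilityMeasure toSphere_univ_ne_zero
  exact Measure.isProbabilityMeasure_map measurable_subtype_coe.aemeasurable

lemma ae_norm_eq_one_unifSphere : ∀ᵐ v ∂unifSphere n, ‖v‖ = 1 := by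
  rw [unifSphere, ae_map_iff measurable_subtype_coe.aemeasurable
    (measurableSet_eq_fun measurable_norm measurable_const)]
  refine Filter.Eventually.of_forall fun u => ?_
  simp

/-- The moments of the squared norm of a projection of a uniformly distributed unit vector satisfy
the recurrence of the moments of a Beta distribution. -/
lemma integral_projSq_pow_unifSphere [Nontrivial (EuclideanSpace ℝ (Fin n))] (k : ℕ) :
    (n / 2 + k : ℝ) * ∫ v, projSq w S v ^ (k + 1) ∂unifSphere n =
      (S.card / 2 + k : ℝ) * ∫ v, projSq w S v ^ k ∂unifSphere n := by
  set σ := (volume : Measure (EuclideanSpace ℝ (Fin n))).toSphere with hσ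
  set R : ℕ → ℝ := fun k => ∫ r : Set.Ioi (0 : ℝ), (r : ℝ) ^ (2 * k) * Real.exp (-(r : ℝ) ^ 2)
        ∂Measure.volumeIoiPow (Module.finrank ℝ (EuclideanSpace ℝ (Fin n)) - 1) with hR
  have hσ0 : σ.real Set.univ ≠ 0 := by
    rw [Measure.real, ENNReal.toReal_ne_zero]
    exact ⟨toSphere_univ_ne_zero, measure_ne_top _ _⟩
  have hn : 0 < n := by
    rcases Nat.eq_zero_or_pos n with rfl | h
    · exact absurd ‹Nontrivial _› (not_nontrivial _)
    · exact h
  have hπ : Real.sqrt Real.pi ^ n ≠ 0 := pow_ne_zero _ (Real.sqrt_pos.2 Real.pi_pos).ne'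
  have hpol : ∀ (T : Finset (Fin n)) (k : ℕ),
      Real.sqrt Real.pi ^ n * ∏ i ∈ Finset.range k, (T.card / 2 + i : ℝ) =
        σ.real Set.univ * (∫ v, projSq w T v ^ k ∂unifSphere n) * R k := by
    intro T k
    rw [← integral_projSq_pow_expNormSq w T k, integral_projSq_pow_expNormSq_eq_mul w T k,
      integral_unifSphere (fun v => projSq w T v ^ k) ((continuous_projSq w T).pow k),
      mul_inv_cancel_left₀ hσ0]
  have huniv : ∀ k, ∫ v, projSq w Finset.univ v ^ k ∂unifSphere n = 1 := by
    intro k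
    have := isProbabilityMeasure_unifSphere (n := n)
    have h : ∀ᵐ v ∂unifSphere n, projSq w Finset.univ v ^ k = 1 := by
      filter_upwards [ae_norm_eq_one_unifSphere] with v hv
      rw [projSq_univ, hv]; simp
    rw [integral_congr_ae h]
    simp
  -- For the full index set the form is 1 on the sphere, so the same identity evaluates the radial
  -- factor. Dividing by it leaves quotients of rising factorials, hence the recurrence.
  have hRk : ∀ k, Real.sqrt Real.pi ^ n * ∏ i ∈ Finset.range k, (n / 2 + i : ℝ) =
      σ.real Set.univ * R k := by
    intro k
    have := hpol Finset.univ k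
    rw [huniv, Finset.card_univ, Fintype.card_fin, mul_one] at this
    exact this
  have hprod : ∀ k, ∏ i ∈ Finset.range k, (n / 2 + i : ℝ) ≠ 0 := by
    intro k
    refine Finset.prod_ne_zero_iff.2 fun i _ => ?_
    have : (0 : ℝ) < n := by exact_mod_cast hn
    positivity
  have h1 := hpol S k
  have h2 := hpol S (k + 1)
  have h3 := hRk k
  have h4 := hRk (k + 1)
  rw [Finset.prod_range_succ] at h2 h4
  have hR0 : σ.real Set.univ * R k ≠ 0 := by
    rw [← h3]; exact mul_ne_zero hπ (hprod k)
  refine mul_left_cancel₀ hR0 ?_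
  calc σ.real Set.univ * R k * ((n / 2 + k : ℝ) * ∫ v, projSq w S v ^ (k + 1) ∂unifSphere n)
      = (σ.real Set.univ * R (k + 1)) * ∫ v, projSq w S v ^ (k + 1) ∂unifSphere n := by
        rw [← h3, ← h4]; ring
    _ = Real.sqrt Real.pi ^ n * ((∏ i ∈ Finset.range k, (S.card / 2 + i : ℝ)) *
          (S.card / 2 + k : ℝ)) := by
        rw [h2]; ring
    _ = (S.card / 2 + k : ℝ) * (Real.sqrt Real.pi ^ n *
          ∏ i ∈ Finset.range k, (S.card / 2 + i : ℝ)) := by ring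
    _ = _ := by rw [h1]; ring

end Sphere

end RandQuad

namespace RandQuad

/-! ### Sub-Gaussian bound from a moment recurrence -/

section BetaMoments

variable {Ω : Type*} [MeasurableSpace Ω] {μ : Measure Ω} [IsProbabilityMeasure μ] {X : Ω → ℝ}

lemma integrable_pow_mul_exp_of_mem_Icc (hX : Measurable X) (h01 : ∀ᵐ ω ∂μ, X ω ∈ Set.Icc 0 1)
    (j : ℕ) (t : ℝ) : Integrable (fun ω => X ω ^ j * Real.exp (t * X ω)) μ := by
  refine Integrable.mono' (integrable_const (Real.exp |t|)) (by fun_prop) ?_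
  filter_upwards [h01] with ω hω
  rw [norm_mul, Real.norm_eq_abs, Real.norm_eq_abs, Real.abs_exp, abs_pow, abs_of_nonneg hω.1]
  refine (mul_le_of_le_one_left (Real.exp_pos _).le (pow_le_one₀ hω.1 hω.2)).trans ?_
  refine Real.exp_le_exp.2 ((le_abs_self _).trans ?_)
  rw [abs_mul, abs_of_nonneg hω.1]
  exact mul_le_of_le_one_right (abs_nonneg _) hω.2

lemma integrable_pow_of_mem_Icc (hX : Measurable X) (h01 : ∀ᵐ ω ∂μ, X ω ∈ Set.Icc 0 1) (j : ℕ) :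
    Integrable (fun ω => X ω ^ j) μ := by
  simpa using integrable_pow_mul_exp_of_mem_Icc hX h01 j 0

lemma hasSum_integral_pow_mul_exp (hX : Measurable X) (h01 : ∀ᵐ ω ∂μ, X ω ∈ Set.Icc 0 1)
    (j : ℕ) (t : ℝ) :
    HasSum (fun k : ℕ => t ^ k / k.factorial * ∫ ω, X ω ^ (k + j) ∂μ)
      (∫ ω, X ω ^ j * Real.exp (t * X ω) ∂μ) := by
  have hint : ∀ k : ℕ, Integrable (fun ω => t ^ k / k.factorial * X ω ^ (k + j)) μ :=
    fun k => (integrable_pow_of_mem_Icc hX h01 (k + j)).const_mul _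
  have hsum : Summable fun k : ℕ => ∫ ω, ‖t ^ k / k.factorial * X ω ^ (k + j)‖ ∂μ := by
    refine Summable.of_nonneg_of_le (fun k => integral_nonneg fun _ => norm_nonneg _) (fun k => ?_)
      (Real.summable_pow_div_factorial |t|)
    calc ∫ ω, ‖t ^ k / k.factorial * X ω ^ (k + j)‖ ∂μ ≤ ∫ _, |t| ^ k / k.factorial ∂μ := by
          refine integral_mono_ae (hint k).norm (integrable_const _) ?_
          filter_upwards [h01] with ω hω
          simp only [norm_mul, norm_div, norm_pow, Real.norm_eq_abs, Nat.abs_cast,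
            abs_of_nonneg hω.1]
          exact mul_le_of_le_one_right (by positivity) (pow_le_one₀ hω.1 hω.2)
      _ = |t| ^ k / k.factorial := by simp
  have h := hasSum_integral_of_summable_integral_norm hint hsum
  have h1 : ∀ ω, ∑' k : ℕ, t ^ k / k.factorial * X ω ^ (k + j) = X ω ^ j * Real.exp (t * X ω) := by
    intro ω
    have h2 : HasSum (fun k : ℕ => (t * X ω) ^ k / k.factorial) (Real.exp (t * X ω)) := by
      rw [Real.exp_eq_exp_ℝ]
      exact NormedSpace.expSeries_div_hasSum_exp _
    rw [← (h2.mul_left (X ω ^ j)).tsum_eq]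
    refine tsum_congr fun k => ?_
    rw [mul_pow, pow_add]
    ring
  simp_rw [h1] at h
  simpa only [integral_const_mul] using h

variable {α γ : ℝ}

/-- Kummer's differential equation for the moment generating function. -/
lemma kummer_of_moments (hX : Measurable X) (h01 : ∀ᵐ ω ∂μ, X ω ∈ Set.Icc 0 1)
    (hrec : ∀ k : ℕ, (γ + k) * ∫ ω, X ω ^ (k + 1) ∂μ = (α + k) * ∫ ω, X ω ^ k ∂μ) (t : ℝ) :
    γ * (∫ ω, X ω ^ 1 * Real.exp (t * X ω) ∂μ) - α * (∫ ω, X ω ^ 0 * Real.exp (t * X ω) ∂μ) =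
      t * ((∫ ω, X ω ^ 1 * Real.exp (t * X ω) ∂μ) - ∫ ω, X ω ^ 2 * Real.exp (t * X ω) ∂μ) := by
  have h0 := hasSum_integral_pow_mul_exp hX h01 0 t
  have h1 := hasSum_integral_pow_mul_exp hX h01 1 t
  have h2 := hasSum_integral_pow_mul_exp hX h01 2 t
  set m : ℕ → ℝ := fun k => ∫ ω, X ω ^ k ∂μ with hm
  -- The recurrence reads `γ m_{k+1} - α m_k = k (m_k - m_{k+1})`, so the left side sums `f`. The
  -- right side sums `f (k + 1)`, and `f 0 = 0`.
  set f : ℕ → ℝ := fun k => t ^ k / k.factorial * k * (m k - m (k + 1)) with hf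
  have hA := (h1.mul_left γ).sub (h0.mul_left α)
  have hB := (h1.sub h2).mul_left t
  have hA' : HasSum f (γ * (∫ ω, X ω ^ 1 * Real.exp (t * X ω) ∂μ) -
      α * (∫ ω, X ω ^ 0 * Real.exp (t * X ω) ∂μ)) := by
    have e : f = fun k : ℕ => γ * (t ^ k / k.factorial * m (k + 1)) -
        α * (t ^ k / k.factorial * m (k + 0)) := by
      funext k
      have := hrec k
      change (γ + k) * m (k + 1) = (α + k) * m k at this
      simp only [hf, add_zero]
      linear_combination (-(t ^ k / k.factorial)) * this
    rw [e]
    exact hA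
  have hB' : HasSum (fun k => f (k + 1)) (t * ((∫ ω, X ω ^ 1 * Real.exp (t * X ω) ∂μ) -
      ∫ ω, X ω ^ 2 * Real.exp (t * X ω) ∂μ)) := by
    have e : (fun k => f (k + 1)) = fun k : ℕ =>
        t * (t ^ k / k.factorial * m (k + 1) - t ^ k / k.factorial * m (k + 2)) := by
      funext k
      simp only [hf]
      rw [Nat.factorial_succ]
      push_cast
      have : (k.factorial : ℝ) ≠ 0 := by exact_mod_cast k.factorial_ne_zero
      field_simp
      ring_nf
    rw [e]
    exact hB
  rw [hasSum_nat_add_iff 1] at hB'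
  have := hA'.unique hB'
  simpa [hf] using this

/-- A random variable in `[0, 1]` with the moments of a Beta distribution has the optimal
sub-Gaussian bound. -/
lemma mgf_le_of_moments (hX : Measurable X) (h01 : ∀ᵐ ω ∂μ, X ω ∈ Set.Icc 0 1) (hγ : 0 < γ)
    (hrec : ∀ k : ℕ, (γ + k) * ∫ ω, X ω ^ (k + 1) ∂μ = (α + k) * ∫ ω, X ω ^ k ∂μ) {t : ℝ}
    (ht : 0 ≤ t) :
    ∫ ω, Real.exp (t * X ω) ∂μ ≤ Real.exp (α / γ * t + t ^ 2 / (8 * (γ + 1))) := by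
  set e : ℕ → ℝ → ℝ := fun j t => ∫ ω, X ω ^ j * Real.exp (t * X ω) ∂μ with he
  have hset : ∀ t, t ∈ interior (integrableExpSet X μ) := by
    have : integrableExpSet X μ = Set.univ := by
      ext t
      simpa [integrableExpSet] using integrable_pow_mul_exp_of_mem_Icc hX h01 0 t
    intro t
    rw [this, interior_univ]
    exact Set.mem_univ t
  have hder : ∀ j t, HasDerivAt (e j) (e (j + 1) t) t := fun j t =>
    hasDerivAt_integral_pow_mul_exp_real (hset t) j
  have hpos : ∀ t, 0 < e 0 t := by
    intro t
    simp only [he, pow_zero, one_mul]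
    exact integral_exp_pos (by simpa using integrable_pow_mul_exp_of_mem_Icc hX h01 0 t)
  have hode : ∀ t, γ * e 1 t - α * e 0 t = t * (e 1 t - e 2 t) :=
    fun t => kummer_of_moments hX h01 hrec t
  -- The derivative of the logarithm of the moment generating function minus the derivative of the
  -- claimed exponent; `d ≤ 0` on `t ≥ 0` suffices.
  set d : ℝ → ℝ := fun t => e 1 t / e 0 t - α / γ - t / (4 * (γ + 1)) with hd
  have hdder : ∀ t, HasDerivAt d
      ((e 2 t * e 0 t - e 1 t * e 1 t) / e 0 t ^ 2 - 1 / (4 * (γ + 1))) t := by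
    intro t
    have h1 := ((hder 1 t).div (hder 0 t) (hpos t).ne').sub_const (α / γ)
    exact h1.sub ((hasDerivAt_id t).div_const _)
  have hg1 : 0 < γ + 1 := by linarith
  have hineq : ∀ t, 0 ≤ t → γ * d t +
      t * ((e 2 t * e 0 t - e 1 t * e 1 t) / e 0 t ^ 2 - 1 / (4 * (γ + 1))) ≤ 0 := by
    intro t ht
    have h0 := (hpos t).ne'
    -- Kummer's equation eliminates `e 2`; the constant `1 / (4 (γ + 1))` is the one that completes
    -- the square.
    have h1 : γ * d t + t * ((e 2 t * e 0 t - e 1 t * e 1 t) / e 0 t ^ 2 - 1 / (4 * (γ + 1))) =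
        -(t * (e 1 t / e 0 t - 1 / 2) ^ 2) := by
      simp only [hd]
      have h2 := hode t
      generalize e 0 t = x at *
      generalize e 1 t = y at *
      generalize e 2 t = z at *
      field_simp
      linear_combination (16 * x * (γ + 1)) * h2
    rw [h1]
    exact neg_nonpos.2 (mul_nonneg ht (sq_nonneg _))
  have hdc : Continuous d := continuous_iff_continuousAt.2 fun t => (hdder t).continuousAt
  have hdle : ∀ t, 0 ≤ t → d t ≤ 0 := by
    intro t ht
    rcases ht.eq_or_lt with rfl | ht
    · have := hineq 0 le_rfl
      rw [zero_mul, add_zero] at this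
      exact nonpos_of_mul_nonpos_right this hγ
    -- The integrating factor `t ^ γ` turns `γ d + t d' ≤ 0` into monotonicity, starting from the
    -- value 0 at the origin.
    · have hanti : AntitoneOn (fun t : ℝ => t ^ γ * d t) (Set.Ici 0) := by
        have hp : ∀ t ∈ interior (Set.Ici (0 : ℝ)), HasDerivAt (fun t : ℝ => t ^ γ * d t)
            (γ * t ^ (γ - 1) * d t + t ^ γ *
              ((e 2 t * e 0 t - e 1 t * e 1 t) / e 0 t ^ 2 - 1 / (4 * (γ + 1)))) t := by
          intro t ht
          rw [interior_Ici, Set.mem_Ioi] at ht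
          exact (Real.hasDerivAt_rpow_const (Or.inl ht.ne')).mul (hdder t)
        refine antitoneOn_of_deriv_nonpos (convex_Ici 0)
          ((Real.continuous_rpow_const hγ.le).mul hdc).continuousOn
          (fun t ht => (hp t ht).differentiableAt.differentiableWithinAt) fun t ht => ?_
        rw [(hp t ht).deriv]
        rw [interior_Ici, Set.mem_Ioi] at ht
        have h3 : t ^ γ = t ^ (γ - 1) * t := by
          rw [← Real.rpow_add_one ht.ne', sub_add_cancel]
        rw [h3]
        have h4 := mul_nonpos_of_nonneg_of_nonpos (Real.rpow_nonneg ht.le (γ - 1)) (hineq t ht.le)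
        linarith
      have h5 := hanti (Set.mem_Ici.2 le_rfl) (Set.mem_Ici.2 ht.le) ht.le
      simp only [Real.zero_rpow hγ.ne', zero_mul] at h5
      exact nonpos_of_mul_nonpos_right h5 (Real.rpow_pos_of_pos ht γ)
  set H : ℝ → ℝ := fun t => Real.log (e 0 t) - α / γ * t - t ^ 2 / (8 * (γ + 1)) with hH
  have hHder : ∀ t, HasDerivAt H (d t) t := by
    intro t
    have h1 := (((hder 0 t).log (hpos t).ne').sub ((hasDerivAt_id t).const_mul (α / γ))).sub
      ((hasDerivAt_pow 2 t).div_const (8 * (γ + 1)))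
    refine HasDerivAt.congr_deriv h1 ?_
    simp only [hd]
    field_simp
    push_cast
    ring
  have hHanti : AntitoneOn H (Set.Ici 0) := by
    refine antitoneOn_of_deriv_nonpos (convex_Ici 0)
      (continuous_iff_continuousAt.2 fun t => (hHder t).continuousAt).continuousOn
      (fun t _ => (hHder t).differentiableAt.differentiableWithinAt) fun t ht => ?_
    rw [(hHder t).deriv]
    rw [interior_Ici, Set.mem_Ioi] at ht
    exact hdle t ht.le
  have h6 := hHanti (Set.mem_Ici.2 le_rfl) (Set.mem_Ici.2 ht) ht
  have h7 : H 0 = 0 := by simp [hH, he]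
  rw [h7] at h6
  have h8 : ∫ ω, Real.exp (t * X ω) ∂μ = e 0 t := by simp [he]
  rw [h8, ← Real.log_le_iff_le_exp (hpos t)]
  simp only [hH] at h6
  linarith

end BetaMoments

/-! ### Quadratic forms on the sphere are sub-Gaussian -/

section SphereSubgaussian

variable {n : ℕ} (w : OrthonormalBasis (Fin n) ℝ (EuclideanSpace ℝ (Fin n)))

lemma nontrivial_euclideanSpace (hn : 0 < n) : Nontrivial (EuclideanSpace ℝ (Fin n)) := by
  have : Nonempty (Fin n) := ⟨⟨0, hn⟩⟩
  infer_instance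

lemma projSq_mem_Icc_of_norm_eq_one (S : Finset (Fin n)) {v : EuclideanSpace ℝ (Fin n)}
    (hv : ‖v‖ = 1) : projSq w S v ∈ Set.Icc 0 1 := by
  refine ⟨projSq_nonneg w S v, ?_⟩
  have h1 := projSq_add_compl w S v
  have h2 := projSq_nonneg w Sᶜ v
  rw [hv] at h1
  linarith

lemma integral_exp_projSq_le_of_nonneg (hn : 0 < n) (S : Finset (Fin n)) {t : ℝ} (ht : 0 ≤ t) :
    ∫ v, Real.exp (t * projSq w S v) ∂unifSphere n ≤
      Real.exp (S.card / n * t + t ^ 2 / (4 * (n + 2))) := by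
  have := nontrivial_euclideanSpace hn
  have := isProbabilityMeasure_unifSphere (n := n)
  have hn' : (0 : ℝ) < n := by exact_mod_cast hn
  have h := mgf_le_of_moments (μ := unifSphere n) (X := projSq w S) (α := S.card / 2) (γ := n / 2)
    (continuous_projSq w S).measurable
    (by filter_upwards [ae_norm_eq_one_unifSphere] with v hv using
      projSq_mem_Icc_of_norm_eq_one w S hv)
    (by positivity) (fun k => integral_projSq_pow_unifSphere w S k) ht
  refine h.trans (le_of_eq ?_)
  congr 1
  field_simp
  ring

/-- On the sphere the projections onto `S` and its complement sum to 1, so negative `t` reduces to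
positive `-t` for the complement. -/
lemma integral_exp_projSq_le (hn : 0 < n) (S : Finset (Fin n)) (t : ℝ) :
    ∫ v, Real.exp (t * projSq w S v) ∂unifSphere n ≤
      Real.exp (S.card / n * t + t ^ 2 / (4 * (n + 2))) := by
  rcases le_total 0 t with ht | ht
  · exact integral_exp_projSq_le_of_nonneg w hn S ht
  · have h := integral_exp_projSq_le_of_nonneg w hn Sᶜ (neg_nonneg.2 ht)
    have hn' : (0 : ℝ) < n := by exact_mod_cast hn
    have h1 : ∫ v, Real.exp (t * projSq w S v) ∂unifSphere n =
        Real.exp t * ∫ v, Real.exp (-t * projSq w Sᶜ v) ∂unifSphere n := by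
      rw [← integral_const_mul]
      refine integral_congr_ae ?_
      filter_upwards [ae_norm_eq_one_unifSphere] with v hv
      rw [← Real.exp_add]
      congr 1
      have := projSq_add_compl w S v
      rw [hv] at this
      linear_combination t * this
    rw [h1]
    refine (mul_le_mul_of_nonneg_left h (Real.exp_pos t).le).trans (le_of_eq ?_)
    rw [← Real.exp_add, Finset.card_compl, Fintype.card_fin,
      Nat.cast_sub (by simpa using Finset.card_le_univ S)]
    congr 1
    field_simp
    ring

/-- A positive combination of squared coordinates. -/
noncomputable def diagForm (β : Fin n → ℝ) (v : EuclideanSpace ℝ (Fin n)) : ℝ :=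
  ∑ j, β j * (inner ℝ (w j) v) ^ 2

lemma continuous_diagForm (β : Fin n → ℝ) : Continuous (diagForm w β) := by
  unfold diagForm
  fun_prop

lemma integrable_unifSphere_of_continuous (hn : 0 < n) {f : EuclideanSpace ℝ (Fin n) → ℝ}
    (hf : Continuous f) : Integrable f (unifSphere n) := by
  have := nontrivial_euclideanSpace hn
  have := isProbabilityMeasure_unifSphere (n := n)
  obtain ⟨C, hC⟩ := (isCompact_sphere (0 : EuclideanSpace ℝ (Fin n)) 1).exists_bound_of_continuousOn
    hf.continuousOn
  refine Integrable.mono' (integrable_const C) hf.aestronglyMeasurable ?_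
  filter_upwards [ae_norm_eq_one_unifSphere] with v hv using hC v (by simpa using hv)

/-- The exponent is linear in `β`, and an integral of convex functions is convex. -/
lemma convexOn_integral_exp_diagForm (hn : 0 < n) (t : ℝ) :
    ConvexOn ℝ Set.univ fun β : Fin n → ℝ =>
      ∫ v, Real.exp (t * (diagForm w β v - (∑ j, β j) / n)) ∂unifSphere n := by
  have hint : ∀ β, Integrable (fun v => Real.exp (t * (diagForm w β v - (∑ j, β j) / n)))
      (unifSphere n) := fun β => integrable_unifSphere_of_continuous hn (by
    have := continuous_diagForm w β
    fun_prop)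
  refine ⟨convex_univ, fun β _ β' _ p q hp hq hpq => ?_⟩
  simp only [smul_eq_mul]
  rw [← integral_const_mul, ← integral_const_mul,
    ← integral_add ((hint β).const_mul p) ((hint β').const_mul q)]
  refine integral_mono (hint _) (((hint β).const_mul p).add ((hint β').const_mul q)) fun v => ?_
  have h := convexOn_exp.2 (Set.mem_univ (t * (diagForm w β v - (∑ j, β j) / n)))
    (Set.mem_univ (t * (diagForm w β' v - (∑ j, β' j) / n))) hp hq hpq
  simp only [smul_eq_mul] at h
  refine le_trans (le_of_eq ?_) h
  congr 1
  have h1 : diagForm w (p • β + q • β') v = p * diagForm w β v + q * diagForm w β' v := by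
    simp only [diagForm, Pi.add_apply, Pi.smul_apply, smul_eq_mul, Finset.mul_sum,
      ← Finset.sum_add_distrib]
    exact Finset.sum_congr rfl fun j _ => by ring
  have h2 : ∑ j, (p • β + q • β') j = p * ∑ j, β j + q * ∑ j, β' j := by
    simp only [Pi.add_apply, Pi.smul_apply, smul_eq_mul, Finset.mul_sum, ← Finset.sum_add_distrib]
  rw [h1, h2]
  ring

/-- A convex function on the cube is dominated by its value at some vertex. At a vertex the form is
a `projSq`, and the bound there does not depend on the vertex. -/
lemma integral_exp_diagForm_le (hn : 0 < n) {β : Fin n → ℝ} (hβ : ∀ j, β j ∈ Set.Icc 0 1) (t : ℝ) :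
    ∫ v, Real.exp (t * (diagForm w β v - (∑ j, β j) / n)) ∂unifSphere n ≤
      Real.exp (t ^ 2 / (4 * (n + 2))) := by
  have hmem : β ∈ convexHull ℝ (Set.univ.pi fun _ : Fin n => ({0, 1} : Set ℝ)) := by
    rw [convexHull_pi, Set.mem_univ_pi]
    intro j
    rw [convexHull_pair, segment_eq_Icc zero_le_one]
    exact hβ j
  obtain ⟨β', hβ', hle⟩ := (convexOn_integral_exp_diagForm w hn t).exists_ge_of_mem_convexHull
    (Set.subset_univ _) hmem
  refine hle.trans ?_
  rw [Set.mem_univ_pi] at hβ'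
  set S := Finset.univ.filter fun j => β' j = 1 with hS
  have hval : ∀ j, β' j = if j ∈ S then 1 else 0 := by
    intro j
    rcases hβ' j with h | h
    · simp [hS, h]
    · rw [Set.mem_singleton_iff] at h
      simp [hS, h]
  have h1 : ∑ j, β' j = S.card := by
    simp_rw [hval]
    simp
  have h2 : ∀ v, diagForm w β' v = projSq w S v := by
    intro v
    rw [diagForm, projSq]
    simp_rw [hval, ite_mul, one_mul, zero_mul]
    rw [Finset.sum_ite_mem, Finset.univ_inter]
  simp_rw [h1, h2]
  have h3 : ∀ v, Real.exp (t * (projSq w S v - (S.card : ℝ) / n)) =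
      Real.exp (-((S.card : ℝ) / n * t)) * Real.exp (t * projSq w S v) := by
    intro v
    rw [← Real.exp_add]
    congr 1
    ring
  simp_rw [h3]
  rw [integral_const_mul]
  refine (mul_le_mul_of_nonneg_left (integral_exp_projSq_le w hn S t) (Real.exp_pos _).le).trans
    (le_of_eq ?_)
  rw [← Real.exp_add]
  congr 1
  ring

end SphereSubgaussian

end RandQuad

namespace RandQuad

/-! ### Weighted spectral measures of random vectors -/

section Diagonalization

variable {n : ℕ}

/-- Diagonalize the symmetric operator `v ↦ ∑ ⟨c_k, v⟩ c_k`. The `c_k` need not be orthogonal: they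
will be real and imaginary parts of complex eigenvectors. -/
lemma exists_orthonormalBasis_sum_inner_sq {ι : Type*} [Fintype ι]
    (c : ι → EuclideanSpace ℝ (Fin n)) :
    ∃ w : OrthonormalBasis (Fin n) ℝ (EuclideanSpace ℝ (Fin n)), ∀ v,
      ∑ k, (inner ℝ (c k) v) ^ 2 = diagForm w (fun j => ∑ k, (inner ℝ (c k) (w j)) ^ 2) v := by
  set T : EuclideanSpace ℝ (Fin n) →ₗ[ℝ] EuclideanSpace ℝ (Fin n) :=
    ∑ k, (innerₛₗ ℝ (c k)).smulRight (c k) with hT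
  have hTv : ∀ v v', inner ℝ (T v) v' = ∑ k, inner ℝ (c k) v * inner ℝ (c k) v' := by
    intro v v'
    simp [hT, sum_inner, inner_smul_left]
  have hsymm : T.IsSymmetric := by
    intro v v'
    rw [hTv, ← real_inner_comm, hTv]
    exact Finset.sum_congr rfl fun k _ => mul_comm _ _
  have hfin : Module.finrank ℝ (EuclideanSpace ℝ (Fin n)) = n := by simp
  set w := hsymm.eigenvectorBasis hfin with hw
  have hself : ∀ v, inner ℝ (T v) v = ∑ k, (inner ℝ (c k) v) ^ 2 := by
    intro v
    rw [hTv]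
    exact Finset.sum_congr rfl fun k _ => (sq _).symm
  have heig : ∀ j, T (w j) = hsymm.eigenvalues hfin j • w j := fun j =>
    hsymm.apply_eigenvectorBasis hfin j
  refine ⟨w, fun v => ?_⟩
  rw [← hself, ← w.sum_inner_mul_inner (T v) v, diagForm]
  refine Finset.sum_congr rfl fun j _ => ?_
  rw [← hself, hsymm v (w j), heig, inner_smul_right, inner_smul_left, real_inner_comm v (w j),
    real_inner_self_eq_norm_sq, w.norm_eq_one]
  simp
  ring

end Diagonalization

/-! ### Weighted spectral distribution functions as real quadratic forms -/

section Spectral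

variable {𝕜 : Type*} [RCLike 𝕜] {n : ℕ}

lemma norm_toField (v : EuclideanSpace ℝ (Fin n)) : ‖toField 𝕜 v‖ = ‖v‖ := by
  simp [toField, EuclideanSpace.norm_eq]

/-- The real parts of the entries of a vector. -/
noncomputable def reVec (u : EuclideanSpace 𝕜 (Fin n)) : EuclideanSpace ℝ (Fin n) :=
  WithLp.toLp 2 fun j => RCLike.re (u j)

/-- The imaginary parts of the entries of a vector. -/
noncomputable def imVec (u : EuclideanSpace 𝕜 (Fin n)) : EuclideanSpace ℝ (Fin n) :=
  WithLp.toLp 2 fun j => RCLike.im (u j)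

lemma norm_sq_reVec_add_imVec (u : EuclideanSpace 𝕜 (Fin n)) :
    ‖reVec u‖ ^ 2 + ‖imVec u‖ ^ 2 = ‖u‖ ^ 2 := by
  simp only [EuclideanSpace.norm_sq_eq, reVec, imVec, ← Finset.sum_add_distrib]
  refine Finset.sum_congr rfl fun j _ => ?_
  rw [RCLike.norm_sq_eq_def (z := u j)]
  simp [sq]

lemma norm_sq_inner_toField (v : EuclideanSpace ℝ (Fin n)) (u : EuclideanSpace 𝕜 (Fin n)) :
    ‖inner 𝕜 (toField 𝕜 v) u‖ ^ 2 = inner ℝ (reVec u) v ^ 2 + inner ℝ (imVec u) v ^ 2 := by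
  rw [RCLike.norm_sq_eq_def]
  simp only [PiLp.inner_apply, toField, reVec, imVec, RCLike.inner_apply, map_sum]
  simp [sq, mul_comm]

variable {A : Matrix (Fin n) (Fin n) 𝕜} (hA : A.IsHermitian)

/-- The indices of the eigenvalues that are at most `x`. -/
noncomputable def eigIdx (x : ℝ) : Finset (Fin n) :=
  Finset.univ.filter fun i => hA.eigenvalues i ≤ x

lemma cesm_eq_card (x : ℝ) : cesm hA x = (eigIdx hA x).card / n := by
  simp only [cesm, eigIdx, mul_ite, mul_one, mul_zero]
  rw [← Finset.sum_filter, Finset.sum_const, nsmul_eq_mul]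
  ring

lemma weightedSpectralMeasure_eq_atomicMeasure (v : EuclideanSpace ℝ (Fin n)) :
    weightedSpectralMeasure hA v = atomicMeasure Finset.univ
      (fun i => ‖inner 𝕜 (toField 𝕜 v) (hA.eigenvectorBasis i)‖ ^ 2) hA.eigenvalues := rfl

lemma weightedSpectralMeasure_real_Iic (v : EuclideanSpace ℝ (Fin n)) (x : ℝ) :
    (weightedSpectralMeasure hA v).real (Set.Iic x) =
      ∑ i ∈ eigIdx hA x, ‖inner 𝕜 (toField 𝕜 v) (hA.eigenvectorBasis i)‖ ^ 2 := by
  rw [← integral_indicator_one measurableSet_Iic, weightedSpectralMeasure_eq_atomicMeasure,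
    integral_atomicMeasure (fun i _ => by positivity), eigIdx, Finset.sum_filter]
  refine Finset.sum_congr rfl fun i _ => ?_
  by_cases h : hA.eigenvalues i ≤ x <;> simp [Set.indicator, h]

lemma sum_norm_sq_inner_toField (v : EuclideanSpace ℝ (Fin n)) :
    ∑ i, ‖inner 𝕜 (toField 𝕜 v) (hA.eigenvectorBasis i)‖ ^ 2 = ‖v‖ ^ 2 := by
  rw [hA.eigenvectorBasis.sum_sq_norm_inner_left, norm_toField]

lemma isProbabilityMeasure_weightedSpectralMeasure {v : EuclideanSpace ℝ (Fin n)} (hv : ‖v‖ = 1) :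
    IsProbabilityMeasure (weightedSpectralMeasure hA v) := by
  constructor
  rw [weightedSpectralMeasure, Measure.coe_finsetSum, Finset.sum_apply]
  simp only [Measure.smul_apply, measure_univ, smul_eq_mul, mul_one]
  rw [← ENNReal.ofReal_sum_of_nonneg fun i _ => by positivity, sum_norm_sq_inner_toField, hv]
  simp

lemma lamMin_le (i : Fin n) : lamMin hA ≤ hA.eigenvalues i :=
  ciInf_le (Set.finite_range _).bddBelow i

lemma le_lamMax (i : Fin n) : hA.eigenvalues i ≤ lamMax hA :=
  le_ciSup (Set.finite_range _).bddAbove i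

lemma lamMin_le_lamMax (hn : 0 < n) : lamMin hA ≤ lamMax hA :=
  (lamMin_le hA ⟨0, hn⟩).trans (le_lamMax hA ⟨0, hn⟩)

lemma weightedSpectralMeasure_compl_Icc {a b : ℝ} (ha : a ≤ lamMin hA) (hb : lamMax hA ≤ b)
    (v : EuclideanSpace ℝ (Fin n)) : weightedSpectralMeasure hA v (Set.Icc a b)ᶜ = 0 :=
  atomicMeasure_compl_Icc fun i _ => ⟨ha.trans (lamMin_le hA i), (le_lamMax hA i).trans hb⟩

/-- Each coefficient `β_j` is the value at `x` of the weighted CESM of the unit vector `w_j`, hence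
lies in `[0, 1]`. Each eigenvector contributes its squared norm 1 to the sum of the `β_j`. -/
lemma exists_diagForm (x : ℝ) :
    ∃ (w : OrthonormalBasis (Fin n) ℝ (EuclideanSpace ℝ (Fin n))) (β : Fin n → ℝ),
      (∀ j, β j ∈ Set.Icc 0 1) ∧ ∑ j, β j = (eigIdx hA x).card ∧
      ∀ v, (weightedSpectralMeasure hA v).real (Set.Iic x) = diagForm w β v := by
  set u := hA.eigenvectorBasis with hu
  obtain ⟨w, hw⟩ := exists_orthonormalBasis_sum_inner_sq
    (Sum.elim (fun i : eigIdx hA x => reVec (u i)) fun i : eigIdx hA x => imVec (u i))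
  have hval : ∀ v, (weightedSpectralMeasure hA v).real (Set.Iic x) =
      ∑ k, inner ℝ ((Sum.elim (fun i : eigIdx hA x => reVec (u i))
        fun i : eigIdx hA x => imVec (u i)) k) v ^ 2 := by
    intro v
    simp only [weightedSpectralMeasure_real_Iic, norm_sq_inner_toField, Fintype.sum_sum_type,
      Sum.elim_inl, Sum.elim_inr, Finset.sum_add_distrib]
    rw [← Finset.sum_coe_sort (eigIdx hA x), ← Finset.sum_coe_sort (eigIdx hA x)]
  simp_rw [← hval] at hw
  refine ⟨w, _, fun j => ⟨measureReal_nonneg, ?_⟩, ?_, hw⟩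
  · rw [weightedSpectralMeasure_real_Iic]
    refine (Finset.sum_le_univ_sum_of_nonneg fun i => by positivity).trans ?_
    rw [sum_norm_sq_inner_toField, w.norm_eq_one, one_pow]
  · simp only [weightedSpectralMeasure_real_Iic, norm_sq_inner_toField]
    rw [Finset.sum_comm]
    have : ∀ i, ∑ j, (inner ℝ (reVec (u i)) (w j) ^ 2 + inner ℝ (imVec (u i)) (w j) ^ 2) = 1 := by
      intro i
      have h1 := w.sum_sq_norm_inner_left (reVec (u i))
      have h2 := w.sum_sq_norm_inner_left (imVec (u i))
      simp only [Real.norm_eq_abs, sq_abs] at h1 h2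
      rw [Finset.sum_add_distrib, h1, h2, norm_sq_reVec_add_imVec, u.norm_eq_one, one_pow]
    simp [← hu, this]

end Spectral

end RandQuad

namespace RandQuad

/-! ### Concentration of the averaged weighted spectral measures -/

section Concentration

variable {𝕜 : Type*} [RCLike 𝕜] {n : ℕ} {A : Matrix (Fin n) (Fin n) 𝕜} (hA : A.IsHermitian)

lemma continuous_weightedSpectralMeasure_real_Iic (x : ℝ) :
    Continuous fun v => (weightedSpectralMeasure hA v).real (Set.Iic x) := by
  obtain ⟨w, β, -, -, h⟩ := exists_diagForm hA x
  simp_rw [h]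
  exact continuous_diagForm w β

/-- The centering is right because the trace of the form divided by `n` is `Φ(x)`. A variance proxy
`c` means the bound `exp (c t² / 2)`, here `exp (t² / (4 (n + 2)))`. -/
lemma hasSubgaussianMGF_weightedSpectralMeasure (hn : 0 < n) (x : ℝ) :
    HasSubgaussianMGF
      (fun v => (weightedSpectralMeasure hA v).real (Set.Iic x) - cesm hA x)
      (1 / (2 * (n + 2))) (unifSphere n) := by
  obtain ⟨w, β, hβ, hsum, h⟩ := exists_diagForm hA x
  have hc := continuous_diagForm w β
  simp_rw [h, cesm_eq_card, ← hsum]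
  refine ⟨fun t => integrable_unifSphere_of_continuous hn (by fun_prop), fun t => ?_⟩
  refine (integral_exp_diagForm_le w hn hβ t).trans (le_of_eq ?_)
  congr 1
  push_cast
  field_simp
  ring

variable {Ω : Type*} [MeasurableSpace Ω] {P : Measure Ω}
  {N : ℕ} {v : Fin N → Ω → EuclideanSpace ℝ (Fin n)}

lemma hasSubgaussianMGF_comp (hn : 0 < n) (hlaw : ∀ l, HasLaw (v l) (unifSphere n) P)
    (x : ℝ) (l : Fin N) :
    HasSubgaussianMGF
      (fun ω => (weightedSpectralMeasure hA (v l ω)).real (Set.Iic x) - cesm hA x)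
      (1 / (2 * (n + 2))) P := by
  have h := hasSubgaussianMGF_weightedSpectralMeasure hA hn x
  rw [← (hlaw l).map_eq] at h
  exact h.of_map (hlaw l).aemeasurable

/-- The average of the weighted spectral distribution functions. -/
noncomputable def avgCDF (v : Fin N → EuclideanSpace ℝ (Fin n)) : ℝ → ℝ :=
  average fun l x => (weightedSpectralMeasure hA (v l)).real (Set.Iic x)

lemma measureReal_le_abs_avgCDF_sub (hn : 0 < n) (hN : 0 < N) (hindep : iIndepFun v P)
    (hlaw : ∀ l, HasLaw (v l) (unifSphere n) P) (x : ℝ) {t : ℝ} (ht : 0 ≤ t) :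
    P.real {ω | t ≤ |avgCDF hA (fun l => v l ω) x - cesm hA x|} ≤
      2 * Real.exp (-(N * (n + 2) * t ^ 2)) := by
  have hprob : IsProbabilityMeasure P := hindep.isProbabilityMeasure
  have hN' : (0 : ℝ) < N := by exact_mod_cast hN
  set Y : Fin N → Ω → ℝ := fun l ω =>
    (weightedSpectralMeasure hA (v l ω)).real (Set.Iic x) - cesm hA x with hY
  have hmeas : Measurable fun v : EuclideanSpace ℝ (Fin n) =>
      (weightedSpectralMeasure hA v).real (Set.Iic x) - cesm hA x :=
    ((continuous_weightedSpectralMeasure_real_Iic hA x).sub continuous_const).measurable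
  have hYi : iIndepFun Y P := hindep.comp _ fun _ => hmeas
  have hYn : iIndepFun (fun l ω => -Y l ω) P := hindep.comp _ fun _ => hmeas.neg
  have hsub : ∀ l, HasSubgaussianMGF (Y l) (1 / (2 * (n + 2))) P :=
    hasSubgaussianMGF_comp hA hn hlaw x
  have h1 := HasSubgaussianMGF.measure_sum_ge_le_of_iIndepFun hYi (s := Finset.univ)
    (fun l _ => hsub l) (ε := N * t) (by positivity)
  have h2 := HasSubgaussianMGF.measure_sum_ge_le_of_iIndepFun hYn (s := Finset.univ)
    (fun l _ => (hsub l).neg) (ε := N * t) (by positivity)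
  -- Variance proxies of independent summands add, to `N / (2 (n + 2))`, against the threshold `N t`
  -- for the unnormalized sum.
  have hexp : -(N * t) ^ 2 / (2 * ((∑ _l : Fin N, 1 / (2 * (n + 2)) : NNReal) : ℝ)) =
      -(N * (n + 2) * t ^ 2) := by
    push_cast
    rw [Finset.sum_const, Finset.card_univ, Fintype.card_fin, nsmul_eq_mul]
    field_simp
  rw [hexp] at h1 h2
  have hsubset : {ω | t ≤ |avgCDF hA (fun l => v l ω) x - cesm hA x|} ⊆
      {ω | N * t ≤ ∑ l, Y l ω} ∪ {ω | N * t ≤ ∑ l, -Y l ω} := by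
    intro ω hω
    have h3 : ∑ l, Y l ω = N * (avgCDF hA (fun l => v l ω) x - cesm hA x) := by
      simp only [hY, avgCDF, average, Finset.sum_sub_distrib, Finset.sum_const, Finset.card_univ,
        Fintype.card_fin, nsmul_eq_mul]
      field_simp
    simp only [Set.mem_union, Set.mem_ofPred_eq, Finset.sum_neg_distrib, h3] at hω ⊢
    rcases le_abs.1 hω with h | h
    · exact Or.inl (mul_le_mul_of_nonneg_left h hN'.le)
    · right
      rw [← mul_neg]
      exact mul_le_mul_of_nonneg_left h hN'.le
  calc _ ≤ P.real ({ω | N * t ≤ ∑ l, Y l ω} ∪ {ω | N * t ≤ ∑ l, -Y l ω}) :=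
        measureReal_mono hsubset
    _ ≤ _ := measureReal_union_le _ _
    _ ≤ _ := by linarith

/-- Both distribution functions depend on `x` only through `eigIdx`, so it is enough to control them
at the eigenvalues: a union bound over `n` events. -/
lemma exists_eigenvalues_le {x : ℝ} (hn : 0 < n) (hx : lamMin hA ≤ x) :
    ∃ i, eigIdx hA x = eigIdx hA (hA.eigenvalues i) := by
  have : Nonempty (Fin n) := ⟨⟨0, hn⟩⟩
  obtain ⟨i₀, hi₀⟩ := exists_eq_ciInf_of_finite (f := hA.eigenvalues)
  obtain ⟨i, hi, hmax⟩ := (eigIdx hA x).exists_max_image hA.eigenvalues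
    ⟨i₀, by simpa [eigIdx, hi₀, lamMin] using hx⟩
  refine ⟨i, ?_⟩
  ext j
  simp only [eigIdx, Finset.mem_filter, Finset.mem_univ, true_and] at hi hmax ⊢
  exact ⟨hmax j, fun h => h.trans hi⟩

lemma avgCDF_eq_of_eigIdx_eq (v : Fin N → EuclideanSpace ℝ (Fin n)) {x y : ℝ}
    (h : eigIdx hA x = eigIdx hA y) : avgCDF hA v x = avgCDF hA v y := by
  simp only [avgCDF, average, weightedSpectralMeasure_real_Iic, h]

lemma eigIdx_eq_empty {x : ℝ} (hx : x < lamMin hA) : eigIdx hA x = ∅ :=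
  Finset.filter_eq_empty_iff.2 fun i _ => not_le.2 (hx.trans_le (lamMin_le hA i))

lemma eigIdx_eq_univ {x : ℝ} (hx : lamMax hA ≤ x) : eigIdx hA x = Finset.univ :=
  Finset.filter_true_of_mem fun i _ => (le_lamMax hA i).trans hx

lemma avgCDF_sub_cesm_eq_zero (hn : 0 < n) (hN : 0 < N)
    {v : Fin N → EuclideanSpace ℝ (Fin n)} (hv : ∀ l, ‖v l‖ = 1) {x : ℝ}
    (hx : x ∉ Set.Ico (lamMin hA) (lamMax hA)) : avgCDF hA v x - cesm hA x = 0 := by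
  have hN' : (N : ℝ) ≠ 0 := by exact_mod_cast hN.ne'
  have hn' : (n : ℝ) ≠ 0 := by exact_mod_cast hn.ne'
  rcases lt_or_ge x (lamMin hA) with h | h
  · simp [avgCDF, average, weightedSpectralMeasure_real_Iic, cesm_eq_card, eigIdx_eq_empty hA h]
  · have h' : lamMax hA ≤ x := not_lt.1 fun h' => hx ⟨h, h'⟩
    simp [avgCDF, average, weightedSpectralMeasure_real_Iic, cesm_eq_card, eigIdx_eq_univ hA h',
      sum_norm_sq_inner_toField, hv, hN', hn']

/-- The integrand vanishes outside `[λ_min, λ_max)`, since both functions are 0 before and 1 after,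
and is at most `t` inside. For a one-point spectrum no pointwise bound is needed. -/
lemma wassersteinDist_cesm_avgCDF_le (hn : 0 < n) (hN : 0 < N)
    {v : Fin N → EuclideanSpace ℝ (Fin n)} (hv : ∀ l, ‖v l‖ = 1) {t : ℝ}
    (h : lamMin hA < lamMax hA →
      ∀ i, |avgCDF hA v (hA.eigenvalues i) - cesm hA (hA.eigenvalues i)| ≤ t) :
    wassersteinDist (cesm hA) (avgCDF hA v) ≤
      ENNReal.ofReal t * ENNReal.ofReal (lamMax hA - lamMin hA) := by
  rw [← Real.volume_Ico, ← lintegral_indicator_const measurableSet_Ico]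
  refine lintegral_mono fun x => ?_
  rw [abs_sub_comm]
  by_cases hx : x ∈ Set.Ico (lamMin hA) (lamMax hA)
  · rw [Set.indicator_of_mem hx]
    obtain ⟨i, hi⟩ := exists_eigenvalues_le hA hn hx.1
    rw [avgCDF_eq_of_eigIdx_eq hA v hi, cesm_eq_card, hi, ← cesm_eq_card]
    exact ENNReal.ofReal_le_ofReal (h (hx.1.trans_lt hx.2) i)
  · simp [avgCDF_sub_cesm_eq_zero hA hn hN hv hx]

/-- The averaged weighted CESM is close to the CESM with high probability. -/
lemma measure_le_failureBound (hn : 0 < n) (hN : 0 < N) (hindep : iIndepFun v P)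
    (hlaw : ∀ l, HasLaw (v l) (unifSphere n) P) {ε : ℝ} (hε : 0 < ε) {B : Set Ω}
    (hB : ∀ ω ∈ B, (∀ l, ‖v l ω‖ = 1) →
      ENNReal.ofReal (ε / 2) < wassersteinDist (cesm hA) (avgCDF hA fun l => v l ω)) :
    P B ≤ ENNReal.ofReal (failureBound n N (lamMax hA - lamMin hA) ε) := by
  have hprob : IsProbabilityMeasure P := hindep.isProbabilityMeasure
  have hae : ∀ᵐ ω ∂P, ∀ l, ‖v l ω‖ = 1 := by
    rw [ae_all_iff]
    intro l
    have h := ae_norm_eq_one_unifSphere (n := n)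
    rw [← (hlaw l).map_eq] at h
    exact ae_of_ae_map (hlaw l).aemeasurable h
  set Z : Set Ω := {ω | ¬ ∀ l, ‖v l ω‖ = 1} with hZ
  have hZ0 : P Z = 0 := hae
  rcases (lamMin_le_lamMax hA hn).eq_or_lt with heq | hlt
  · have hsub : B ⊆ Z := by
      intro ω hω hv
      have h1 := wassersteinDist_cesm_avgCDF_le hA hn hN (t := 0) hv
        fun h => absurd h heq.not_lt
      rw [ENNReal.ofReal_zero, zero_mul] at h1
      exact absurd (hB ω hω hv) (not_lt.2 (h1.trans zero_le))
    rw [measure_mono_null hsub hZ0]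
    exact zero_le
  · set W := lamMax hA - lamMin hA with hW
    have hWpos : 0 < W := sub_pos.2 hlt
    -- Pointwise deviations below `ε / (2 W)` over a width `W` keep the distance within `ε / 2`.
    -- Only monotonicity of outer measure is used, so `B` may be nonmeasurable.
    have hsub : B ⊆ Z ∪ ⋃ i, {ω | ε / (2 * W) ≤ |avgCDF hA (fun l => v l ω) (hA.eigenvalues i) -
        cesm hA (hA.eigenvalues i)|} := by
      intro ω hω
      by_contra hcon
      simp only [Set.mem_union, Set.mem_iUnion, Set.mem_ofPred_eq, not_or, not_exists, not_le,
        hZ, not_not] at hcon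
      have h1 := wassersteinDist_cesm_avgCDF_le hA hn hN hcon.1
        fun _ i => (hcon.2 i).le
      rw [← ENNReal.ofReal_mul (by positivity)] at h1
      have h2 : ε / (2 * W) * W = ε / 2 := by field_simp
      rw [← hW, h2] at h1
      exact absurd (hB ω hω hcon.1) (not_lt.2 h1)
    have hexp : ∀ x, P {ω | ε / (2 * W) ≤ |avgCDF hA (fun l => v l ω) x - cesm hA x|} ≤
        ENNReal.ofReal (2 * Real.exp (-((N : ℝ) * (n + 2) * ε ^ 2 / (4 * W ^ 2)))) := by
      intro x
      rw [← ofReal_measureReal]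
      refine ENNReal.ofReal_le_ofReal ?_
      refine (measureReal_le_abs_avgCDF_sub hA hn hN hindep hlaw x (by positivity)).trans
        (le_of_eq ?_)
      congr 3
      field_simp
      norm_num
    calc P B ≤ P Z + ∑ i, P {ω | ε / (2 * W) ≤
            |avgCDF hA (fun l => v l ω) (hA.eigenvalues i) - cesm hA (hA.eigenvalues i)|} :=
          (measure_mono hsub).trans ((measure_union_le _ _).trans
            (add_le_add le_rfl (measure_iUnion_fintype_le _ _)))
      _ ≤ 0 + ∑ _i : Fin n,
          ENNReal.ofReal (2 * Real.exp (-((N : ℝ) * (n + 2) * ε ^ 2 / (4 * W ^ 2)))) :=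
          add_le_add hZ0.le (Finset.sum_le_sum fun i _ => hexp _)
      _ = _ := by
          rw [zero_add, Finset.sum_const, Finset.card_univ, Fintype.card_fin, nsmul_eq_mul,
            failureBound, if_neg hWpos.ne', ← ENNReal.ofReal_natCast,
            ← ENNReal.ofReal_mul (by positivity)]
          congr 1
          ring

end Concentration

/-! ### Deterministic error bounds for the averaged quadrature approximations -/

section Deterministic

lemma wassersteinDist_triangle {f g h : ℝ → ℝ} (hf : Measurable f) (hg : Measurable g) :
    wassersteinDist f h ≤ wassersteinDist f g + wassersteinDist g h := by
  simp only [wassersteinDist]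
  rw [← lintegral_add_left (by fun_prop)]
  refine lintegral_mono fun x => ?_
  rw [← ENNReal.ofReal_add (abs_nonneg _) (abs_nonneg _)]
  exact ENNReal.ofReal_le_ofReal (abs_sub_le _ _ _)

/-- Used for Gaussian quadrature, whose nodes depend on the sample vector, so that averaging and
quadrature do not commute. -/
lemma wassersteinDist_average_le {N : ℕ} (hN : 0 < N) {f g : Fin N → ℝ → ℝ}
    (hf : ∀ l, Measurable (f l)) (hg : ∀ l, Measurable (g l)) {C : ℝ≥0∞}
    (h : ∀ l, wassersteinDist (f l) (g l) ≤ C) :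
    wassersteinDist (average f) (average g) ≤ C := by
  have hN' : (N : ℝ≥0∞) ≠ 0 := by exact_mod_cast hN.ne'
  have hpos : (0 : ℝ) < N := by exact_mod_cast hN
  calc wassersteinDist (average f) (average g)
      ≤ ∫⁻ x, (N : ℝ≥0∞)⁻¹ * ∑ l, ENNReal.ofReal |f l x - g l x| := by
        refine lintegral_mono fun x => ?_
        rw [average, average, ← mul_sub, ← Finset.sum_sub_distrib, abs_mul,
          abs_of_pos (inv_pos.2 hpos), ENNReal.ofReal_mul (inv_nonneg.2 hpos.le),
          ENNReal.ofReal_inv_of_pos hpos, ENNReal.ofReal_natCast,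
          ← ENNReal.ofReal_sum_of_nonneg fun l _ => abs_nonneg _]
        gcongr
        exact Finset.abs_sum_le_sum_abs _ _
    _ = (N : ℝ≥0∞)⁻¹ * ∑ l, wassersteinDist (f l) (g l) := by
        rw [lintegral_const_mul _ (by fun_prop), lintegral_finsetSum _ (by fun_prop)]
        rfl
    _ ≤ (N : ℝ≥0∞)⁻¹ * ∑ _l : Fin N, C := by
        gcongr with l
        exact h l
    _ = C := by
        rw [Finset.sum_const, Finset.card_univ, Fintype.card_fin, nsmul_eq_mul, ← mul_assoc,
          ENNReal.inv_mul_cancel hN' (by simp), one_mul]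

lemma measurable_measureReal_Iic (ν : Measure ℝ) [IsFiniteMeasure ν] :
    Measurable fun x => ν.real (Set.Iic x) :=
  Monotone.measurable fun _ _ h => measureReal_mono (Set.Iic_subset_Iic.2 h)

/-- Nonnegative weights make the rule a genuine measure; its distribution function is monotone and
hence measurable. -/
lemma quadGauss_eq_gaussMeasure {ν : Measure ℝ} (h : PolyIntegrable ν) (k : ℕ) :
    quadGauss k ν = fun x => (gaussMeasure ν k).real (Set.Iic x) := by
  funext x
  rw [← integral_indicator_one measurableSet_Iic, integral_gaussMeasure h]
  rfl

variable {𝕜 : Type*} [RCLike 𝕜] {n N : ℕ} {A : Matrix (Fin n) (Fin n) 𝕜} (hA : A.IsHermitian)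

lemma measurable_cesm : Measurable (cesm hA) := by
  unfold cesm
  refine Finset.measurable_sum _ fun i _ => Measurable.const_mul ?_ _
  exact Measurable.ite measurableSet_Ici measurable_const measurable_const

instance (v : EuclideanSpace ℝ (Fin n)) : IsFiniteMeasure (weightedSpectralMeasure hA v) := by
  rw [weightedSpectralMeasure_eq_atomicMeasure]
  infer_instance

/-- The average of weighted spectral measures. -/
noncomputable def avgMeasure (v : Fin N → EuclideanSpace ℝ (Fin n)) : Measure ℝ :=
  atomicMeasure Finset.univ
    (fun i => (N : ℝ)⁻¹ * ∑ l, ‖inner 𝕜 (toField 𝕜 (v l)) (hA.eigenvectorBasis i)‖ ^ 2)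
    hA.eigenvalues

instance (v : Fin N → EuclideanSpace ℝ (Fin n)) : IsFiniteMeasure (avgMeasure hA v) := by
  unfold avgMeasure
  infer_instance

lemma integral_avgMeasure (v : Fin N → EuclideanSpace ℝ (Fin n)) (f : ℝ → ℝ) :
    ∫ x, f x ∂avgMeasure hA v = (N : ℝ)⁻¹ * ∑ l, ∫ x, f x ∂weightedSpectralMeasure hA (v l) := by
  simp_rw [weightedSpectralMeasure_eq_atomicMeasure]
  rw [avgMeasure, integral_atomicMeasure fun i _ => by positivity]
  simp_rw [integral_atomicMeasure (I := Finset.univ) (fun i _ => sq_nonneg _)]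
  rw [Finset.sum_comm, Finset.mul_sum]
  refine Finset.sum_congr rfl fun i _ => ?_
  rw [← Finset.mul_sum]
  ring

lemma avgMeasure_real_Iic (v : Fin N → EuclideanSpace ℝ (Fin n)) :
    (fun x => (avgMeasure hA v).real (Set.Iic x)) = avgCDF hA v := by
  funext x
  simp only [avgCDF, average, ← integral_indicator_one measurableSet_Iic, integral_avgMeasure]

/-- An operator that does not depend on the measure induces a quadrature linear in the measure, so
one quadrature of the averaged measure is analysed. This is why the total variation of the average
enters, not those of the summands. -/
lemma protoOutput_inducedQuad (op : (ℝ → ℝ) → ℝ[X]) (v : Fin N → EuclideanSpace ℝ (Fin n)) :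
    protoOutput hA (inducedQuad op) v = inducedQuad op (avgMeasure hA v) := by
  funext x
  simp only [protoOutput, average, inducedQuad, integral_avgMeasure]

lemma avgMeasure_compl_Icc {a b : ℝ} (ha : a ≤ lamMin hA) (hb : lamMax hA ≤ b)
    (v : Fin N → EuclideanSpace ℝ (Fin n)) : avgMeasure hA v (Set.Icc a b)ᶜ = 0 :=
  atomicMeasure_compl_Icc fun i _ => ⟨ha.trans (lamMin_le hA i), (le_lamMax hA i).trans hb⟩

variable {v : Fin N → EuclideanSpace ℝ (Fin n)}

lemma isProbabilityMeasure_avgMeasure (hN : 0 < N) (hv : ∀ l, ‖v l‖ = 1) :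
    IsProbabilityMeasure (avgMeasure hA v) := by
  have hN' : (N : ℝ) ≠ 0 := by exact_mod_cast hN.ne'
  have h1 := integral_avgMeasure hA v fun _ => (1 : ℝ)
  have h2 : ∀ l, ∫ _, (1 : ℝ) ∂weightedSpectralMeasure hA (v l) = 1 := by
    intro l
    have := isProbabilityMeasure_weightedSpectralMeasure hA (hv l)
    simp
  simp only [h2, Finset.sum_const, Finset.card_univ, Fintype.card_fin, nsmul_eq_mul, mul_one,
    inv_mul_cancel₀ hN', integral_const, smul_eq_mul] at h1
  exact isProbabilityMeasure_iff_real.2 h1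

lemma measurable_avgCDF (v : Fin N → EuclideanSpace ℝ (Fin n)) : Measurable (avgCDF hA v) := by
  rw [← avgMeasure_real_Iic]
  exact measurable_measureReal_Iic _

/-- The triangle inequality in contrapositive form: the conclusion no longer mentions the quadrature
output `f`, so its degree may vary with the sample. -/
lemma lt_wassersteinDist_avgCDF {f : ℝ → ℝ} {ε : ℝ} (hε : 0 < ε)
    (hf : wassersteinDist (avgCDF hA v) f ≤ ENNReal.ofReal (ε / 2))
    (h : ENNReal.ofReal ε < wassersteinDist (cesm hA) f) :
    ENNReal.ofReal (ε / 2) < wassersteinDist (cesm hA) (avgCDF hA v) := by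
  by_contra hcon
  have h1 := (wassersteinDist_triangle (h := f) (measurable_cesm hA)
    (measurable_avgCDF hA v)).trans (add_le_add (not_lt.1 hcon) hf)
  rw [← ENNReal.ofReal_add (by positivity) (by positivity), add_halves] at h1
  exact absurd h (not_lt.2 h1)

lemma wassersteinDist_avgCDF_quadGauss_le (hn : 0 < n) (hN : 0 < N) (hv : ∀ l, ‖v l‖ = 1) {k : ℕ}
    (hk : 1 ≤ k) :
    wassersteinDist (avgCDF hA v) (protoOutput hA (quadGauss k) v) ≤
      ENNReal.ofReal (Real.pi * (lamMax hA - lamMin hA) / (2 * k)) := by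
  refine wassersteinDist_average_le hN (fun l => measurable_measureReal_Iic _) (fun l => ?_)
    fun l => ?_
  · rw [quadGauss_eq_gaussMeasure (polyIntegrable_of_compl_Icc
      (weightedSpectralMeasure_compl_Icc hA le_rfl le_rfl (v l)))]
    exact measurable_measureReal_Iic _
  · have := isProbabilityMeasure_weightedSpectralMeasure hA (hv l)
    exact wassersteinDist_quadGauss_le (lamMin_le_lamMax hA hn)
      (weightedSpectralMeasure_compl_Icc hA le_rfl le_rfl (v l)) hk

lemma wassersteinDist_avgCDF_quad_le_totalVar (hn : 0 < n) (hN : 0 < N) (hv : ∀ l, ‖v l‖ = 1)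
    {a b : ℝ} (ha : a ≤ lamMin hA) (hb : lamMax hA ≤ b) {μ : Measure ℝ} [IsProbabilityMeasure μ]
    (hμ : μ (Set.Icc a b)ᶜ = 0) {s : ℕ} (hs : (s : ℕ∞) + 1 ≤ μ.support.encard)
    {Q : ℕ → Measure ℝ → ℝ → ℝ} (hQ : Q = quadInterp μ ∨ Q = quadApprox μ) :
    wassersteinDist (avgCDF hA v) (protoOutput hA (Q s) v) ≤
      ENNReal.ofReal (Real.pi * (b - a) / (2 * (s + 2))) *
        (1 + totalVar (protoOutput hA (Q s) v)) := by
  have hab : a ≤ b := ha.trans ((lamMin_le_lamMax hA hn).trans hb)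
  have hnd := orthNondeg_of_support (polyIntegrable_of_compl_Icc hμ) hs
  have := isProbabilityMeasure_avgMeasure hA hN hv
  have hν := avgMeasure_compl_Icc hA ha hb v
  rw [← avgMeasure_real_Iic]
  rcases hQ with rfl | rfl
  · have h : protoOutput hA (quadInterp μ s) v = quadInterp μ s (avgMeasure hA v) :=
      protoOutput_inducedQuad hA _ v
    rw [h]
    exact wassersteinDist_quadInterp_le hab hμ hν hnd
  · have h : protoOutput hA (quadApprox μ s) v = quadApprox μ s (avgMeasure hA v) :=
      protoOutput_inducedQuad hA _ v
    rw [h]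
    exact wassersteinDist_quadApprox_le hab hμ hν hnd

lemma wassersteinDist_avgCDF_quadDamped_le (hN : 0 < N) (hv : ∀ l, ‖v l‖ = 1)
    {a b : ℝ} (hab : a < b) (ha : a ≤ lamMin hA) (hb : lamMax hA ≤ b) (s : ℕ)
    {Q : ℕ → Measure ℝ → ℝ → ℝ} (hQ : Q = quadDampedInterp a b ∨ Q = quadDampedApprox a b) :
    wassersteinDist (avgCDF hA v) (protoOutput hA (Q s) v) ≤
      ENNReal.ofReal (Real.pi * (b - a) / (2 * (s + 2))) := by
  have := isProbabilityMeasure_avgMeasure hA hN hv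
  have hν := avgMeasure_compl_Icc hA ha hb v
  rw [← avgMeasure_real_Iic]
  rcases hQ with rfl | rfl
  · have h : protoOutput hA (quadDampedInterp a b s) v =
        quadDampedInterp a b s (avgMeasure hA v) := protoOutput_inducedQuad hA _ v
    rw [h]
    exact wassersteinDist_quadDampedInterp_le hab hν s
  · have h : protoOutput hA (quadDampedApprox a b s) v =
        quadDampedApprox a b s (avgMeasure hA v) := protoOutput_inducedQuad hA _ v
    rw [h]
    exact wassersteinDist_quadDampedApprox_le hab hν s

/-- Pulling out `ε / (2 (s + 2))` leaves exactly the threshold expression, so a possibly infinite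
`T` is never subtracted or divided. The step from `s + 1` to `s + 2` is slack. -/
lemma ofReal_mul_le_of_threshold {ε c : ℝ} (hε : 0 < ε) {s : ℕ} {T : ℝ≥0∞}
    (h : ENNReal.ofReal (c * ε⁻¹) * T ≤ (s : ℝ≥0∞) + 1) :
    ENNReal.ofReal (c / (2 * (s + 2))) * T ≤ ENNReal.ofReal (ε / 2) := by
  have h1 : c / (2 * (s + 2)) = ε / (2 * (s + 2)) * (c * ε⁻¹) := by field_simp
  have h2 : (s : ℝ≥0∞) + 1 = ENNReal.ofReal (s + 1) := by
    rw [ENNReal.ofReal_add (by positivity) zero_le_one]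
    simp
  rw [h1, ENNReal.ofReal_mul (by positivity), mul_assoc]
  refine (mul_le_mul_right h _).trans ?_
  rw [h2, ← ENNReal.ofReal_mul (by positivity)]
  refine ENNReal.ofReal_le_ofReal ?_
  rw [div_mul_eq_mul_div, div_le_div_iff₀ (by positivity) two_pos]
  nlinarith

end Deterministic

end RandQuad

/-! ### Error bounds for the prototypical algorithm -/

theorem mainTheorem1 {𝕜 : Type*} [RCLike 𝕜] {n : ℕ} (hn : 0 < n)
    (A : Matrix (Fin n) (Fin n) 𝕜) (hA : A.IsHermitian)
    {Ω : Type*} [MeasurableSpace Ω] (P : Measure Ω) [IsProbabilityMeasure P]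
    {N : ℕ} (hN : 0 < N) (v : Fin N → Ω → EuclideanSpace ℝ (Fin n))
    (hindep : iIndepFun v P) (hlaw : ∀ l, HasLaw (v l) (RandQuad.unifSphere n) P)
    (ε : ℝ) (hε : 0 < ε) :
    -- Gaussian quadrature, of degree `s = 2k - 1`
    (∀ k : ℕ, 1 ≤ k →
      -1 + 2 * Real.pi * (RandQuad.lamMax hA - RandQuad.lamMin hA) * ε⁻¹ ≤ 2 * (k : ℝ) - 1 →
      P {ω | ENNReal.ofReal ε < RandQuad.wassersteinDist (RandQuad.cesm hA)
          (RandQuad.protoOutput hA (RandQuad.quadGauss k) fun l => v l ω)} ≤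
        ENNReal.ofReal
          (RandQuad.failureBound n N (RandQuad.lamMax hA - RandQuad.lamMin hA) ε)) ∧
    -- quadrature by interpolation and by approximation, `μ` arbitrary; the degree `s` and the
    -- threshold may depend on the sample
    (∀ (a b : ℝ), a ≤ RandQuad.lamMin hA → RandQuad.lamMax hA ≤ b →
      ∀ (μ : Measure ℝ) [IsProbabilityMeasure μ], μ (Set.Icc a b)ᶜ = 0 →
      ∀ s : Ω → ℕ, (∀ ω, (s ω : ℕ∞) + 1 ≤ μ.support.encard) →
      ∀ Q : ℕ → Measure ℝ → ℝ → ℝ, (Q = RandQuad.quadInterp μ ∨ Q = RandQuad.quadApprox μ) →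
      P {ω |
          ENNReal.ofReal (Real.pi * (b - a) * ε⁻¹) *
              (1 + RandQuad.totalVar (RandQuad.protoOutput hA (Q (s ω)) fun l => v l ω)) ≤
            (s ω : ℝ≥0∞) + 1 ∧
          ENNReal.ofReal ε < RandQuad.wassersteinDist (RandQuad.cesm hA)
            (RandQuad.protoOutput hA (Q (s ω)) fun l => v l ω)} ≤
        ENNReal.ofReal
          (RandQuad.failureBound n N (RandQuad.lamMax hA - RandQuad.lamMin hA) ε)) ∧
    -- Jackson-damped quadrature for the Chebyshev distribution on `[a, b]`
    (∀ (a b : ℝ), a < b → a ≤ RandQuad.lamMin hA → RandQuad.lamMax hA ≤ b →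
      ∀ s : ℕ, -2 + Real.pi ^ 2 * (b - a) * ε⁻¹ ≤ (s : ℝ) →
      ∀ Q : ℕ → Measure ℝ → ℝ → ℝ,
        (Q = RandQuad.quadDampedInterp a b ∨ Q = RandQuad.quadDampedApprox a b) →
      P {ω | ENNReal.ofReal ε < RandQuad.wassersteinDist (RandQuad.cesm hA)
          (RandQuad.protoOutput hA (Q s) fun l => v l ω)} ≤
        ENNReal.ofReal
          (RandQuad.failureBound n N (RandQuad.lamMax hA - RandQuad.lamMin hA) ε)) := by
  refine ⟨fun k hk hs => ?_, fun a b ha hb μ _ hμ s hs Q hQ => ?_,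
    fun a b hab ha hb s hs Q hQ => ?_⟩ <;>
    refine RandQuad.measure_le_failureBound hA hn hN hindep hlaw hε fun ω hω hv => ?_
  · refine RandQuad.lt_wassersteinDist_avgCDF hA hε
      ((RandQuad.wassersteinDist_avgCDF_quadGauss_le hA hn hN hv hk).trans
        (ENNReal.ofReal_le_ofReal ?_)) hω
    have hk' : (0 : ℝ) < k := by exact_mod_cast hk
    have h : Real.pi * (RandQuad.lamMax hA - RandQuad.lamMin hA) * ε⁻¹ ≤ k := by linarith
    rw [← div_eq_mul_inv, div_le_iff₀ hε] at h
    rw [div_le_div_iff₀ (by positivity) two_pos]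
    linarith
  · exact RandQuad.lt_wassersteinDist_avgCDF hA hε
      ((RandQuad.wassersteinDist_avgCDF_quad_le_totalVar hA hn hN hv ha hb hμ (hs ω) hQ).trans
        (RandQuad.ofReal_mul_le_of_threshold hε hω.1)) hω.2
  · refine RandQuad.lt_wassersteinDist_avgCDF hA hε
      ((RandQuad.wassersteinDist_avgCDF_quadDamped_le hA hN hv hab ha hb s hQ).trans
        (ENNReal.ofReal_le_ofReal ?_)) hω
    have h : Real.pi * (Real.pi * (b - a)) * ε⁻¹ ≤ s + 2 := by
      have : Real.pi * (Real.pi * (b - a)) = Real.pi ^ 2 * (b - a) := by ring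
      linarith
    rw [← div_eq_mul_inv, div_le_iff₀ hε] at h
    have h1 : 0 ≤ Real.pi * (b - a) := mul_nonneg Real.pi_pos.le (sub_nonneg.2 hab.le)
    -- The quadrature bound needs only `π (b - a) / ε ≤ s + 2`; the second factor `π` in the
    -- hypothesis is slack.
    have h2 : Real.pi * (b - a) ≤ Real.pi * (Real.pi * (b - a)) :=
      le_mul_of_one_le_left h1 (by linarith [Real.pi_gt_three])
    rw [div_le_div_iff₀ (by positivity) two_pos]
    linarith
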